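/- \textbf{Setting.} Let $P$ be a poset which is the union of its finite order ideals, let $\mathbb{G}=J(P)$ be the set of finite order ideals of $P$, and write $|\lambda|$ for the number of elements ("boxes") of $\lambda\in\mathbb{G}$. Assume that each level $\mathbb{G}_n=\{\lambda:|\lambda|=n\}$ is finite. Write $\mu\nearrow\lambda$ if $\mu\subset\lambda$ and $|\lambda|=|\mu|+1$, and let every such edge carry a multiplicity $\kappa(\mu,\lambda)>0$. Let $\dim(\mu,\lambda)$ be the sum over all oriented paths from $\mu$ to $\lambda$ of the products of the edge multiplicities along the path, let $\dim\lambda=\dim(\varnothing,\lambda)$, and put $$\mathcal P^*_\mu(\lambda)=|\lambda|(|\lambda|-1)\cdots(|\lambda|-|\mu|+1)\,\frac{\dim(\mu,\lambda)}{\dim\lambda}.$$ Let $q$ be a function on $P$, and let $U,D,H$ be operators on the space of finitely supported complex functions on $\mathbb{G}$, with basis vectors $1_\lambda$, such that $$U1_\lambda=\sum_{\nu:\lambda\nearrow\nu}\kappa(\lambda,\nu)\,q(\nu/\lambda)\,1_\nu,\qquad D1_\lambda=\sum_{\mu:\mu\nearrow\lambda}\kappa(\mu,\lambda)\,q(\lambda/\mu)\,1_\mu,$$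 each $1_\lambda$ is an eigenvector of $H$ with an eigenvalue that depends only on $|\lambda|$, and $[H,U]=2U$, $[H,D]=-2D$, $[D,U]=H$. Assume that $H1_\varnothing=t\,1_\varnothing$ with $t>0$, and that the weights $$M_n(\lambda)=\frac1{Z_n}(U^n1_\varnothing,1_\lambda)(D^n1_\lambda,1_\varnothing),\qquad \lambda\in\mathbb{G}_n,$$ where $Z_n$ normalizes their sum over $\mathbb{G}_n$ to $1$, are all positive real numbers. For $\xi\in(0,1)$ let $$M_\xi(\lambda)=(1-\xi)^t\,\frac{(t)_n}{n!}\,\xi^n\,M_n(\lambda),\qquad n=|\lambda|,$$ and let $(f,g)_{M_\xi}=\sum_\lambda f(\lambda)\overline{g(\lambda)}M_\xi(\lambda)$ be the inner product of the complex Hilbert space $\ell^2(\mathbb{G},M_\xi)$. Put $$p^\downarrow(\lambda,\mu)=\frac{\kappa(\mu,\lambda)\dim\mu}{\dim\lambda}\ \ (\mu\nearrow\lambda),\qquad p^\uparrow(\lambda,\nu)=\frac{M_{|\nu|}(\nu)}{M_{|\lambda|}(\lambda)}\,p^\downarrow(\nu,\lambda)\ \ (\lambda\nearrow\nu).$$ Let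 $A_\xi$ be the operator $(A_\xi f)(\lambda)=\sum_\rho Q_{\lambda\rho}f(\rho)$ on finitely supported functions, where, with $n=|\lambda|$, the jump rates are $$Q_{\lambda\mu}=\frac{n}{1-\xi}\,p^\downarrow(\lambda,\mu)\ (\mu\nearrow\lambda),\qquad Q_{\lambda\nu}=\frac{\xi(n+t)}{1-\xi}\,p^\uparrow(\lambda,\nu)\ (\lambda\nearrow\nu),\qquad Q_{\lambda\lambda}=-\frac{n+\xi(n+t)}{1-\xi},$$ and all other rates are $0$. Finally let $$\mathfrak M_\lambda=\sum_{\mu\subseteq\lambda}\Big(\frac{\xi}{\xi-1}\Big)^{|\lambda|-|\mu|}\frac{\dim(\mu,\lambda)}{(|\lambda|-|\mu|)!}\Big(\prod_{\square\in\lambda/\mu}q(\square)^2\Big)\mathcal P^*_\mu,\qquad\lambda\in\mathbb{G}.$$ \textbf{Theorem.} (1) The operator $A_\xi$ is closable in $\ell^2(\mathbb{G},M_\xi)$. Every $\mathfrak M_\lambda$ belongs to $\ell^2(\mathbb{G},M_\xi)$ and to the domain of the closure $\bar A_\xi$, and $\bar A_\xi\mathfrak M_\lambda=-|\lambda|\,\mathfrak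 M_\lambda$. (2) The functions $\mathfrak M_\lambda$, $\lambda\in\mathbb{G}$, form an orthogonal basis of $\ell^2(\mathbb{G},M_\xi)$: they are nonzero, their linear span is dense, and $$(\mathfrak M_\lambda,\mathfrak M_\mu)_{M_\xi}=\delta_{\lambda,\mu}\,\frac{\xi^{|\lambda|}}{(1-\xi)^{2|\lambda|}}\prod_{\square\in\lambda}q(\square)^2 .$$ (3) Suppose in addition that $q(\square)>0$ for all $\square\in P$. Then there is a strongly continuous one-parameter group $(V(s))_{s\in\mathbb R}$ of unitary operators on $\ell^2(\mathbb{G})$ with $\frac{d}{ds}V(s)f\big|_{s=0}=(U-D)f$ for every finitely supported $f$. For every such group, the vector $\mathfrak F_\lambda=V(\operatorname{artanh}\sqrt\xi)\,1_\lambda$ is the function $$\mathfrak F_\lambda(\rho)=\sum_{\mu\subseteq\lambda}\frac{(-1)^{n-m}\xi^{n/2-m}(1-\xi)^m}{(n-m)!}\,\dim(\mu,\lambda)\Big(\prod_{\square\in\lambda/\mu}q(\square)^2\Big)\Big(\prod_{\square\in\lambda}q(\square)^{-1}\Big)M_\xi(\rho)^{1/2}\,\mathcal P^*_\mu(\rho),$$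 where $n=|\lambda|$ and $m=|\mu|$. -/

import Mathlib

open MeasureTheory
open scoped Classical

noncomputable section

/-- A finite order ideal (down-closed finite subset) of a poset `P`. -/
@[ext]
structure FinIdeal (P : Type*) [PartialOrder P] where
  carrier : Finset P
  lower : IsLowerSet (carrier : Set P)

namespace FinIdeal

variable {P : Type*} [PartialOrder P]

/-- All subsets of the (countable, discrete) vertex set are measurable. -/
instance : MeasurableSpace (FinIdeal P) := ⊤

/-- The empty ideal. -/
def empty : FinIdeal P := ⟨∅, by simp [IsLowerSet]⟩

/-- The level `|lam|` of an ideal. -/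
def size (lam : FinIdeal P) : ℕ := lam.carrier.card

/-- The edge relation `mu ↗ lam`: the ideal `lam` is `mu` with one box added. -/
def Covers (mu lam : FinIdeal P) : Prop :=
  mu.carrier ⊆ lam.carrier ∧ lam.size = mu.size + 1

theorem finite_below (lam : FinIdeal P) : {mu : FinIdeal P | mu.carrier ⊆ lam.carrier}.Finite := by
  refine Set.Finite.of_finite_image (f := FinIdeal.carrier)
    ((lam.carrier.powerset.finite_toSet).subset ?_) ?_
  · rintro _ ⟨mu, hmu, rfl⟩
    simpa using hmu
  · intro a _ b _ h
    exact FinIdeal.ext h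

/-- The finite set of all ideals `mu` contained in `lam`. -/
def below (lam : FinIdeal P) : Finset (FinIdeal P) := lam.finite_below.toFinset

/-- The finite set of all `mu` with `mu ↗ lam`. -/
def down (lam : FinIdeal P) : Finset (FinIdeal P) := lam.below.filter fun mu => Covers mu lam

/-- The product of `f` over the boxes of `lam / mu`. When `mu ↗ lam`, this is the value of `f` at
the single box of `lam / mu`. -/
def boxProd (f : P → ℂ) (mu lam : FinIdeal P) : ℂ := ∏ x ∈ lam.carrier \ mu.carrier, f x

end FinIdeal

/-- A graph of ideals `(J(P), κ)`: the vertices are the finite order ideals of the poset `P`, `P` is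
the union of its finite order ideals, every level is finite, and every edge carries a strictly
positive multiplicity. The value of `mult` on a pair that is not an edge is never used. -/
structure IdealGraph (P : Type*) [PartialOrder P] where
  mult : FinIdeal P → FinIdeal P → ℝ
  mult_pos : ∀ mu lam, FinIdeal.Covers mu lam → 0 < mult mu lam
  minimal : ∀ x : P, ∃ lam : FinIdeal P, x ∈ lam.carrier
  level_finite : ∀ n : ℕ, {lam : FinIdeal P | lam.size = n}.Finite

namespace IdealGraph

variable {P : Type*} [PartialOrder P] (G : IdealGraph P)

/-- The `n`-th level. -/
def level (n : ℕ) : Finset (FinIdeal P) := (G.level_finite n).toFinset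

/-- The finite set of all `nu` with `lam ↗ nu`. -/
def up (lam : FinIdeal P) : Finset (FinIdeal P) :=
  (G.level (lam.size + 1)).filter fun nu => FinIdeal.Covers lam nu

/-- The sum of the weights of all oriented paths of length `n` from `mu` to `lam`, the weight of a
path being the product of its edge multiplicities; a path of length `n + 1` is a path of length `n`
from `mu` to some `nu` followed by an edge `nu ↗ lam`. -/
def pathSum : ℕ → FinIdeal P → FinIdeal P → ℝ
  | 0, mu, lam => if mu = lam then 1 else 0
  | n + 1, mu, lam => ∑ nu ∈ lam.down, pathSum n mu nu * G.mult nu lam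

/-- The relative dimension `dim(mu, lam)`: the sum of the weights of all oriented paths from `mu` to
`lam`. All of them have length `|lam| - |mu|`; if `|lam| < |mu|` there are none, and the value is
`0`. -/
def relDim (mu lam : FinIdeal P) : ℝ := G.pathSum (lam.size - mu.size) mu lam

/-- The dimension `dim lam`. -/
def dim (lam : FinIdeal P) : ℝ := G.relDim FinIdeal.empty lam

/-- The relative dimension function `P*_mu`, which involves a falling factorial power of `|lam|`. -/
def relDimFun (mu lam : FinIdeal P) : ℝ :=
  (lam.size.descFactorial mu.size : ℝ) * G.relDim mu lam / G.dim lam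

/-! Finitely supported complex functions on the graph are `FinIdeal P →₀ ℂ`, and the basis vector
of `lam` is `Finsupp.single lam 1`. -/

/-- The up operator, which takes the basis vector of `lam` to
`∑_{nu : lam ↗ nu} κ(lam, nu) q(nu / lam) 1_nu`. -/
def upOp (q : P → ℂ) : Module.End ℂ (FinIdeal P →₀ ℂ) :=
  Finsupp.linearCombination ℂ fun lam =>
    ∑ nu ∈ G.up lam, Finsupp.single nu ((G.mult lam nu : ℂ) * FinIdeal.boxProd q lam nu)

/-- The down operator, which takes the basis vector of `lam` to
`∑_{mu : mu ↗ lam} κ(mu, lam) q(lam / mu) 1_mu`. -/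
def downOp (q : P → ℂ) : Module.End ℂ (FinIdeal P →₀ ℂ) :=
  Finsupp.linearCombination ℂ fun lam =>
    ∑ mu ∈ lam.down, Finsupp.single mu ((G.mult mu lam : ℂ) * FinIdeal.boxProd q mu lam)

/-- `(U, D, H)`, with `U` and `D` the up and down operators of the function `q`, is a triplet of
Kerov operators: the three operators represent `sl(2, ℂ)`, and each basis vector is an eigenvector
of `H` whose eigenvalue depends only on the level. -/
structure IsKerovTriplet (q : P → ℂ) (H : Module.End ℂ (FinIdeal P →₀ ℂ)) : Prop where
  eigen : ∃ h : ℕ → ℂ, ∀ lam : FinIdeal P,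
    H (Finsupp.single lam 1) = h lam.size • Finsupp.single lam 1
  comm_H_U : H * G.upOp q - G.upOp q * H = (2 : ℂ) • G.upOp q
  comm_H_D : H * G.downOp q - G.downOp q * H = -((2 : ℂ) • G.downOp q)
  comm_D_U : G.downOp q * G.upOp q - G.upOp q * G.downOp q = H

/-- The matrix-coefficient product `(Uⁿ 1_∅, 1_lam) (Dⁿ 1_lam, 1_∅)`. -/
def coherentWeight (q : P → ℂ) (n : ℕ) (lam : FinIdeal P) : ℂ :=
  (G.upOp q ^ n) (Finsupp.single FinIdeal.empty 1) lam *
    (G.downOp q ^ n) (Finsupp.single lam 1) FinIdeal.empty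

/-- The complex-valued coherent system: the value `M_n(lam)`, where `n = |lam|`, of the normalized
weights on the level of `lam`. -/
def coherent (q : P → ℂ) (lam : FinIdeal P) : ℂ :=
  G.coherentWeight q lam.size lam / ∑ rho ∈ G.level lam.size, G.coherentWeight q lam.size rho

/-- The coherent system is a nondegenerate system of positive probability measures: every value
`M_n(lam)` is a positive real number. -/
def IsPositive (q : P → ℂ) : Prop :=
  ∀ lam : FinIdeal P, (G.coherent q lam).im = 0 ∧ 0 < (G.coherent q lam).re

/-- The value `M_n(lam)`, `n = |lam|`, of a real-valued coherent system, as a real number. -/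
def floorMeasure (q : P → ℂ) (lam : FinIdeal P) : ℝ := (G.coherent q lam).re

/-- The negative binomial weights `(1 - ξ)^t (t)_n / n! ξ^n`. -/
def _root_.negBinomialWeight (t ξ : ℝ) (n : ℕ) : ℝ :=
  (1 - ξ) ^ t * ((ascPochhammer ℝ n).eval t / (n.factorial : ℝ)) * ξ ^ n

/-- The mixed measure `M_ξ` of the singleton `{lam}`. -/
def mixedWeight (q : P → ℂ) (t ξ : ℝ) (lam : FinIdeal P) : ℝ :=
  negBinomialWeight t ξ lam.size * G.floorMeasure q lam

/-- The mixed measure `M_ξ`. -/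
def mixedMeasure (q : P → ℂ) (t ξ : ℝ) : Measure (FinIdeal P) :=
  Measure.sum fun lam => ENNReal.ofReal (G.mixedWeight q t ξ lam) • Measure.dirac lam

/-- Down transition probabilities from `lam` to `mu`. -/
def downProb (lam mu : FinIdeal P) : ℝ :=
  if FinIdeal.Covers mu lam then G.mult mu lam * G.dim mu / G.dim lam else 0

/-- Up transition probabilities from `lam` to `nu`. -/
def upProb (q : P → ℂ) (lam nu : FinIdeal P) : ℝ :=
  if FinIdeal.Covers lam nu then
    G.floorMeasure q nu / G.floorMeasure q lam * G.downProb nu lam else 0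

/-- The jump rates of the Markov jump dynamics on the graph. -/
def jumpRate (q : P → ℂ) (t ξ : ℝ) (lam rho : FinIdeal P) : ℝ :=
  if rho = lam then -((lam.size + ξ * (lam.size + t)) / (1 - ξ))
  else if FinIdeal.Covers rho lam then lam.size / (1 - ξ) * G.downProb lam rho
  else if FinIdeal.Covers lam rho then
    ξ * (lam.size + t) / (1 - ξ) * G.upProb q lam rho
  else 0

/-- The function `lam ↦ ∑_rho Q(lam, rho) f(rho)` for a finitely supported `f`. -/
def jumpFun (q : P → ℂ) (t ξ : ℝ) (f : FinIdeal P →₀ ℂ) (lam : FinIdeal P) : ℂ :=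
  f.sum fun rho c => (G.jumpRate q t ξ lam rho : ℂ) * c

/-- The weighted Hilbert space `ℓ²(J(P), M_ξ)`. -/
abbrev WeightedL2 (q : P → ℂ) (t ξ : ℝ) : Type _ :=
  Lp ℂ 2 (G.mixedMeasure q t ξ)

/-- The graph of the pre-generator: the pairs `(f, A_ξ f)` with `f` finitely supported. -/
def preGeneratorGraph (q : P → ℂ) (t ξ : ℝ) :
    Submodule ℂ (G.WeightedL2 q t ξ × G.WeightedL2 q t ξ) where
  carrier := {p | ∃ f : FinIdeal P →₀ ℂ,
    p.1 =ᵐ[G.mixedMeasure q t ξ] (f : FinIdeal P → ℂ) ∧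
    p.2 =ᵐ[G.mixedMeasure q t ξ] G.jumpFun q t ξ f}
  zero_mem' := by
    refine ⟨0, ?_, ?_⟩
    · filter_upwards [Lp.coeFn_zero ℂ 2 (G.mixedMeasure q t ξ)] with x hx
      simpa using hx
    · filter_upwards [Lp.coeFn_zero ℂ 2 (G.mixedMeasure q t ξ)] with x hx
      simpa [jumpFun] using hx
  add_mem' := by
    rintro a b ⟨f, hf1, hf2⟩ ⟨g, hg1, hg2⟩
    refine ⟨f + g, ?_, ?_⟩
    · filter_upwards [Lp.coeFn_add a.1 b.1, hf1, hg1] with x hx h1 h2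
      simp only [Prod.fst_add, hx, Pi.add_apply, h1, h2, Finsupp.coe_add]
    · filter_upwards [Lp.coeFn_add a.2 b.2, hf2, hg2] with x hx h1 h2
      simp only [Prod.snd_add, hx, Pi.add_apply, h1, h2, jumpFun]
      rw [Finsupp.sum_add_index' (by simp) (by intros; ring)]
  smul_mem' := by
    rintro c a ⟨f, hf1, hf2⟩
    refine ⟨c • f, ?_, ?_⟩
    · filter_upwards [Lp.coeFn_smul c a.1, hf1] with x hx h1
      simp [hx, h1]
    · filter_upwards [Lp.coeFn_smul c a.2, hf2] with x hx h1
      simp only [Prod.smul_snd, hx, Pi.smul_apply, h1, jumpFun, smul_eq_mul]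
      rw [Finsupp.sum_smul_index (by simp), Finsupp.mul_sum]
      refine Finsupp.sum_congr fun i _ => ?_
      ring

/-- The operator `A_ξ`, `(A_ξ f)(lam) = ∑_rho Q(lam, rho) f(rho)`, in `ℓ²(J(P), M_ξ)`, whose domain
is the space of finitely supported functions. The Markov generator is its closure. -/
def preGenerator (q : P → ℂ) (t ξ : ℝ) : G.WeightedL2 q t ξ →ₗ.[ℂ] G.WeightedL2 q t ξ :=
  (G.preGeneratorGraph q t ξ).toLinearPMap

/-- The functions `𝔐_lam`. -/
def meixner (q : P → ℂ) (ξ : ℝ) (lam rho : FinIdeal P) : ℂ :=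
  ∑ mu ∈ lam.below,
    ((ξ / (ξ - 1) : ℝ) : ℂ) ^ (lam.size - mu.size) *
      ((G.relDim mu lam / ((lam.size - mu.size).factorial : ℝ) : ℝ) : ℂ) *
      FinIdeal.boxProd (fun x => q x ^ 2) mu lam * (G.relDimFun mu rho : ℂ)

/-- The unweighted Hilbert space `ℓ²(J(P))`. -/
abbrev _root_.FinIdeal.Ell2 (P : Type*) [PartialOrder P] : Type _ :=
  lp (fun _ : FinIdeal P => ℂ) 2

/-- The inclusion of the finitely supported functions into `ℓ²(J(P))`. -/
def _root_.FinIdeal.toEll2 (f : FinIdeal P →₀ ℂ) : FinIdeal.Ell2 P :=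
  f.sum fun lam c => lp.single (E := fun _ : FinIdeal P => ℂ) 2 lam c

/-- `V` is a strongly continuous one-parameter group of unitary operators in `ℓ²(J(P))` whose
infinitesimal generator extends the operator `U - D` on the finitely supported functions. -/
structure IsIntegral (q : P → ℂ)
    (V : ℝ → (FinIdeal.Ell2 P ≃ₗᵢ[ℂ] FinIdeal.Ell2 P)) : Prop where
  map_zero : V 0 = 1
  map_add : ∀ r s : ℝ, V (r + s) = V r * V s
  continuous : ∀ f : FinIdeal.Ell2 P, Continuous fun s => V s f
  deriv : ∀ f : FinIdeal P →₀ ℂ,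
    HasDerivAt (fun s : ℝ => V s (FinIdeal.toEll2 f))
      (FinIdeal.toEll2 ((G.upOp q - G.downOp q) f)) 0

/-- The explicit expression for the functions `𝔉_lam`; with `n = |lam|`, `m = |mu|`, the `mu`-th
term is `(-1)^(n-m) ξ^(n/2-m) (1-ξ)^m / (n-m)! dim(mu, lam) ∏_{lam/mu} q² ∏_{lam} q⁻¹` times
`M_ξ^(1/2) P*_mu`. -/
def frakF (q : P → ℂ) (t ξ : ℝ) (lam rho : FinIdeal P) : ℂ :=
  ∑ mu ∈ lam.below,
    (((-1) ^ (lam.size - mu.size) * ξ ^ ((lam.size : ℝ) / 2 - mu.size) * (1 - ξ) ^ mu.size /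
        ((lam.size - mu.size).factorial : ℝ) * G.relDim mu lam : ℝ) : ℂ) *
      FinIdeal.boxProd (fun x => q x ^ 2) mu lam *
      FinIdeal.boxProd (fun x => (q x)⁻¹) FinIdeal.empty lam *
      ((Real.sqrt (G.mixedWeight q t ξ rho) * G.relDimFun mu rho : ℝ) : ℂ)

end IdealGraph

end

/-!
The values of `q` are real and nonzero because the weights `M_n` are positive
(`IsPositive.sq_eq`), and only `q²` enters the first two parts. Flipping the signs of the basis
vectors replaces `q` by `a = |q|` without changing the commutation relations
(`IsKerovTriplet.comm_edgeWeight`). After that `U` and `D` are given by real matrices which are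
transposes of each other, and `[D, U] = 2 n + t` on level `n`. This is the structure `SlNetwork`.

Disentangling the exponential suggests
`exp (s (U - D)) = exp (r U) (1 - r²) ^ (H / 2) exp (-r D)` with `r = tanh s`. Applied to a basis
vector, the right-hand side is at every vertex a finite sum; it defines the functions `meix r lam`,
and the commutation relations show that they solve `x' = (U - D) x` (`hasDerivAt_meix`,
`isFlow_flow`) and are eigenvectors of the conjugate of `H` (`meix_eigen`). An induction on the
level bounds `‖U f‖² ≤ (n + 1) (n + t) ‖f‖²` on level `n`. Hence `‖U ^ k f‖ / k!` grows
polynomially in `k`, and `meix r lam` decays faster than every power of the level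
(`exists_sqn_meix_le` records the one power that is needed).

On the levels up to `n`, the operator `U - D` is skew-symmetric up to a boundary term
(`ballPair_green`). The decay makes this term vanish in the limit, so that the pairing of a bounded
solution of `x' = (U - D) x` with an explicit one is constant in time (`tendsto_ballPair_sub`).
Everything about the group follows: the explicit solutions at a fixed time are orthonormal, they
satisfy the group law, and a bounded solution is determined by its initial value. This gives the
unitary group `SlNetwork.group` and the uniqueness statement `eq_flowVec_of_hasDerivAt`; as the
group consists of surjective isometries, the explicit solutions at a fixed time form an
orthonormal basis.

It remains to translate. With `ξ = r²`, the square root of the weight `M_ξ` is `rootWeight`; after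
multiplication by it, the functions `P*_mu` become multiples of `exp (r U) 1_mu`, the functions
`𝔐_lam` multiples of `meix r lam` (`IsNetwork.meixner_eq`), and the generator becomes
`(1 - r²)⁻¹ markov r` (`IsNetwork.rootWeight_mul_jumpFun`), for which `meix r lam` is an
eigenvector. The generator is closable since each value of `A_ξ f` is a finite combination of
values of `f` (`apply_eq_of_mem_closure_preGeneratorGraph`). The truncations of `meix r lam`
converge to it in the graph norm, again because the boundary terms vanish
(`tendsto_finVec_markov`), which puts `𝔐_lam` into the domain of the closure.
-/

noncomputable section

open Filter Topology

/-! ### Graded networks with an `sl(2)` action -/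

/-- A graded graph with finite levels and real edge weights between consecutive levels, whose up
and down operators satisfy `D U - U D = 2 |x| + t` on functions. The weights are recorded on all
pairs of vertices and vanish on pairs that do not lie on consecutive levels. -/
structure SlNetwork (X : Type*) where
  size : X → ℕ
  level : ℕ → Finset X
  mem_level : ∀ n x, x ∈ level n ↔ size x = n
  w : X → X → ℝ
  w_eq_zero : ∀ x y, size y ≠ size x + 1 → w x y = 0
  t : ℝ
  t_pos : 0 < t
  comm : ∀ x y, size x = size y →
    ∑ z ∈ level (size x + 1), w x z * w y z - ∑ z ∈ level (size x - 1), w z x * w z y =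
      if x = y then 2 * (size x : ℝ) + t else 0

namespace SlNetwork

variable {X : Type*} (N : SlNetwork X)

/-- The up operator on arbitrary functions. Functions are read as formal sums of vertices, so the
value at `y` collects the edges that end at `y`. -/
def up : (X → ℝ) →ₗ[ℝ] (X → ℝ) where
  toFun f y := ∑ x ∈ N.level (N.size y - 1), N.w x y * f x
  map_add' f g := by
    ext y; simp [mul_add, Finset.sum_add_distrib]
  map_smul' c f := by
    ext y; simp only [Pi.smul_apply, smul_eq_mul, RingHom.id_apply, Finset.mul_sum]
    exact Finset.sum_congr rfl fun _ _ => by ring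

/-- The down operator on arbitrary functions. -/
def down : (X → ℝ) →ₗ[ℝ] (X → ℝ) where
  toFun f x := ∑ y ∈ N.level (N.size x + 1), N.w x y * f y
  map_add' f g := by
    ext y; simp [mul_add, Finset.sum_add_distrib]
  map_smul' c f := by
    ext y; simp only [Pi.smul_apply, smul_eq_mul, RingHom.id_apply, Finset.mul_sum]
    exact Finset.sum_congr rfl fun _ _ => by ring

/-- The grading operator, with eigenvalue `2 n + t` on level `n`. -/
def grade : (X → ℝ) →ₗ[ℝ] (X → ℝ) where
  toFun f x := (2 * (N.size x : ℝ) + N.t) * f x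
  map_add' f g := by ext y; simp [mul_add]
  map_smul' c f := by ext y; simp; ring

theorem up_apply (f : X → ℝ) (y : X) :
    N.up f y = ∑ x ∈ N.level (N.size y - 1), N.w x y * f x := rfl

theorem down_apply (f : X → ℝ) (x : X) :
    N.down f x = ∑ y ∈ N.level (N.size x + 1), N.w x y * f y := rfl

theorem grade_apply (f : X → ℝ) (x : X) :
    N.grade f x = (2 * (N.size x : ℝ) + N.t) * f x := rfl

theorem up_apply_of_size_eq_zero (f : X → ℝ) {y : X} (hy : N.size y = 0) : N.up f y = 0 :=
  Finset.sum_eq_zero fun x _ => by rw [N.w_eq_zero x y (by omega), zero_mul]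

theorem up_apply_of_size {f : X → ℝ} {y : X} {n : ℕ} (hy : N.size y = n + 1) :
    N.up f y = ∑ x ∈ N.level n, N.w x y * f x := by
  rw [up_apply, hy, Nat.add_sub_cancel]

theorem down_apply_of_size {f : X → ℝ} {x : X} {n : ℕ} (hx : N.size x = n) :
    N.down f x = ∑ y ∈ N.level (n + 1), N.w x y * f y := by
  rw [down_apply, hx]

theorem down_up (f : X → ℝ) : N.down (N.up f) = N.up (N.down f) + N.grade f := by
  ext x
  have h1 : N.down (N.up f) x = ∑ y ∈ N.level (N.size x),
      (∑ z ∈ N.level (N.size x + 1), N.w x z * N.w y z) * f y := by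
    rw [down_apply]
    simp_rw [Finset.sum_mul]
    rw [Finset.sum_comm]
    refine Finset.sum_congr rfl fun z hz => ?_
    rw [N.up_apply_of_size ((N.mem_level _ _).1 hz), Finset.mul_sum]
    exact Finset.sum_congr rfl fun _ _ => by ring
  have h2 : N.up (N.down f) x = ∑ y ∈ N.level (N.size x),
      (∑ z ∈ N.level (N.size x - 1), N.w z x * N.w z y) * f y := by
    rw [up_apply]
    simp_rw [Finset.sum_mul]
    rw [Finset.sum_comm]
    refine Finset.sum_congr rfl fun z hz => ?_
    rw [N.mem_level] at hz
    rcases Nat.eq_zero_or_pos (N.size x) with h0 | h0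
    · rw [N.w_eq_zero z x (by omega)]; simp
    · rw [N.down_apply_of_size (n := N.size x - 1) hz, Nat.sub_add_cancel h0, Finset.mul_sum]
      exact Finset.sum_congr rfl fun _ _ => by ring
  have h3 : N.grade f x = ∑ y ∈ N.level (N.size x),
      (if x = y then 2 * (N.size x : ℝ) + N.t else 0) * f y := by
    rw [grade_apply]
    simp [ite_mul, N.mem_level]
  rw [Pi.add_apply, h1, h2, h3, ← Finset.sum_add_distrib]
  refine Finset.sum_congr rfl fun y hy => ?_
  rw [N.mem_level] at hy
  rw [← N.comm x y hy.symm]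
  ring

theorem grade_up (f : X → ℝ) : N.grade (N.up f) = N.up (N.grade f) + (2 : ℝ) • N.up f := by
  ext x
  rcases Nat.eq_zero_or_pos (N.size x) with h0 | h0
  · simp [grade_apply, N.up_apply_of_size_eq_zero _ h0]
  · obtain ⟨n, hn⟩ : ∃ n, N.size x = n + 1 := ⟨N.size x - 1, by omega⟩
    simp only [grade_apply, Pi.add_apply, Pi.smul_apply, smul_eq_mul, N.up_apply_of_size hn, hn,
      Finset.mul_sum, ← Finset.sum_add_distrib]
    refine Finset.sum_congr rfl fun y hy => ?_
    rw [N.mem_level] at hy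
    rw [hy]; push_cast; ring

theorem grade_up_pow (k : ℕ) (f : X → ℝ) :
    N.grade ((N.up ^ k) f) = (N.up ^ k) (N.grade f) + (2 * k : ℝ) • (N.up ^ k) f := by
  induction k with
  | zero => simp
  | succ k ih =>
    rw [pow_succ', Module.End.mul_apply, grade_up, ih, map_add, map_smul]
    simp only [Module.End.mul_apply]
    push_cast
    module

/-- The commutator of `D` with `U ^ (k + 1)` is `(k + 1) U ^ k (H + k)`. -/
theorem down_up_pow (k : ℕ) (f : X → ℝ) :
    N.down ((N.up ^ (k + 1)) f) = (N.up ^ (k + 1)) (N.down f) +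
      (k + 1 : ℝ) • (N.up ^ k) (N.grade f) + ((k + 1) * k : ℝ) • (N.up ^ k) f := by
  induction k with
  | zero => simp [down_up]
  | succ k ih =>
    rw [pow_succ', Module.End.mul_apply, down_up, ih, grade_up_pow]
    simp only [map_add, map_smul]
    rw [← Module.End.mul_apply N.up (N.up ^ (k + 1)), ← pow_succ',
      ← Module.End.mul_apply N.up (N.up ^ k), ← Module.End.mul_apply N.up (N.up ^ k), ← pow_succ']
    push_cast
    module

theorem up_pow_apply_eq_zero {k : ℕ} {f : X → ℝ} {x : X} (h : N.size x < k) :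
    (N.up ^ k) f x = 0 := by
  induction k generalizing x with
  | zero => omega
  | succ k ih =>
    rw [pow_succ', Module.End.mul_apply]
    rcases Nat.eq_zero_or_pos (N.size x) with h0 | h0
    · exact N.up_apply_of_size_eq_zero _ h0
    · rw [up_apply]
      refine Finset.sum_eq_zero fun y hy => ?_
      rw [N.mem_level] at hy
      rw [ih (by omega), mul_zero]

/-- The exponential `exp (r U)` on arbitrary functions. The sum stops at the level of the vertex,
beyond which the powers of `U` vanish there. -/
def expUp (r : ℝ) : (X → ℝ) →ₗ[ℝ] (X → ℝ) where
  toFun f x := ∑ k ∈ Finset.range (N.size x + 1), r ^ k / (k.factorial : ℝ) * (N.up ^ k) f x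
  map_add' f g := by ext y; simp [mul_add, Finset.sum_add_distrib]
  map_smul' c f := by
    ext y; simp only [map_smul, Pi.smul_apply, smul_eq_mul, RingHom.id_apply, Finset.mul_sum]
    exact Finset.sum_congr rfl fun _ _ => by ring

theorem expUp_apply (r : ℝ) (f : X → ℝ) {x : X} {K : ℕ} (hK : N.size x < K) :
    N.expUp r f x = ∑ k ∈ Finset.range K, r ^ k / (k.factorial : ℝ) * (N.up ^ k) f x := by
  refine Finset.sum_subset (Finset.range_mono hK) fun k _ hk => ?_
  rw [N.up_pow_apply_eq_zero (by simpa [Nat.lt_succ_iff] using hk), mul_zero]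

theorem up_expUp (r : ℝ) (f : X → ℝ) : N.up (N.expUp r f) = N.expUp r (N.up f) := by
  ext x
  rw [N.expUp_apply r _ (Nat.lt_succ_self (N.size x)), up_apply]
  simp_rw [← Module.End.mul_apply (_ ^ _) N.up, ← pow_succ, pow_succ', Module.End.mul_apply,
    up_apply, Finset.mul_sum]
  rw [Finset.sum_comm]
  refine Finset.sum_congr rfl fun y hy => ?_
  rw [N.mem_level] at hy
  rw [N.expUp_apply r f (K := (N.size x).succ) (by omega), Finset.mul_sum]
  exact Finset.sum_congr rfl fun _ _ => by ring

/-- The conjugate of `D` by `exp (r U)` is `D + r H + r² U`. -/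
theorem down_expUp (r : ℝ) (f : X → ℝ) :
    N.down (N.expUp r f) = N.expUp r (N.down f + r • N.grade f + r ^ 2 • N.up f) := by
  ext x
  set n := N.size x with hn
  have h1 : N.down (N.expUp r f) x = ∑ k ∈ Finset.range (n + 2),
      r ^ k / (k.factorial : ℝ) * N.down ((N.up ^ k) f) x := by
    simp_rw [down_apply, Finset.mul_sum]
    rw [Finset.sum_comm]
    refine Finset.sum_congr rfl fun y hy => ?_
    rw [N.mem_level] at hy
    rw [N.expUp_apply r f (K := n + 2) (by omega), Finset.mul_sum]
    exact Finset.sum_congr rfl fun _ _ => by ring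
  -- the factors `k + 1` and `(k + 1) k` of the commutator lower the index of the exponential series
  have hfac : ∀ k : ℕ, r ^ (k + 1) / ((k + 1).factorial : ℝ) * (k + 1) =
      r * (r ^ k / (k.factorial : ℝ)) := fun k => by
    rw [Nat.factorial_succ]
    have := Nat.factorial_ne_zero k
    push_cast
    field_simp
    ring
  have h2 : ∑ k ∈ Finset.range (n + 1), r * (r ^ k / (k.factorial : ℝ)) * k * (N.up ^ k) f x =
      r ^ 2 * N.expUp r (N.up f) x := by
    rw [Finset.sum_range_succ', N.expUp_apply r (N.up f) (K := n + 1) (by omega),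
      Finset.sum_range_succ (n := n), ← Module.End.mul_apply (N.up ^ n), ← pow_succ,
      N.up_pow_apply_eq_zero (k := n + 1) (by omega)]
    simp only [Nat.cast_zero, mul_zero, zero_mul, add_zero, Finset.mul_sum]
    refine Finset.sum_congr rfl fun k _ => ?_
    rw [pow_succ N.up, Module.End.mul_apply]
    have := hfac k
    push_cast
    linear_combination (r * (N.up ^ k) (N.up f) x) * this
  have h3 : N.expUp r (N.down f) x = ∑ k ∈ Finset.range (n + 1),
      r ^ (k + 1) / ((k + 1).factorial : ℝ) * (N.up ^ (k + 1)) (N.down f) x + N.down f x := by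
    rw [N.expUp_apply r (N.down f) (K := n + 1 + 1) (by omega), Finset.sum_range_succ']
    simp
  rw [h1, Finset.sum_range_succ' _ (n + 1)]
  simp only [map_add, map_smul, Pi.add_apply, Pi.smul_apply, smul_eq_mul, down_up_pow]
  rw [← h2, h3, N.expUp_apply r (N.grade f) (K := n + 1) (by omega)]
  simp only [pow_zero, Module.End.one_apply, Finset.mul_sum, Nat.factorial_zero, Nat.cast_one,
    div_one, one_mul]
  have : ∀ a b c d e : ℝ, a = b + d + e → a + c = b + c + d + e := by intros; linarith
  refine this _ _ _ _ _ ?_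
  rw [← Finset.sum_add_distrib, ← Finset.sum_add_distrib]
  refine Finset.sum_congr rfl fun k _ => ?_
  have := hfac k
  linear_combination ((N.up ^ k) (N.grade f) x + k * (N.up ^ k) f x) * this

/-- The conjugate of `H` by `exp (r U)` is `H + 2 r U`. It is read off from the conjugates of `D`
and `U`, as `H` is their commutator. -/
theorem grade_expUp (r : ℝ) (f : X → ℝ) :
    N.grade (N.expUp r f) = N.expUp r (N.grade f + (2 * r) • N.up f) := by
  have h1 := N.down_up (N.expUp r f)
  rw [up_expUp, down_expUp, down_expUp, up_expUp, down_up, grade_up] at h1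
  rw [eq_comm, ← eq_sub_iff_add_eq'] at h1
  rw [h1, ← map_sub]
  congr 1
  simp only [map_add, map_smul]
  module

theorem hasDerivAt_expUp (r : ℝ) (f : X → ℝ) (x : X) :
    HasDerivAt (fun r => N.expUp r f x) (N.expUp r (N.up f) x) r := by
  set n := N.size x with hn
  have h : HasDerivAt (fun r : ℝ => ∑ k ∈ Finset.range (n + 1),
      r ^ k / (k.factorial : ℝ) * (N.up ^ k) f x)
      (∑ k ∈ Finset.range (n + 1), (k * r ^ (k - 1)) / (k.factorial : ℝ) * (N.up ^ k) f x) r :=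
    HasDerivAt.fun_sum fun k _ => ((hasDerivAt_pow k r).div_const _).mul_const _
  convert! h using 1
  rw [Finset.sum_range_succ', N.expUp_apply r (N.up f) (K := n + 1) (by omega),
    Finset.sum_range_succ (n := n), ← Module.End.mul_apply (N.up ^ n), ← pow_succ,
    N.up_pow_apply_eq_zero (k := n + 1) (by omega)]
  simp only [Nat.cast_zero, mul_zero, zero_mul, add_zero, zero_div]
  refine Finset.sum_congr rfl fun k _ => ?_
  rw [pow_succ N.up, Module.End.mul_apply, Nat.factorial_succ, Nat.add_sub_cancel]
  have := Nat.factorial_ne_zero k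
  push_cast
  field_simp

end SlNetwork

/-! ### The disentangled exponential of `U - D` -/

namespace SlNetwork

variable {X : Type*} (N : SlNetwork X)

/-- The indicator of a vertex. -/
def ket (lam : X) : X → ℝ := Pi.single lam 1

theorem down_pow_ket_apply {lam x : X} {j : ℕ} (h : N.size x + j ≠ N.size lam) :
    (N.down ^ j) (ket lam) x = 0 := by
  induction j generalizing x with
  | zero =>
    rw [pow_zero, Module.End.one_apply, ket, Pi.single_apply, if_neg]
    rintro rfl
    exact h rfl
  | succ j ih =>
    rw [pow_succ', Module.End.mul_apply, down_apply]
    refine Finset.sum_eq_zero fun y hy => ?_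
    rw [N.mem_level] at hy
    rw [ih (by omega), mul_zero]

theorem down_pow_size_succ_ket (lam : X) : (N.down ^ (N.size lam + 1)) (ket lam) = 0 := by
  ext x
  exact N.down_pow_ket_apply (by omega)

theorem grade_down_pow_ket (lam : X) (j : ℕ) :
    N.grade ((N.down ^ j) (ket lam)) =
      (2 * ((N.size lam : ℝ) - j) + N.t) • (N.down ^ j) (ket lam) := by
  ext x
  rw [grade_apply, Pi.smul_apply, smul_eq_mul]
  by_cases h : N.size x + j = N.size lam
  · rw [← h]; push_cast; ring
  · rw [N.down_pow_ket_apply h, mul_zero, mul_zero]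

/-- The scalar by which `(1 - r²) ^ (H / 2) exp (-r D)` multiplies the component `D ^ j` of a
vector of level `n`. -/
def coef (n j : ℕ) (r : ℝ) : ℝ :=
  (-r) ^ j / (j.factorial : ℝ) * (1 - r ^ 2) ^ ((n : ℝ) - j + N.t / 2)

/-- The function `exp (r U) (1 - r²) ^ (H / 2) exp (-r D) 1_lam`. At `r = tanh s` this is
`exp (s (U - D)) 1_lam`. -/
def meix (r : ℝ) (lam : X) : X → ℝ :=
  ∑ j ∈ Finset.range (N.size lam + 1),
    N.coef (N.size lam) j r • N.expUp r ((N.down ^ j) (ket lam))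

/-- The function `exp (r U) H (1 - r²) ^ (H / 2) exp (-r D) 1_lam`. -/
def meixGrade (r : ℝ) (lam : X) : X → ℝ :=
  ∑ j ∈ Finset.range (N.size lam + 1),
    (N.coef (N.size lam) j r * (2 * ((N.size lam : ℝ) - j) + N.t)) •
      N.expUp r ((N.down ^ j) (ket lam))

/-- The terms of `meix` with one more factor `D`. -/
def meixShift (r : ℝ) (lam : X) : X → ℝ :=
  ∑ j ∈ Finset.range (N.size lam + 1),
    N.coef (N.size lam) j r • N.expUp r ((N.down ^ (j + 1)) (ket lam))

theorem coef_succ {r : ℝ} (hr : 0 < 1 - r ^ 2) (n j : ℕ) :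
    (j + 1) * (1 - r ^ 2) * N.coef n (j + 1) r = -(r * N.coef n j r) := by
  have h : (n : ℝ) - j + N.t / 2 = ((n : ℝ) - (j + 1 : ℕ) + N.t / 2) + 1 := by push_cast; ring
  rw [coef, coef, h, Real.rpow_add_one hr.ne', Nat.factorial_succ]
  have := Nat.factorial_ne_zero j
  push_cast
  field_simp
  ring

theorem hasDerivAt_rpow_one_sub_sq {r : ℝ} (hr : 0 < 1 - r ^ 2) (p : ℝ) :
    HasDerivAt (fun r : ℝ => (1 - r ^ 2) ^ p)
      (-((1 - r ^ 2)⁻¹ * (2 * r * p * (1 - r ^ 2) ^ p))) r := by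
  have h := ((hasDerivAt_pow 2 r).const_sub 1).rpow_const (p := p) (Or.inl hr.ne')
  convert! h using 1
  rw [Real.rpow_sub_one hr.ne']
  simp
  field_simp

theorem hasDerivAt_coef_zero {r : ℝ} (hr : 0 < 1 - r ^ 2) (n : ℕ) :
    HasDerivAt (N.coef n 0)
      (-((1 - r ^ 2)⁻¹ * (r * (N.coef n 0 r * (2 * ((n : ℝ) - (0 : ℕ)) + N.t))))) r := by
  have h := hasDerivAt_rpow_one_sub_sq hr ((n : ℝ) - (0 : ℕ) + N.t / 2)
  convert! h using 1
  · ext r; simp [coef]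
  · simp only [coef, pow_zero, Nat.factorial_zero, Nat.cast_one, div_one, one_mul]; ring

theorem hasDerivAt_coef_succ {r : ℝ} (hr : 0 < 1 - r ^ 2) (n j : ℕ) :
    HasDerivAt (N.coef n (j + 1))
      (-((1 - r ^ 2)⁻¹ * (N.coef n j r +
        r * (N.coef n (j + 1) r * (2 * ((n : ℝ) - (j + 1 : ℕ)) + N.t))))) r := by
  have h1 : HasDerivAt (fun r : ℝ => (-r) ^ (j + 1) / ((j + 1).factorial : ℝ))
      (-((-r) ^ j / (j.factorial : ℝ))) r := by
    have := ((hasDerivAt_neg r).pow (j + 1)).div_const ((j + 1).factorial : ℝ)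
    convert! this using 1
    rw [Nat.factorial_succ]
    have := Nat.factorial_ne_zero j
    push_cast
    field_simp
  have h := h1.mul (hasDerivAt_rpow_one_sub_sq hr ((n : ℝ) - (j + 1 : ℕ) + N.t / 2))
  convert! h using 1
  have h2 : (n : ℝ) - j + N.t / 2 = ((n : ℝ) - (j + 1 : ℕ) + N.t / 2) + 1 := by push_cast; ring
  rw [coef, coef, h2, Real.rpow_add_one hr.ne']
  field_simp
  ring

theorem up_meix (r : ℝ) (lam : X) : N.up (N.meix r lam) =
    ∑ j ∈ Finset.range (N.size lam + 1),
      N.coef (N.size lam) j r • N.expUp r (N.up ((N.down ^ j) (ket lam))) := by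
  simp only [meix, map_sum, map_smul, up_expUp]

theorem down_meix (r : ℝ) (lam : X) : N.down (N.meix r lam) =
    N.meixShift r lam + r • N.meixGrade r lam + r ^ 2 • N.up (N.meix r lam) := by
  rw [up_meix, meixShift, meixGrade, meix, map_sum, Finset.smul_sum, Finset.smul_sum,
    ← Finset.sum_add_distrib, ← Finset.sum_add_distrib]
  refine Finset.sum_congr rfl fun j _ => ?_
  rw [map_smul, down_expUp, grade_down_pow_ket, pow_succ' N.down, Module.End.mul_apply]
  simp only [map_add, map_smul]
  module

theorem grade_meix (r : ℝ) (lam : X) : N.grade (N.meix r lam) =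
    N.meixGrade r lam + (2 * r) • N.up (N.meix r lam) := by
  rw [up_meix, meixGrade, meix, map_sum, Finset.smul_sum, ← Finset.sum_add_distrib]
  refine Finset.sum_congr rfl fun j _ => ?_
  rw [map_smul, grade_expUp, grade_down_pow_ket]
  simp only [map_add, map_smul]
  module

/-- The middle factor `H` acts on `D ^ j 1_lam` by a scalar; its part linear in `j` turns into one
more factor `D`. -/
theorem meixGrade_eq {r : ℝ} (hr : 0 < 1 - r ^ 2) (lam : X) :
    (1 - r ^ 2) • N.meixGrade r lam =
      ((1 - r ^ 2) * (2 * N.size lam + N.t)) • N.meix r lam + (2 * r) • N.meixShift r lam := by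
  set n := N.size lam with hn
  have h1 : r • N.meixShift r lam = ∑ j ∈ Finset.range (n + 1),
      (-(j * (1 - r ^ 2) * N.coef n j r)) • N.expUp r ((N.down ^ j) (ket lam)) := by
    rw [Finset.sum_range_succ', meixShift, Finset.sum_range_succ, ← hn, hn,
      N.down_pow_size_succ_ket, ← hn]
    simp only [map_zero, smul_zero, add_zero, Nat.cast_zero, zero_mul, neg_zero, zero_smul,
      Finset.smul_sum]
    refine Finset.sum_congr rfl fun j _ => ?_
    have := N.coef_succ hr n j
    rw [smul_smul]
    congr 1
    push_cast
    linarith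
  rw [mul_smul 2 r, h1, meixGrade, meix, Finset.smul_sum, Finset.smul_sum, Finset.smul_sum,
    ← Finset.sum_add_distrib]
  refine Finset.sum_congr rfl fun j _ => ?_
  module

/-- The function `meix r lam` is an eigenvector of the conjugate of the grading operator. -/
theorem meix_eigen {r : ℝ} (hr : 0 < 1 - r ^ 2) (lam : X) :
    r • (N.up (N.meix r lam) + N.down (N.meix r lam)) -
        ((1 + r ^ 2) / 2) • N.grade (N.meix r lam) + ((1 - r ^ 2) * N.t / 2) • N.meix r lam =
      -(((1 - r ^ 2) * N.size lam) • N.meix r lam) := by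
  have h := N.meixGrade_eq hr lam
  rw [grade_meix, down_meix]
  linear_combination (norm := module) (-(1 / 2 : ℝ)) • h

/-- In the variable `s` with `r = tanh s`, where `dr = (1 - r²) ds`, this is the equation
`x' = (U - D) x`. -/
theorem hasDerivAt_meix {r : ℝ} (hr : 0 < 1 - r ^ 2) (lam x : X) :
    HasDerivAt (fun r => N.meix r lam x)
      ((1 - r ^ 2)⁻¹ * (N.up (N.meix r lam) - N.down (N.meix r lam)) x) r := by
  set n := N.size lam with hn
  -- `e j` and `e' j` are the value at `x` of the `j`-th term and of its derivative
  let e : ℕ → ℝ := fun j => N.expUp r ((N.down ^ j) (ket lam)) x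
  let e' : ℕ → ℝ := fun j => N.expUp r (N.up ((N.down ^ j) (ket lam))) x
  have hfun : (fun r => N.meix r lam x) = fun r => ∑ j ∈ Finset.range (n + 1),
      N.coef n j r * N.expUp r ((N.down ^ j) (ket lam)) x := by
    ext r
    simp [meix, hn]
  let a : ℕ → ℝ := fun j => -((1 - r ^ 2)⁻¹ * ((if j = 0 then 0 else N.coef n (j - 1) r) +
    r * (N.coef n j r * (2 * ((n : ℝ) - j) + N.t))))
  have ha : ∀ j, HasDerivAt (N.coef n j) (a j) r := by
    intro j
    cases j with
    | zero => simpa [a] using N.hasDerivAt_coef_zero hr n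
    | succ j => simpa [a] using N.hasDerivAt_coef_succ hr n j
  have h : HasDerivAt (fun r => N.meix r lam x)
      (∑ j ∈ Finset.range (n + 1), (a j * e j + N.coef n j r * e' j)) r := by
    rw [hfun]
    exact HasDerivAt.fun_sum fun j _ => (ha j).mul (N.hasDerivAt_expUp r _ x)
  convert! h using 1
  have hup : N.up (N.meix r lam) x = ∑ j ∈ Finset.range (n + 1), N.coef n j r * e' j := by
    rw [up_meix]; simp [e', hn]
  have hgr : N.meixGrade r lam x =
      ∑ j ∈ Finset.range (n + 1), N.coef n j r * (2 * ((n : ℝ) - j) + N.t) * e j := by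
    simp [meixGrade, e, hn]
  have hsh : N.meixShift r lam x =
      ∑ j ∈ Finset.range (n + 1), (if j = 0 then 0 else N.coef n (j - 1) r) * e j := by
    rw [Finset.sum_range_succ', meixShift, Finset.sum_range_succ, hn,
      N.down_pow_size_succ_ket, ← hn]
    simp [e]
  have hsum : ∑ j ∈ Finset.range (n + 1), a j * e j =
      -((1 - r ^ 2)⁻¹ * (N.meixShift r lam x + r * N.meixGrade r lam x)) := by
    rw [hsh, hgr, Finset.mul_sum, ← Finset.sum_add_distrib, Finset.mul_sum,
      ← Finset.sum_neg_distrib]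
    refine Finset.sum_congr rfl fun j _ => ?_
    simp only [a]
    ring
  rw [Finset.sum_add_distrib, hsum, ← hup, down_meix]
  simp only [Pi.sub_apply, Pi.add_apply, Pi.smul_apply, smul_eq_mul]
  field_simp
  ring

end SlNetwork

/-! ### Growth estimates -/

namespace SlNetwork

variable {X : Type*} (N : SlNetwork X)

/-- The squared `ℓ²` norm of the restriction of a function to level `n`. -/
def sqn (n : ℕ) (f : X → ℝ) : ℝ := ∑ x ∈ N.level n, f x ^ 2

/-- The bilinear pairing of two functions over level `n`. -/
def pair (n : ℕ) (f g : X → ℝ) : ℝ := ∑ x ∈ N.level n, f x * g x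

theorem sqn_nonneg (n : ℕ) (f : X → ℝ) : 0 ≤ N.sqn n f :=
  Finset.sum_nonneg fun _ _ => sq_nonneg _

theorem sqn_eq_pair (n : ℕ) (f : X → ℝ) : N.sqn n f = N.pair n f f :=
  Finset.sum_congr rfl fun _ _ => sq _

theorem pair_comm (n : ℕ) (f g : X → ℝ) : N.pair n f g = N.pair n g f :=
  Finset.sum_congr rfl fun _ _ => mul_comm _ _

theorem pair_sq_le (n : ℕ) (f g : X → ℝ) : N.pair n f g ^ 2 ≤ N.sqn n f * N.sqn n g :=
  Finset.sum_mul_sq_le_sq_mul_sq _ _ _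

/-- On neighbouring levels, `U` and `D` are adjoint. -/
theorem pair_up (n : ℕ) (f g : X → ℝ) : N.pair (n + 1) (N.up f) g = N.pair n f (N.down g) := by
  have h1 : N.pair (n + 1) (N.up f) g =
      ∑ y ∈ N.level (n + 1), ∑ x ∈ N.level n, N.w x y * f x * g y :=
    Finset.sum_congr rfl fun y hy => by
      rw [N.up_apply_of_size ((N.mem_level _ _).1 hy), Finset.sum_mul]
  have h2 : N.pair n f (N.down g) =
      ∑ x ∈ N.level n, ∑ y ∈ N.level (n + 1), N.w x y * f x * g y :=
    Finset.sum_congr rfl fun x hx => by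
      rw [N.down_apply_of_size ((N.mem_level _ _).1 hx), Finset.mul_sum]
      exact Finset.sum_congr rfl fun _ _ => by ring
  rw [h1, h2, Finset.sum_comm]

theorem pair_zero_up (f g : X → ℝ) : N.pair 0 (N.up f) g = 0 :=
  Finset.sum_eq_zero fun x hx => by
    rw [N.up_apply_of_size_eq_zero f ((N.mem_level _ _).1 hx), zero_mul]

/-- A bound for `U` on a level passes to its adjoint `D`. -/
theorem sqn_down_le_of_sqn_up_le {n : ℕ} {c : ℝ} (hc : 0 ≤ c)
    (h : ∀ f, N.sqn (n + 1) (N.up f) ≤ c * N.sqn n f) (g : X → ℝ) :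
    N.sqn n (N.down g) ≤ c * N.sqn (n + 1) g := by
  -- `‖D g‖² = ⟨U D g, g⟩`, to which the Cauchy–Schwarz inequality applies
  have h1 : N.sqn n (N.down g) = N.pair (n + 1) (N.up (N.down g)) g := by
    rw [pair_up, sqn_eq_pair]
  have h2 := N.pair_sq_le (n + 1) (N.up (N.down g)) g
  rw [← h1] at h2
  have h3 := mul_le_mul_of_nonneg_right (h (N.down g)) (N.sqn_nonneg (n + 1) g)
  rcases (N.sqn_nonneg n (N.down g)).eq_or_lt with h0 | h0
  · rw [← h0]
    exact mul_nonneg hc (N.sqn_nonneg _ _)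
  · refine le_of_mul_le_mul_left ?_ h0
    nlinarith

/-- On level `n`, `‖U f‖² = ‖D f‖² + (2 n + t) ‖f‖²`. -/
theorem sqn_up (n : ℕ) (f : X → ℝ) : N.sqn (n + 1) (N.up f) =
    N.pair n f (N.up (N.down f)) + (2 * n + N.t) * N.sqn n f := by
  rw [sqn_eq_pair, pair_up, down_up, pair, pair, sqn, Finset.mul_sum, ← Finset.sum_add_distrib]
  refine Finset.sum_congr rfl fun x hx => ?_
  rw [N.mem_level] at hx
  rw [Pi.add_apply, grade_apply, hx]
  ring

/-- The norm of `U` on level `n`, by induction: the bound for level `n - 1` passes to `D`, and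
`n (n - 1 + t) + (2 n + t) = (n + 1) (n + t)`. -/
theorem sqn_up_le (n : ℕ) (f : X → ℝ) :
    N.sqn (n + 1) (N.up f) ≤ ((n + 1) * (n + N.t)) * N.sqn n f := by
  have ht := N.t_pos
  induction n generalizing f with
  | zero =>
    rw [sqn_up, pair_comm, pair_zero_up]
    simp
  | succ n ih =>
    have h := N.sqn_down_le_of_sqn_up_le (by positivity) ih f
    rw [sqn_up, pair_comm, pair_up, ← sqn_eq_pair]
    push_cast at *
    linarith

theorem sqn_down_le (n : ℕ) (f : X → ℝ) :
    N.sqn n (N.down f) ≤ ((n + 1) * (n + N.t)) * N.sqn (n + 1) f := by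
  have ht := N.t_pos
  exact N.sqn_down_le_of_sqn_up_le (by positivity) (N.sqn_up_le n) f

theorem sqn_up_pow_le (m k L : ℕ) (hL : m + N.t ≤ L) (f : X → ℝ) :
    N.sqn (m + k) ((N.up ^ k) f) ≤ ((L + 1).ascFactorial k : ℝ) ^ 2 * N.sqn m f := by
  have ht := N.t_pos
  have hmL : (m : ℝ) ≤ L := by linarith
  induction k with
  | zero => simp
  | succ k ih =>
    rw [pow_succ', Module.End.mul_apply, ← add_assoc]
    refine (N.sqn_up_le _ _).trans ?_
    have h1 : ((m + k : ℕ) + 1 : ℝ) * ((m + k : ℕ) + N.t) ≤ ((L : ℝ) + 1 + k) ^ 2 := by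
      push_cast
      rw [sq]
      have hk : (0 : ℝ) ≤ k := k.cast_nonneg
      exact mul_le_mul (by linarith) (by linarith) (by linarith) (by linarith)
    calc _ ≤ ((L : ℝ) + 1 + k) ^ 2 * (((L + 1).ascFactorial k : ℝ) ^ 2 * N.sqn m f) := by
            gcongr
            exact N.sqn_nonneg _ _
      _ = _ := by rw [Nat.ascFactorial_succ]; push_cast; ring

theorem ascFactorial_div_factorial_le (L k : ℕ) :
    ((L + 1).ascFactorial k : ℝ) / (k.factorial : ℝ) ≤ ((L + k : ℕ) : ℝ) ^ L := by
  have := Nat.factorial_ne_zero k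
  rw [Nat.ascFactorial_eq_factorial_mul_choose, Nat.cast_mul,
    mul_div_cancel_left₀ _ (by positivity), Nat.choose_symm_add.symm]
  refine (Nat.choose_le_pow_div (α := ℝ) L (L + k)).trans (div_le_self (by positivity) ?_)
  exact_mod_cast Nat.succ_le_of_lt (Nat.factorial_pos L)

theorem up_pow_apply_of_size_ne {m : ℕ} {f : X → ℝ} (hf : ∀ x, N.size x ≠ m → f x = 0)
    {k : ℕ} {x : X} (hx : N.size x ≠ m + k) : (N.up ^ k) f x = 0 := by
  induction k generalizing x with
  | zero => simpa using hf x hx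
  | succ k ih =>
    rw [pow_succ', Module.End.mul_apply]
    rcases Nat.eq_zero_or_pos (N.size x) with h0 | h0
    · exact N.up_apply_of_size_eq_zero _ h0
    · rw [up_apply]
      refine Finset.sum_eq_zero fun y hy => ?_
      rw [N.mem_level] at hy
      rw [ih (by omega), mul_zero]

theorem expUp_apply_of_size {m : ℕ} {f : X → ℝ} (hf : ∀ x, N.size x ≠ m → f x = 0) (r : ℝ)
    {k : ℕ} {x : X} (hx : N.size x = m + k) :
    N.expUp r f x = r ^ k / (k.factorial : ℝ) * (N.up ^ k) f x := by
  rw [N.expUp_apply r f (Nat.lt_succ_self (N.size x))]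
  refine Finset.sum_eq_single_of_mem k (by simp; omega) fun b _ hb => ?_
  rw [N.up_pow_apply_of_size_ne hf (by omega), mul_zero]

theorem expUp_apply_of_size_lt {m : ℕ} {f : X → ℝ} (hf : ∀ x, N.size x ≠ m → f x = 0) (r : ℝ)
    {x : X} (hx : N.size x < m) : N.expUp r f x = 0 := by
  rw [N.expUp_apply r f (Nat.lt_succ_self (N.size x))]
  refine Finset.sum_eq_zero fun b _ => ?_
  rw [N.up_pow_apply_of_size_ne hf (by omega), mul_zero]

theorem exists_add_pow_mul_pow_le (L p : ℕ) {ρ : ℝ} (h0 : 0 < ρ) (h1 : ρ < 1) :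
    ∃ C, 0 ≤ C ∧ ∀ k : ℕ, ((L + k : ℕ) : ℝ) ^ p * ρ ^ k ≤ C := by
  obtain ⟨C, hC⟩ := (tendsto_pow_const_mul_const_pow_of_abs_lt_one p
    (abs_lt.2 ⟨by linarith, h1⟩)).bddAbove_range
  have hC' : ∀ k : ℕ, (k : ℝ) ^ p * ρ ^ k ≤ C := fun k => hC ⟨k, rfl⟩
  have hC0 : 0 ≤ C := le_trans (by positivity) (hC' 0)
  refine ⟨C / ρ ^ L, by positivity, fun k => ?_⟩
  rw [le_div_iff₀ (by positivity)]
  calc _ = ((L + k : ℕ) : ℝ) ^ p * ρ ^ (L + k) := by rw [pow_add]; ring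
    _ ≤ C := hC' _

/-- If `f` lives on one level, `‖U ^ k f‖ / k!` is bounded by a power of `k`, so that the factor
`r ^ k` in `exp (r U) f` beats any power of the level. -/
theorem exists_sqn_expUp_le {m : ℕ} {f : X → ℝ} (hf : ∀ x, N.size x ≠ m → f x = 0) {r₀ : ℝ}
    (h0 : 0 < r₀) (h1 : r₀ < 1) :
    ∃ C, ∀ r, |r| ≤ r₀ → ∀ n : ℕ, ((n : ℝ) + 1) ^ 4 * N.sqn n (N.expUp r f) ≤ C := by
  have ht := N.t_pos
  -- an integral upper bound for `m + t`, so that the norms of `U ^ k` are rising factorials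
  set L := m + ⌈N.t⌉₊ with hL
  have hL' : m + N.t ≤ (L : ℝ) := by
    rw [hL]; push_cast; linarith [Nat.le_ceil N.t]
  have hmL : (m : ℝ) ≤ L := by linarith
  have hm1 : m + 1 ≤ L := by
    have := Nat.ceil_pos.2 ht
    omega
  have hm1' : (m : ℝ) + 1 ≤ L := by exact_mod_cast hm1
  obtain ⟨C, hC0, hC⟩ := exists_add_pow_mul_pow_le L (2 * L + 4) (ρ := r₀ ^ 2) (by positivity)
    (by nlinarith)
  refine ⟨C * N.sqn m f, fun r hr n => ?_⟩
  have hs := N.sqn_nonneg m f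
  rcases lt_or_ge n m with hn | hn
  · have : N.sqn n (N.expUp r f) = 0 := Finset.sum_eq_zero fun x hx => by
      rw [N.mem_level] at hx
      rw [N.expUp_apply_of_size_lt hf r (by omega)]
      simp
    rw [this, mul_zero]
    positivity
  · obtain ⟨k, rfl⟩ := Nat.exists_eq_add_of_le hn
    have h2 : N.sqn (m + k) (N.expUp r f) =
        (r ^ k / (k.factorial : ℝ)) ^ 2 * N.sqn (m + k) ((N.up ^ k) f) := by
      rw [sqn, sqn, Finset.mul_sum]
      refine Finset.sum_congr rfl fun x hx => ?_
      rw [N.expUp_apply_of_size hf r ((N.mem_level _ _).1 hx)]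
      ring
    have h3 : r ^ 2 ≤ r₀ ^ 2 := sq_le_sq' (abs_le.1 hr).1 (abs_le.1 hr).2
    rw [h2]
    calc (((m + k : ℕ) : ℝ) + 1) ^ 4 *
          ((r ^ k / (k.factorial : ℝ)) ^ 2 * N.sqn (m + k) ((N.up ^ k) f))
        ≤ ((L + k : ℕ) : ℝ) ^ 4 * ((r ^ k / (k.factorial : ℝ)) ^ 2 *
          (((L + 1).ascFactorial k : ℝ) ^ 2 * N.sqn m f)) := by
          gcongr
          · exact mul_nonneg (sq_nonneg _) (N.sqn_nonneg _ _)
          · push_cast; linarith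
          · exact N.sqn_up_pow_le m k L hL' f
      _ = ((L + k : ℕ) : ℝ) ^ 4 * ((r ^ 2) ^ k *
          (((L + 1).ascFactorial k : ℝ) / (k.factorial : ℝ)) ^ 2) * N.sqn m f := by ring
      _ ≤ ((L + k : ℕ) : ℝ) ^ 4 * ((r₀ ^ 2) ^ k * (((L + k : ℕ) : ℝ) ^ L) ^ 2) * N.sqn m f := by
          gcongr
          exact ascFactorial_div_factorial_le L k
      _ = (((L + k : ℕ) : ℝ) ^ (2 * L + 4) * (r₀ ^ 2) ^ k) * N.sqn m f := by ring
      _ ≤ C * N.sqn m f := by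
          gcongr
          exact hC k

theorem abs_coef_le_one {n j : ℕ} (hj : j ≤ n) {r : ℝ} (hr : |r| < 1) : |N.coef n j r| ≤ 1 := by
  have ht := N.t_pos
  have hr2 : r ^ 2 < 1 := (sq_lt_one_iff_abs_lt_one r).2 hr
  rw [coef, abs_mul, abs_div, abs_pow, abs_neg, Nat.abs_cast]
  have hj' : (j : ℝ) ≤ n := by exact_mod_cast hj
  have h1 : |r| ^ j / (j.factorial : ℝ) ≤ 1 := by
    refine (div_le_one (by exact_mod_cast Nat.factorial_pos j)).2
      ((pow_le_one₀ (abs_nonneg r) hr.le).trans ?_)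
    exact_mod_cast Nat.succ_le_of_lt (Nat.factorial_pos j)
  have h2 : |(1 - r ^ 2) ^ ((n : ℝ) - j + N.t / 2)| ≤ 1 := by
    rw [abs_of_nonneg (Real.rpow_nonneg (by linarith) _)]
    exact Real.rpow_le_one (by linarith) (by linarith [sq_nonneg r]) (by linarith)
  exact mul_le_one₀ h1 (abs_nonneg _) h2

/-- The norm of `meix r lam` on level `n` is `O(1 / n²)`, locally uniformly in `r`. -/
theorem exists_sqn_meix_le (lam : X) {r₀ : ℝ} (h0 : 0 < r₀) (h1 : r₀ < 1) :
    ∃ C, ∀ r, |r| ≤ r₀ → ∀ n : ℕ, ((n : ℝ) + 1) ^ 4 * N.sqn n (N.meix r lam) ≤ C := by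
  set S := Finset.range (N.size lam + 1) with hS
  have hf : ∀ j ∈ S, ∃ C, ∀ r, |r| ≤ r₀ → ∀ n : ℕ,
      ((n : ℝ) + 1) ^ 4 * N.sqn n (N.expUp r ((N.down ^ j) (ket lam))) ≤ C := fun j hj =>
    N.exists_sqn_expUp_le (m := N.size lam - j)
      (fun x hx => N.down_pow_ket_apply (by simp [hS] at hj; omega)) h0 h1
  choose! C hC using hf
  refine ⟨(S.card : ℝ) * ∑ j ∈ S, C j, fun r hr n => ?_⟩
  calc ((n : ℝ) + 1) ^ 4 * N.sqn n (N.meix r lam)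
      ≤ ((n : ℝ) + 1) ^ 4 *
        ((S.card : ℝ) * ∑ j ∈ S, N.sqn n (N.expUp r ((N.down ^ j) (ket lam)))) := by
        gcongr
        simp only [sqn]
        rw [Finset.sum_comm, Finset.mul_sum]
        refine Finset.sum_le_sum fun x _ => ?_
        rw [meix, Finset.sum_apply]
        refine sq_sum_le_card_mul_sum_sq.trans ?_
        refine mul_le_mul_of_nonneg_left (Finset.sum_le_sum fun j hj => ?_) (Nat.cast_nonneg _)
        rw [Pi.smul_apply, smul_eq_mul, mul_pow]
        refine mul_le_of_le_one_left (sq_nonneg _) ?_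
        rw [sq_le_one_iff_abs_le_one]
        exact N.abs_coef_le_one (by simp at hj; omega) (hr.trans_lt h1)
    _ = (S.card : ℝ) * ∑ j ∈ S, ((n : ℝ) + 1) ^ 4 *
          N.sqn n (N.expUp r ((N.down ^ j) (ket lam))) := by
        rw [← Finset.mul_sum]; ring
    _ ≤ (S.card : ℝ) * ∑ j ∈ S, C j := by
        gcongr with j hj
        exact hC j hj r hr n

end SlNetwork

/-! ### Green's formula and the explicit solutions of `x' = (U - D) x` -/

theorem Real.hasDerivAt_tanh_one_sub_sq (s : ℝ) :
    HasDerivAt Real.tanh (1 - Real.tanh s ^ 2) s := by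
  have hc := (Real.cosh_pos s).ne'
  have h := (Real.hasDerivAt_sinh s).div (Real.hasDerivAt_cosh s) hc
  have he : (Real.sinh / Real.cosh : ℝ → ℝ) = Real.tanh := by
    ext x; rw [Pi.div_apply, Real.tanh_eq_sinh_div_cosh]
  rw [he] at h
  convert! h using 1
  rw [Real.tanh_eq_sinh_div_cosh]
  field_simp

theorem Real.monotone_tanh : Monotone Real.tanh :=
  monotone_of_deriv_nonneg (fun s => (Real.hasDerivAt_tanh_one_sub_sq s).differentiableAt)
    fun s => by
      rw [(Real.hasDerivAt_tanh_one_sub_sq s).deriv]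
      linarith [Real.tanh_sq_lt_one s]

namespace SlNetwork

variable {X : Type*} (N : SlNetwork X)

/-- The bilinear pairing of two functions over the levels up to `n`. -/
def ballPair (n : ℕ) (f g : X → ℝ) : ℝ := ∑ k ∈ Finset.range (n + 1), N.pair k f g

/-- Green's formula: on the levels up to `n`, the operator `U - D` is skew-symmetric up to a
boundary term. -/
theorem ballPair_green (n : ℕ) (f g : X → ℝ) :
    N.ballPair n (N.up f - N.down f) g + N.ballPair n f (N.up g - N.down g) =
      -(N.pair n f (N.down g) + N.pair n g (N.down f)) := by
  have hsub : ∀ k (f g h : X → ℝ), N.pair k (f - g) h = N.pair k f h - N.pair k g h := by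
    intro k f g h
    simp [pair, sub_mul]
  induction n with
  | zero =>
    simp only [ballPair, zero_add, Finset.sum_range_one]
    rw [N.pair_comm 0 f, hsub, hsub, pair_zero_up, pair_zero_up, N.pair_comm 0 _ g,
      N.pair_comm 0 _ f]
    ring
  | succ n ih =>
    rw [ballPair, ballPair, Finset.sum_range_succ, Finset.sum_range_succ _ (n + 1)]
    rw [ballPair, ballPair] at ih
    rw [N.pair_comm (n + 1) f (_ - _), hsub, hsub, pair_up, pair_up, N.pair_comm (n + 1) _ g,
      N.pair_comm (n + 1) _ f]
    linarith

/-- The boundary term in Green's formula is `O(1 / n)` if one of the functions is bounded and the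
norm of the other one on level `n` is `O(1 / n²)`. -/
theorem abs_pair_down_le {n : ℕ} {f g : X → ℝ} {A B : ℝ}
    (hAB : N.sqn n f * N.sqn (n + 1) g ≤ A * B / ((n : ℝ) + 1) ^ 4) :
    |N.pair n f (N.down g)| ≤ √(max 1 N.t * (A * B)) / (n + 1) := by
  have ht := N.t_pos
  have h1 : ((n : ℝ) + 1) * (n + N.t) ≤ max 1 N.t * ((n : ℝ) + 1) ^ 2 := by
    have h2 : (n : ℝ) + N.t ≤ max 1 N.t * ((n : ℝ) + 1) := by
      have := le_max_left 1 N.t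
      have := le_max_right 1 N.t
      nlinarith [n.cast_nonneg (α := ℝ)]
    calc ((n : ℝ) + 1) * (n + N.t) ≤ ((n : ℝ) + 1) * (max 1 N.t * ((n : ℝ) + 1)) := by gcongr
      _ = _ := by ring
  have h3 : N.pair n f (N.down g) ^ 2 ≤ max 1 N.t * (A * B) / ((n : ℝ) + 1) ^ 2 := by
    calc N.pair n f (N.down g) ^ 2 ≤ N.sqn n f * N.sqn n (N.down g) := N.pair_sq_le _ _ _
      _ ≤ N.sqn n f * ((max 1 N.t * ((n : ℝ) + 1) ^ 2) * N.sqn (n + 1) g) := by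
          gcongr
          · exact N.sqn_nonneg _ _
          · refine (N.sqn_down_le n g).trans ?_
            gcongr
            exact N.sqn_nonneg _ _
      _ = (max 1 N.t * ((n : ℝ) + 1) ^ 2) * (N.sqn n f * N.sqn (n + 1) g) := by ring
      _ ≤ (max 1 N.t * ((n : ℝ) + 1) ^ 2) * (A * B / ((n : ℝ) + 1) ^ 4) := by gcongr
      _ = _ := by field_simp
  refine (Real.abs_le_sqrt h3).trans (le_of_eq ?_)
  rw [Real.sqrt_div' _ (by positivity), Real.sqrt_sq (by positivity)]

/-- A curve of functions that solves `x' = (U - D) x` at every vertex. -/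
def IsFlow (x : ℝ → X → ℝ) : Prop :=
  ∀ s z, HasDerivAt (fun s => x s z) ((N.up (x s) - N.down (x s)) z) s

/-- The pairing of a bounded and a rapidly decaying solution of `x' = (U - D) x` is constant. -/
theorem tendsto_ballPair_sub {x y : ℝ → X → ℝ} (hx : N.IsFlow x) (hy : N.IsFlow y)
    (hxb : ∀ R, ∃ A, ∀ s, |s| ≤ R → ∀ n, N.sqn n (x s) ≤ A)
    (hyb : ∀ R, ∃ B, ∀ s, |s| ≤ R → ∀ n : ℕ, ((n : ℝ) + 1) ^ 4 * N.sqn n (y s) ≤ B) (a b : ℝ) :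
    Tendsto (fun n => N.ballPair n (x b) (y b) - N.ballPair n (x a) (y a)) atTop (𝓝 0) := by
  set R := max |a| |b| with hR
  obtain ⟨A, hA⟩ := hxb R
  obtain ⟨B, hB⟩ := hyb R
  set K := √(max 1 N.t * (A * B)) with hK
  -- the derivative of the pairing over the levels up to `n` is the boundary term
  have hder : ∀ n s, HasDerivAt (fun s => N.ballPair n (x s) (y s))
      (-(N.pair n (x s) (N.down (y s)) + N.pair n (y s) (N.down (x s)))) s := by
    intro n s
    rw [← ballPair_green]
    have h : HasDerivAt (fun s => N.ballPair n (x s) (y s))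
        (∑ k ∈ Finset.range (n + 1), ∑ z ∈ N.level k,
          ((N.up (x s) - N.down (x s)) z * y s z + x s z * (N.up (y s) - N.down (y s)) z)) s :=
      HasDerivAt.fun_sum fun k _ => HasDerivAt.fun_sum fun z _ => (hx s z).mul (hy s z)
    convert! h using 1
    simp only [ballPair, pair, Finset.sum_add_distrib]
  have hbound : ∀ (n : ℕ) s, |s| ≤ R →
      ‖-(N.pair n (x s) (N.down (y s)) + N.pair n (y s) (N.down (x s)))‖ ≤
        K / (n + 1) + K / (n + 1) := by
    intro n s hs
    rw [norm_neg]
    have hdiv : ∀ k : ℕ, n ≤ k → N.sqn k (y s) ≤ B / ((n : ℝ) + 1) ^ 4 := fun k hk => by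
      rw [le_div_iff₀' (by positivity)]
      refine le_trans ?_ (hB s hs k)
      gcongr
      exact N.sqn_nonneg _ _
    have hA0 : 0 ≤ A := (N.sqn_nonneg n (x s)).trans (hA s hs n)
    refine (norm_add_le _ _).trans (add_le_add ?_ ?_) <;> rw [Real.norm_eq_abs]
    · refine N.abs_pair_down_le ?_
      rw [mul_div_assoc]
      exact mul_le_mul (hA s hs n) (hdiv _ n.le_succ) (N.sqn_nonneg _ _) hA0
    · refine N.abs_pair_down_le ?_
      rw [mul_div_assoc, mul_comm]
      exact mul_le_mul (hA s hs _) (hdiv _ le_rfl) (N.sqn_nonneg _ _) hA0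
  have hmv : ∀ n : ℕ, ‖N.ballPair n (x b) (y b) - N.ballPair n (x a) (y a)‖ ≤
      (K / (n + 1) + K / (n + 1)) * ‖b - a‖ := fun n =>
    (convex_Icc (-R) R).norm_image_sub_le_of_norm_hasDerivWithin_le
      (fun s _ => (hder n s).hasDerivWithinAt) (fun s hs => hbound n s (abs_le.2 hs))
      (abs_le.1 (le_max_left _ _)) (abs_le.1 (le_max_right _ _))
  refine squeeze_zero_norm hmv ?_
  have h0 : Tendsto (fun n : ℕ => K / ((n : ℝ) + 1)) atTop (𝓝 0) := by
    have := tendsto_one_div_add_atTop_nhds_zero_nat (𝕜 := ℝ)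
    simpa [div_eq_mul_inv] using this.const_mul K
  simpa using (h0.add h0).mul_const ‖b - a‖

/-- The explicit solution of `x' = (U - D) x` with initial value `1_lam`. -/
def flow (lam : X) (s : ℝ) : X → ℝ := N.meix (Real.tanh s) lam

theorem one_sub_tanh_sq_pos (s : ℝ) : 0 < 1 - Real.tanh s ^ 2 := by
  linarith [Real.tanh_sq_lt_one s]

theorem isFlow_flow (lam : X) : N.IsFlow (N.flow lam) := fun s z => by
  have hs := one_sub_tanh_sq_pos s
  have h := (N.hasDerivAt_meix hs lam z).comp s (Real.hasDerivAt_tanh_one_sub_sq s)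
  convert! h using 1
  rw [flow]
  field_simp

theorem IsFlow.comp_add_const {x : ℝ → X → ℝ} (hx : N.IsFlow x) (d : ℝ) :
    N.IsFlow fun s => x (s + d) :=
  fun s z => (hx (s + d) z).comp_add_const s d

theorem expUp_zero (f : X → ℝ) : N.expUp 0 f = f := by
  ext x
  rw [N.expUp_apply 0 f (Nat.lt_succ_self _), Finset.sum_range_succ']
  simp

theorem flow_zero (lam : X) : N.flow lam 0 = ket lam := by
  rw [flow, Real.tanh_zero, meix, Finset.sum_range_succ', Finset.sum_eq_zero]
  · simp [coef, expUp_zero]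
  · intro j _
    simp [coef]

theorem exists_sqn_flow_le (lam : X) (R : ℝ) :
    ∃ B, ∀ s, |s| ≤ R → ∀ n : ℕ, ((n : ℝ) + 1) ^ 4 * N.sqn n (N.flow lam s) ≤ B := by
  rcases lt_or_ge R 0 with hR | hR
  · exact ⟨0, fun s hs => absurd (abs_nonneg s) (by linarith)⟩
  have h0 : 0 < Real.tanh (R + 1) := by
    rw [Real.tanh_eq_sinh_div_cosh]
    exact div_pos (Real.sinh_pos_iff.2 (by linarith)) (Real.cosh_pos _)
  obtain ⟨B, hB⟩ := N.exists_sqn_meix_le lam h0 (Real.tanh_lt_one _)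
  refine ⟨B, fun s hs => hB _ ?_⟩
  rw [abs_le, ← Real.tanh_neg]
  have := abs_le.1 hs
  exact ⟨Real.monotone_tanh (by linarith), Real.monotone_tanh (by linarith)⟩

theorem sqn_le_of_decay {n : ℕ} {f : X → ℝ} {B : ℝ} (h : ((n : ℝ) + 1) ^ 4 * N.sqn n f ≤ B) :
    N.sqn n f ≤ B := by
  refine le_trans ?_ h
  refine le_mul_of_one_le_left (N.sqn_nonneg _ _) (one_le_pow₀ ?_)
  linarith [n.cast_nonneg (α := ℝ)]

theorem ballPair_ket {n : ℕ} {mu : X} (h : N.size mu ≤ n) (f : X → ℝ) :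
    N.ballPair n f (ket mu) = f mu := by
  rw [ballPair, Finset.sum_eq_single_of_mem (N.size mu) (by simp; omega)]
  · rw [pair, Finset.sum_eq_single_of_mem mu ((N.mem_level _ _).2 rfl)]
    · simp [ket]
    · intro x _ hx; simp [ket, hx]
  · intro k _ hk
    refine Finset.sum_eq_zero fun x hx => ?_
    have : x ≠ mu := by
      rintro rfl
      exact hk ((N.mem_level _ _).1 hx).symm
    simp [ket, this]

theorem ballPair_comm (n : ℕ) (f g : X → ℝ) : N.ballPair n f g = N.ballPair n g f :=
  Finset.sum_congr rfl fun _ _ => N.pair_comm _ _ _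

/-- The value of a bounded solution of `x' = (U - D) x` at any time is read off from its pairing
with the explicit solutions, run backwards. -/
theorem tendsto_ballPair_flow {x : ℝ → X → ℝ} (hx : N.IsFlow x)
    (hxb : ∀ R, ∃ A, ∀ s, |s| ≤ R → ∀ n, N.sqn n (x s) ≤ A) (mu : X) (d : ℝ) :
    Tendsto (fun n => N.ballPair n (x 0) (N.flow mu d)) atTop (𝓝 (x (-d) mu)) := by
  -- the pairing of `x s` and `flow mu (s + d)` is compared at the times `s = -d` and `s = 0`
  have h := N.tendsto_ballPair_sub hx ((N.isFlow_flow mu).comp_add_const N d) hxb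
    (fun R => by
      obtain ⟨B, hB⟩ := N.exists_sqn_flow_le mu (R + |d|)
      exact ⟨B, fun s hs => hB _ ((abs_add_le s d).trans (by linarith))⟩) (-d) 0
  have h1 : Tendsto (fun n => N.ballPair n (x (-d)) (N.flow mu (-d + d))) atTop
      (𝓝 (x (-d) mu)) := by
    refine tendsto_const_nhds.congr' ?_
    filter_upwards [eventually_ge_atTop (N.size mu)] with n hn
    rw [neg_add_cancel, flow_zero, N.ballPair_ket hn]
  simpa using h.add h1

/-- The explicit solutions at times `c` and `d` pair like those at times `c - d` and `0`. -/
theorem tendsto_ballPair_flow_flow (lam mu : X) (c d : ℝ) :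
    Tendsto (fun n => N.ballPair n (N.flow lam c) (N.flow mu d)) atTop
      (𝓝 (N.flow lam (c - d) mu)) := by
  have h := N.tendsto_ballPair_flow ((N.isFlow_flow lam).comp_add_const N c)
    (fun R => by
      obtain ⟨B, hB⟩ := N.exists_sqn_flow_le lam (R + |c|)
      exact ⟨B, fun s hs n => N.sqn_le_of_decay
        (hB _ ((abs_add_le s c).trans (by linarith)) n)⟩) mu d
  simpa [neg_add_eq_sub] using h

/-- The inverse of the matrix of `exp (s (U - D))` is its transpose. -/
theorem flow_neg_apply (lam mu : X) (s : ℝ) : N.flow lam (-s) mu = N.flow mu s lam := by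
  have h := N.tendsto_ballPair_flow_flow lam mu 0 s
  rw [zero_sub] at h
  refine tendsto_nhds_unique h (tendsto_const_nhds.congr' ?_)
  filter_upwards [eventually_ge_atTop (N.size lam)] with n hn
  rw [flow_zero, ballPair_comm, N.ballPair_ket hn]

theorem ballPair_smul (n : ℕ) (c : ℝ) (f g : X → ℝ) :
    N.ballPair n (c • f) g = c * N.ballPair n f g := by
  simp only [ballPair, pair, Finset.mul_sum, Pi.smul_apply, smul_eq_mul, mul_assoc]

/-- A bounded solution of `x' = (U - D) x` that starts at a multiple of `1_lam` is the
corresponding multiple of the explicit solution. -/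
theorem IsFlow.eq_smul_flow {x : ℝ → X → ℝ} (hx : N.IsFlow x)
    (hxb : ∀ R, ∃ A, ∀ s, |s| ≤ R → ∀ n, N.sqn n (x s) ≤ A) {lam : X} {c : ℝ}
    (h0 : x 0 = c • ket lam) (s : ℝ) : x s = c • N.flow lam s := by
  ext mu
  have h := N.tendsto_ballPair_flow hx hxb mu (-s)
  rw [neg_neg] at h
  refine tendsto_nhds_unique h (tendsto_const_nhds.congr' ?_)
  filter_upwards [eventually_ge_atTop (N.size lam)] with n hn
  rw [h0, ballPair_smul, ballPair_comm, N.ballPair_ket hn, flow_neg_apply, Pi.smul_apply,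
    smul_eq_mul]

end SlNetwork

/-! ### The one-parameter unitary group -/

namespace SlNetwork

variable {X : Type*} (N : SlNetwork X)

/-- The set of vertices of level at most `n`. -/
def ball (n : ℕ) : Finset X := (Finset.range (n + 1)).biUnion N.level

theorem mem_ball {n : ℕ} {x : X} : x ∈ N.ball n ↔ N.size x ≤ n := by
  simp [ball, N.mem_level]

theorem tendsto_ball : Tendsto N.ball atTop atTop :=
  tendsto_atTop_finset_of_monotone
    (fun _ _ h _ hx => N.mem_ball.2 ((N.mem_ball.1 hx).trans h))
    fun x => ⟨N.size x, N.mem_ball.2 le_rfl⟩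

theorem sum_ball {M : Type*} [AddCommMonoid M] (n : ℕ) (f : X → M) :
    ∑ x ∈ N.ball n, f x = ∑ k ∈ Finset.range (n + 1), ∑ x ∈ N.level k, f x :=
  Finset.sum_biUnion fun _ _ _ _ hij => Finset.disjoint_left.2 fun _ hx hy =>
    hij (((N.mem_level _ _).1 hx).symm.trans ((N.mem_level _ _).1 hy))

theorem ballPair_eq_sum (n : ℕ) (f g : X → ℝ) : N.ballPair n f g = ∑ x ∈ N.ball n, f x * g x :=
  (N.sum_ball n _).symm

theorem summable_sq_of_decay {f : X → ℝ} {B : ℝ}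
    (h : ∀ n : ℕ, ((n : ℝ) + 1) ^ 4 * N.sqn n f ≤ B) : Summable fun x => f x ^ 2 := by
  have hs : Summable fun n : ℕ => B / ((n : ℝ) + 1) ^ 4 := by
    have := (summable_nat_add_iff 1).2 (Real.summable_one_div_nat_pow.2 (by norm_num : 1 < 4))
    simpa [div_eq_mul_inv] using this.mul_left B
  have hle : ∀ n : ℕ, N.sqn n f ≤ B / ((n : ℝ) + 1) ^ 4 := fun n => by
    rw [le_div_iff₀' (by positivity)]
    exact h n
  refine summable_of_sum_le (c := ∑' n : ℕ, B / ((n : ℝ) + 1) ^ 4) (fun _ => sq_nonneg _)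
    fun u => ?_
  obtain ⟨n, hn⟩ := (tendsto_atTop.1 N.tendsto_ball u).exists
  calc ∑ x ∈ u, f x ^ 2 ≤ ∑ x ∈ N.ball n, f x ^ 2 :=
        Finset.sum_le_sum_of_subset_of_nonneg hn fun _ _ _ => sq_nonneg _
    _ = ∑ k ∈ Finset.range (n + 1), N.sqn k f := N.sum_ball n _
    _ ≤ ∑ k ∈ Finset.range (n + 1), B / ((k : ℝ) + 1) ^ 4 := Finset.sum_le_sum fun k _ => hle k
    _ ≤ _ := hs.sum_le_tsum _ fun k _ => (N.sqn_nonneg k f).trans (hle k)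

/-- A square-summable real function as a vector of the complex Hilbert space `ℓ²(X)`. -/
def ofRealVec (f : X → ℝ) (hf : Summable fun x => f x ^ 2) : lp (fun _ : X => ℂ) 2 :=
  ⟨fun x => (f x : ℂ), memℓp_gen (by simpa using hf)⟩

theorem inner_ofRealVec {f g : X → ℝ} (hf : Summable fun x => f x ^ 2)
    (hg : Summable fun x => g x ^ 2) {a : ℝ}
    (h : Tendsto (fun n => N.ballPair n f g) atTop (𝓝 a)) :
    inner ℂ (ofRealVec f hf) (ofRealVec g hg) = (a : ℂ) := by
  have h1 := (lp.hasSum_inner (𝕜 := ℂ) (ofRealVec f hf) (ofRealVec g hg)).comp N.tendsto_ball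
  refine tendsto_nhds_unique h1 ?_
  refine ((Complex.continuous_ofReal.tendsto a).comp h).congr fun n => ?_
  simp only [Function.comp_apply]
  rw [ballPair_eq_sum, Complex.ofReal_sum]
  refine Finset.sum_congr rfl fun x _ => ?_
  simp [ofRealVec, mul_comm]

theorem summable_sq_flow (lam : X) (s : ℝ) : Summable fun x => N.flow lam s x ^ 2 := by
  obtain ⟨B, hB⟩ := N.exists_sqn_flow_le lam |s|
  exact N.summable_sq_of_decay (hB s le_rfl)

/-- The explicit solution of `x' = (U - D) x` as a vector of `ℓ²(X)`. -/
def flowVec (s : ℝ) (lam : X) : lp (fun _ : X => ℂ) 2 :=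
  ofRealVec (N.flow lam s) (N.summable_sq_flow lam s)

theorem flowVec_apply (s : ℝ) (lam x : X) : N.flowVec s lam x = (N.flow lam s x : ℂ) := rfl

theorem inner_flowVec (c d : ℝ) (lam mu : X) :
    inner ℂ (N.flowVec c lam) (N.flowVec d mu) = (N.flow lam (c - d) mu : ℂ) :=
  N.inner_ofRealVec _ _ (N.tendsto_ballPair_flow_flow lam mu c d)

theorem orthonormal_flowVec (s : ℝ) : Orthonormal ℂ (N.flowVec s) := by
  rw [orthonormal_iff_ite]
  intro lam mu
  rw [inner_flowVec, sub_self, flow_zero, ket, Pi.single_apply]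
  simp [eq_comm, apply_ite]

/-- The isometry of `ℓ²(X)` which takes the basis vectors to the explicit solutions of
`x' = (U - D) x` at time `s`. -/
def evolve (s : ℝ) : lp (fun _ : X => ℂ) 2 →ₗᵢ[ℂ] lp (fun _ : X => ℂ) 2 :=
  (N.orthonormal_flowVec s).orthogonalFamily.linearIsometry

theorem evolve_single (s : ℝ) (lam : X) (a : ℂ) :
    N.evolve s (lp.single 2 lam a) = a • N.flowVec s lam := by
  rw [evolve, OrthogonalFamily.linearIsometry_apply_single]
  simp

/-- Two continuous linear operators on `ℓ²(X)` with the same matrix are equal. -/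
theorem ext_matrix {S T : lp (fun _ : X => ℂ) 2 →L[ℂ] lp (fun _ : X => ℂ) 2}
    (h : ∀ lam rho, S (lp.single 2 lam 1) rho = T (lp.single 2 lam 1) rho) : S = T := by
  refine lp.ext_continuousLinearMap (by simp) fun lam => ?_
  refine ContinuousLinearMap.ext_ring ?_
  refine lp.ext (funext fun rho => ?_)
  exact h lam rho

/-- The adjoint of `exp (s (U - D))` is the same operator at time `-s`. -/
theorem evolve_apply (s : ℝ) (f : lp (fun _ : X => ℂ) 2) (rho : X) :
    N.evolve s f rho = inner ℂ (N.flowVec (-s) rho) f := by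
  have h : (lp.evalCLM ℂ (fun _ : X => ℂ) 2 rho) ∘L (N.evolve s).toContinuousLinearMap =
      innerSL ℂ (N.flowVec (-s) rho) := by
    refine lp.ext_continuousLinearMap (by simp) fun lam => ?_
    refine ContinuousLinearMap.ext_ring ?_
    change N.evolve s (lp.single 2 lam 1) rho =
      inner ℂ (N.flowVec (-s) rho) (lp.single 2 lam (1 : ℂ))
    rw [evolve_single, lp.inner_single_right, one_smul, flowVec_apply, flowVec_apply,
      flow_neg_apply]
    simp
  exact DFunLike.congr_fun h f

theorem evolve_add (r s : ℝ) (f : lp (fun _ : X => ℂ) 2) :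
    N.evolve (r + s) f = N.evolve r (N.evolve s f) := by
  have h : (N.evolve (r + s)).toContinuousLinearMap =
      (N.evolve r).toContinuousLinearMap ∘L (N.evolve s).toContinuousLinearMap := by
    refine ext_matrix fun lam rho => ?_
    change N.evolve (r + s) (lp.single 2 lam 1) rho =
      N.evolve r (N.evolve s (lp.single 2 lam 1)) rho
    rw [evolve_apply N r, evolve_single, evolve_single, one_smul, one_smul, flowVec_apply,
      inner_flowVec, ← flow_neg_apply]
    congr 2
    ring
  exact DFunLike.congr_fun h f

theorem evolve_zero (f : lp (fun _ : X => ℂ) 2) : N.evolve 0 f = f := by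
  have h : (N.evolve 0).toContinuousLinearMap = ContinuousLinearMap.id ℂ _ := by
    refine ext_matrix fun lam rho => ?_
    change N.evolve 0 (lp.single 2 lam 1) rho =
      (lp.single 2 lam (1 : ℂ) : lp (fun _ : X => ℂ) 2) rho
    rw [evolve_single, one_smul, flowVec_apply, flow_zero, ket, lp.coeFn_single,
      Pi.single_apply, Pi.single_apply]
    split_ifs <;> simp
  exact DFunLike.congr_fun h f

/-- The one-parameter unitary group of `ℓ²(X)` generated by `U - D`. -/
def group (s : ℝ) : lp (fun _ : X => ℂ) 2 ≃ₗᵢ[ℂ] lp (fun _ : X => ℂ) 2 :=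
  LinearIsometryEquiv.ofSurjective (N.evolve s) fun f =>
    ⟨N.evolve (-s) f, by rw [← evolve_add, add_neg_cancel, evolve_zero]⟩

theorem group_apply (s : ℝ) (f : lp (fun _ : X => ℂ) 2) : N.group s f = N.evolve s f := rfl

/-- Weak continuity implies strong continuity, as all the vectors have norm one. -/
theorem continuous_flowVec (lam : X) : Continuous fun s => N.flowVec s lam := by
  rw [continuous_iff_continuousAt]
  intro s
  rw [ContinuousAt, tendsto_iff_norm_sub_tendsto_zero]
  have h : ∀ u, ‖N.flowVec u lam - N.flowVec s lam‖ = √(2 - 2 * N.flow lam (u - s) lam) := by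
    intro u
    rw [← Real.sqrt_sq (norm_nonneg (N.flowVec u lam - N.flowVec s lam)),
      norm_sub_sq (𝕜 := ℂ), (N.orthonormal_flowVec u).1, (N.orthonormal_flowVec s).1,
      inner_flowVec]
    congr 1
    simp
    ring
  simp_rw [h]
  have hc : ContinuousAt (fun u => √(2 - 2 * N.flow lam (u - s) lam)) s := by
    refine Real.continuous_sqrt.continuousAt.comp ?_
    refine continuousAt_const.sub (continuousAt_const.mul ?_)
    exact ((N.isFlow_flow lam (s - s) lam).continuousAt.comp (f := fun u => u - s) (x := s)
      (continuous_sub_right s).continuousAt)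
  have := hc.tendsto
  rw [sub_self, flow_zero] at this
  simpa [ket] using this

theorem continuous_evolve (f : lp (fun _ : X => ℂ) 2) : Continuous fun s => N.evolve s f := by
  have h : TendstoUniformly
      (fun (u : Finset X) s => N.evolve s (∑ x ∈ u, lp.single 2 x (f x)))
      (fun s => N.evolve s f) atTop := by
    rw [Metric.tendstoUniformly_iff]
    intro ε hε
    filter_upwards [Metric.tendsto_nhds.1 (lp.hasSum_single (by simp) f) ε hε] with u hu s
    rwa [(N.evolve s).isometry.dist_eq, dist_comm]
  refine h.continuous (Frequently.of_forall fun u => ?_)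
  simp only [map_sum, evolve_single]
  exact continuous_finsetSum _ fun x _ =>
    (continuous_const_smul (f x : ℂ)).comp (N.continuous_flowVec x)

/-- The vector `(U - D) 1_lam` of `ℓ²(X)`. -/
def genVec (lam : X) : lp (fun _ : X => ℂ) 2 :=
  ∑ nu ∈ N.level (N.size lam + 1), (N.w lam nu : ℂ) • lp.single 2 nu (1 : ℂ) -
    ∑ mu ∈ N.level (N.size lam - 1), (N.w mu lam : ℂ) • lp.single 2 mu (1 : ℂ)

/-- Pairing with `(U - D) 1_lam` is the transposed operator `D - U` at `lam`. -/
theorem inner_genVec (lam : X) (f : lp (fun _ : X => ℂ) 2) :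
    inner ℂ (N.genVec lam) f =
      ((N.down (fun x => (f x).re) lam - N.up (fun x => (f x).re) lam : ℝ) : ℂ) +
      ((N.down (fun x => (f x).im) lam - N.up (fun x => (f x).im) lam : ℝ) : ℂ) * Complex.I := by
  have h : inner ℂ (N.genVec lam) f =
      ∑ nu ∈ N.level (N.size lam + 1), (N.w lam nu : ℂ) * f nu -
        ∑ mu ∈ N.level (N.size lam - 1), (N.w mu lam : ℂ) * f mu := by
    rw [genVec, inner_sub_left, sum_inner, sum_inner]
    congr 1 <;> refine Finset.sum_congr rfl fun x _ => ?_ <;>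
      rw [inner_smul_left, lp.inner_single_left] <;> simp
  rw [h]
  apply Complex.ext <;> simp [down_apply, up_apply]

theorem hasDerivAt_evolve_single_apply (s : ℝ) (lam rho : X) :
    HasDerivAt (fun s => N.evolve s (lp.single 2 lam 1) rho)
      (N.evolve s (N.genVec lam) rho) s := by
  have h1 : (fun s => N.evolve s (lp.single 2 lam 1) rho) =
      fun s => ((N.flow rho (-s) lam : ℝ) : ℂ) := by
    ext s
    rw [evolve_single, one_smul, flowVec_apply, flow_neg_apply]
  have h2 : N.evolve s (N.genVec lam) rho =
      ((-(N.up (N.flow rho (-s)) - N.down (N.flow rho (-s))) lam : ℝ) : ℂ) := by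
    rw [evolve_apply, ← inner_conj_symm, inner_genVec]
    simp only [flowVec_apply, Complex.ofReal_re, Complex.ofReal_im]
    have h0 : ∀ T : (X → ℝ) →ₗ[ℝ] (X → ℝ), T (fun _ => 0) lam = 0 := fun T =>
      congrFun (map_zero T) lam
    rw [h0, h0]
    simp
  rw [h1, h2]
  refine HasDerivAt.ofReal_comp ?_
  convert! (N.isFlow_flow rho (-s) lam).comp s (hasDerivAt_neg s) using 1
  ring

/-- The orbits of the basis vectors are differentiable in norm. Coordinatewise differentiability
shows that an orbit is the integral of the continuous curve `exp (s (U - D)) (U - D) 1_lam`. -/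
theorem hasDerivAt_evolve_single (lam : X) :
    HasDerivAt (fun s => N.evolve s (lp.single 2 lam 1)) (N.genVec lam) 0 := by
  have hc := N.continuous_evolve (N.genVec lam)
  -- the orbit as an integral, by the fundamental theorem of calculus in each coordinate
  have h : (fun s => N.evolve s (lp.single 2 lam 1)) =
      fun s => lp.single 2 lam (1 : ℂ) + ∫ u in (0 : ℝ)..s, N.evolve u (N.genVec lam) := by
    ext s rho
    have h1 : ∫ u in (0 : ℝ)..s, N.evolve u (N.genVec lam) rho =
        N.evolve s (lp.single 2 lam 1) rho - N.evolve 0 (lp.single 2 lam 1) rho :=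
      intervalIntegral.integral_eq_sub_of_hasDerivAt
        (fun u _ => N.hasDerivAt_evolve_single_apply u lam rho)
        (((lp.evalCLM ℂ (fun _ : X => ℂ) 2 rho).continuous.comp hc).intervalIntegrable _ _)
    have h2 := (lp.evalCLM ℂ (fun _ : X => ℂ) 2 rho).intervalIntegral_comp_comm
      (hc.intervalIntegrable (μ := volume) 0 s)
    change ∫ u in (0 : ℝ)..s, N.evolve u (N.genVec lam) rho =
      (∫ u in (0 : ℝ)..s, N.evolve u (N.genVec lam) : lp (fun _ : X => ℂ) 2) rho at h2
    rw [lp.coeFn_add, Pi.add_apply, ← h2, h1, evolve_zero]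
    ring
  rw [h]
  have h3 := (intervalIntegral.integral_hasDerivAt_right (hc.intervalIntegrable 0 0)
    (hc.stronglyMeasurableAtFilter _ _) hc.continuousAt).const_add (lp.single 2 lam (1 : ℂ))
  rwa [evolve_zero] at h3

/-- A one-parameter unitary group whose generator extends `U - D` takes the basis vectors to the
explicit solutions of `x' = (U - D) x`. -/
theorem eq_flowVec_of_hasDerivAt
    {V : ℝ → (lp (fun _ : X => ℂ) 2 ≃ₗᵢ[ℂ] lp (fun _ : X => ℂ) 2)}
    (h0 : V 0 = 1) (hadd : ∀ r s, V (r + s) = V r * V s)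
    (hder : ∀ lam, HasDerivAt (fun s => V s (lp.single 2 lam 1)) (N.genVec lam) 0)
    (s : ℝ) (lam : X) : V s (lp.single 2 lam 1) = N.flowVec s lam := by
  have hinv : ∀ s f, V s (V (-s) f) = f := fun s f => by
    have := hadd s (-s)
    rw [add_neg_cancel, h0] at this
    exact (DFunLike.congr_fun this f).symm
  have hmove : ∀ s f g, inner ℂ (V (-s) f) g = inner ℂ f (V s g) := fun s f g => by
    rw [← (V s).inner_map_map, hinv]
  set x : ℝ → lp (fun _ : X => ℂ) 2 := fun s => V s (lp.single 2 lam 1) with hx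
  -- the curve `x` solves `x' = (U - D) x` coordinatewise
  have hcoord : ∀ s rho, HasDerivAt (fun s => x s rho) (-inner ℂ (N.genVec rho) (x s)) s := by
    intro s rho
    -- the derivative at zero is moved to time `-s` by the group law
    have h1 : HasDerivAt (fun u => V (-u) (lp.single 2 rho 1)) (-V (-s) (N.genVec rho)) s := by
      have h2 : HasDerivAt (fun u : ℝ => s - u) (-1) s := by
        simpa using (hasDerivAt_id s).const_sub s
      have h3 := hder rho
      rw [← sub_self s] at h3
      have h4 := ((V (-s)).toLinearIsometry.toContinuousLinearMap.restrictScalars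
        ℝ).hasFDerivAt.comp_hasDerivAt s (h3.scomp s h2)
      have h5 : (fun u => V (-u) (lp.single 2 rho (1 : ℂ))) =
          fun u => V (-s) (V (s - u) (lp.single 2 rho (1 : ℂ))) := by
        ext1 u
        rw [show -u = -s + (s - u) by ring, hadd]
        rfl
      rw [h5]
      convert! h4 using 1
      simp
    have h6 : (fun s => x s rho) =
        fun s => inner ℂ (V (-s) (lp.single 2 rho 1)) (lp.single 2 lam (1 : ℂ)) := by
      ext s
      rw [hmove, lp.inner_single_left]
      simp [hx]
    rw [h6]
    have h7 := h1.inner ℂ (hasDerivAt_const s (lp.single 2 lam (1 : ℂ)))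
    convert! h7 using 1
    rw [inner_zero_right, zero_add, inner_neg_left, hmove]
  have hnorm : ∀ s n, ∑ rho ∈ N.level n, ‖x s rho‖ ^ 2 ≤ 1 := fun s n => by
    have h := lp.sum_rpow_le_norm_rpow (p := 2) (by simp) (x s) (N.level n)
    have h1 : ‖x s‖ = 1 := by
      rw [hx, LinearIsometryEquiv.norm_map, lp.norm_single (by simp)]
      simp
    rw [h1] at h
    simpa using h
  -- the real and imaginary parts are bounded solutions with initial values `1_lam` and `0`
  have hre : N.IsFlow fun s rho => (x s rho).re := fun s rho => by
    have h := Complex.reCLM.hasFDerivAt.comp_hasDerivAt s (hcoord s rho)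
    rw [inner_genVec] at h
    convert! h using 1
    simp
  have him : N.IsFlow fun s rho => (x s rho).im := fun s rho => by
    have h := Complex.imCLM.hasFDerivAt.comp_hasDerivAt s (hcoord s rho)
    rw [inner_genVec] at h
    convert! h using 1
    simp
  have hreb : ∀ R : ℝ, ∃ A, ∀ s : ℝ, |s| ≤ R → ∀ n, N.sqn n (fun rho => (x s rho).re) ≤ A :=
    fun R => ⟨1, fun s _ n => (Finset.sum_le_sum fun rho _ =>
      sq_le_sq.2 (by simpa using Complex.abs_re_le_norm (x s rho))).trans (hnorm s n)⟩
  have himb : ∀ R : ℝ, ∃ A, ∀ s : ℝ, |s| ≤ R → ∀ n, N.sqn n (fun rho => (x s rho).im) ≤ A :=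
    fun R => ⟨1, fun s _ n => (Finset.sum_le_sum fun rho _ =>
      sq_le_sq.2 (by simpa using Complex.abs_im_le_norm (x s rho))).trans (hnorm s n)⟩
  have hx0 : ∀ rho, x 0 rho = ((ket lam rho : ℝ) : ℂ) := fun rho => by
    have h : x 0 = lp.single 2 lam 1 := by
      simp only [hx, h0]
      rfl
    rw [h, ket, Pi.single_apply, lp.coeFn_single, Pi.single_apply]
    split_ifs <;> simp
  have h1 := hre.eq_smul_flow N hreb (lam := lam) (c := 1) (by ext rho; simp [hx0]) s
  have h2 := him.eq_smul_flow N himb (lam := lam) (c := 0) (by ext rho; simp [hx0]) s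
  ext rho
  have h3 := congrFun h1 rho
  have h4 := congrFun h2 rho
  apply Complex.ext
  · simpa [flowVec_apply] using h3
  · simpa [flowVec_apply] using h4

end SlNetwork

/-! ### Truncation of eigenfunctions of the Markov operator -/

namespace SlNetwork

variable {X : Type*} (N : SlNetwork X)

/-- The operator whose multiple by `(1 - r²)⁻¹` is the Markov generator, conjugated by the square
root of the weights. -/
def markov (r : ℝ) (f : X → ℝ) : X → ℝ :=
  r • (N.up f + N.down f) - ((1 + r ^ 2) / 2) • N.grade f + ((1 - r ^ 2) * N.t / 2) • f

theorem markov_apply (r : ℝ) (f : X → ℝ) (x : X) : N.markov r f x =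
    r * (N.up f x + N.down f x) - (N.size x + r ^ 2 * (N.size x + N.t)) * f x := by
  simp only [markov, Pi.sub_apply, Pi.add_apply, Pi.smul_apply, smul_eq_mul, grade_apply]
  ring

/-- The restriction of a function to the levels up to `n`, extended by zero. -/
def trunc (n : ℕ) (f : X → ℝ) (x : X) : ℝ := if N.size x ≤ n then f x else 0

/-- The commutator of `U + D` with the truncation at level `n`. It lives on the levels `n` and
`n + 1`. -/
def boundary (n : ℕ) (f : X → ℝ) (x : X) : ℝ :=
  if N.size x = n + 1 then N.up f x else if N.size x = n then -N.down f x else 0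

theorem markov_trunc (r : ℝ) (n : ℕ) (f : X → ℝ) :
    N.markov r (N.trunc n f) = N.trunc n (N.markov r f) + r • N.boundary n f := by
  ext x
  rw [Pi.add_apply, Pi.smul_apply, smul_eq_mul, trunc, boundary, markov_apply, markov_apply]
  have hup : N.up (N.trunc n f) x = if N.size x ≤ n + 1 then N.up f x else 0 := by
    rcases Nat.eq_zero_or_pos (N.size x) with h0 | h0
    · rw [N.up_apply_of_size_eq_zero _ h0, N.up_apply_of_size_eq_zero _ h0, ite_self]
    · split_ifs with h
      · refine Finset.sum_congr rfl fun y hy => ?_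
        rw [N.mem_level] at hy
        rw [trunc, if_pos (by omega)]
      · refine Finset.sum_eq_zero fun y hy => ?_
        rw [N.mem_level] at hy
        rw [trunc, if_neg (by omega), mul_zero]
  have hdown : N.down (N.trunc n f) x = if N.size x + 1 ≤ n then N.down f x else 0 := by
    split_ifs with h
    · refine Finset.sum_congr rfl fun y hy => ?_
      rw [N.mem_level] at hy
      rw [trunc, if_pos (by omega)]
    · refine Finset.sum_eq_zero fun y hy => ?_
      rw [N.mem_level] at hy
      rw [trunc, if_neg (by omega), mul_zero]
  rw [hup, hdown, trunc]
  rcases lt_trichotomy (N.size x) n with h | h | h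
  · simp only [show N.size x ≤ n + 1 by omega, show N.size x + 1 ≤ n by omega,
      show N.size x ≤ n by omega, show N.size x ≠ n + 1 by omega, show N.size x ≠ n by omega,
      if_true, if_false]
    ring
  · simp [h]
    ring
  · by_cases h1 : N.size x = n + 1
    · simp [h1]
    · simp [show ¬ N.size x ≤ n + 1 by omega, show ¬ N.size x + 1 ≤ n by omega,
        show ¬ N.size x ≤ n by omega, h1, show N.size x ≠ n by omega]

/-- The restriction of a real function to the levels up to `n`, as a vector of `ℓ²(X)`. -/
def finVec (n : ℕ) (f : X → ℝ) : lp (fun _ : X => ℂ) 2 :=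
  ∑ x ∈ N.ball n, lp.single 2 x (f x : ℂ)

theorem finVec_apply (n : ℕ) (f : X → ℝ) (x : X) :
    N.finVec n f x = (N.trunc n f x : ℂ) := by
  rw [finVec, lp.coeFn_sum, Finset.sum_apply, trunc]
  simp only [lp.coeFn_single, Pi.single_apply]
  rw [Finset.sum_ite_eq]
  by_cases h : N.size x ≤ n <;> simp [mem_ball, h]

theorem norm_finVec_sq (n : ℕ) (f : X → ℝ) :
    ‖N.finVec n f‖ ^ 2 = ∑ k ∈ Finset.range (n + 1), N.sqn k f := by
  have h := lp.norm_sum_single (p := 2) (by simp) (fun x => (f x : ℂ)) (N.ball n)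
  rw [N.sum_ball n (fun x => ‖(f x : ℂ)‖ ^ (2 : ENNReal).toReal)] at h
  simpa [finVec, sqn] using h

theorem tendsto_finVec {f : X → ℝ} (hf : Summable fun x => f x ^ 2) :
    Tendsto (fun n => N.finVec n f) atTop (𝓝 (ofRealVec f hf)) :=
  (lp.hasSum_single (by simp) (ofRealVec f hf)).comp N.tendsto_ball

theorem tendsto_finVec_boundary {f : X → ℝ} {B : ℝ}
    (h : ∀ n : ℕ, ((n : ℝ) + 1) ^ 4 * N.sqn n f ≤ B) :
    Tendsto (fun n => N.finVec (n + 1) (N.boundary n f)) atTop (𝓝 0) := by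
  have ht := N.t_pos
  have hle : ∀ n k : ℕ, n ≤ k → N.sqn k f ≤ B / ((n : ℝ) + 1) ^ 4 := fun n k hk => by
    rw [le_div_iff₀' (by positivity)]
    refine le_trans ?_ (h k)
    gcongr
    exact N.sqn_nonneg _ _
  have hB : 0 ≤ B := le_trans (mul_nonneg (by positivity) (N.sqn_nonneg 0 f)) (h 0)
  have hnorm : ∀ n : ℕ, ‖N.finVec (n + 1) (N.boundary n f)‖ ^ 2 ≤
      2 * max 1 N.t * B * (1 / ((n : ℝ) + 1)) := by
    intro n
    rw [norm_finVec_sq, Finset.sum_range_succ, Finset.sum_range_succ, Finset.sum_eq_zero]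
    · have h1 : N.sqn (n + 1) (N.boundary n f) = N.sqn (n + 1) (N.up f) :=
        Finset.sum_congr rfl fun x hx => by rw [boundary, if_pos ((N.mem_level _ _).1 hx)]
      have h2 : N.sqn n (N.boundary n f) = N.sqn n (N.down f) :=
        Finset.sum_congr rfl fun x hx => by
          have := (N.mem_level _ _).1 hx
          rw [boundary, if_neg (by omega), if_pos this, neg_sq]
      have h3 : (n : ℝ) + N.t ≤ max 1 N.t * ((n : ℝ) + 1) := by
        have := le_max_left 1 N.t
        have := le_max_right 1 N.t
        nlinarith [n.cast_nonneg (α := ℝ)]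
      have h4 : ∀ S ≤ B / ((n : ℝ) + 1) ^ 4, ((n : ℝ) + 1) * (n + N.t) * S ≤
          max 1 N.t * B * (1 / ((n : ℝ) + 1)) := fun S hS => by
        calc ((n : ℝ) + 1) * (n + N.t) * S
            ≤ ((n : ℝ) + 1) * (n + N.t) * (B / ((n : ℝ) + 1) ^ 4) := by gcongr
          _ ≤ ((n : ℝ) + 1) * (max 1 N.t * ((n : ℝ) + 1)) * (B / ((n : ℝ) + 1) ^ 4) := by
              gcongr
          _ = max 1 N.t * B * (1 / ((n : ℝ) + 1) ^ 2) := by field_simp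
          _ ≤ max 1 N.t * B * (1 / ((n : ℝ) + 1)) := by
              gcongr
              exact le_self_pow₀ (by linarith [n.cast_nonneg (α := ℝ)]) two_ne_zero
      rw [h1, h2]
      have h5 := (N.sqn_up_le n f).trans (h4 _ (hle n n le_rfl))
      have h6 := (N.sqn_down_le n f).trans (h4 _ (hle n (n + 1) n.le_succ))
      linarith
    · intro k hk
      refine Finset.sum_eq_zero fun x hx => ?_
      rw [N.mem_level] at hx
      rw [Finset.mem_range] at hk
      rw [boundary, if_neg (by omega), if_neg (by omega), zero_pow two_ne_zero]
  have hlim : Tendsto (fun n : ℕ => ‖N.finVec (n + 1) (N.boundary n f)‖ ^ 2) atTop (𝓝 0) :=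
    squeeze_zero (fun _ => sq_nonneg _) hnorm (by
      simpa using (tendsto_one_div_add_atTop_nhds_zero_nat (𝕜 := ℝ)).const_mul
        (2 * max 1 N.t * B))
  rw [tendsto_zero_iff_norm_tendsto_zero]
  simpa using hlim.sqrt

/-- The truncations of an eigenfunction of the Markov operator approximate it in graph norm. -/
theorem tendsto_finVec_markov {r : ℝ} (hr : |r| < 1) (lam : X)
    (hf : Summable fun x => N.meix r lam x ^ 2) :
    Tendsto (fun n => N.finVec (n + 1) (N.markov r (N.trunc n (N.meix r lam)))) atTop
      (𝓝 ((-((1 - r ^ 2) * N.size lam) : ℂ) • ofRealVec (N.meix r lam) hf)) := by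
  have hr2 : 0 < 1 - r ^ 2 := by
    have := (sq_lt_one_iff_abs_lt_one r).2 hr
    linarith
  obtain ⟨B, hB⟩ := N.exists_sqn_meix_le lam (r₀ := (|r| + 1) / 2) (by positivity) (by linarith)
  have h1 := (N.tendsto_finVec hf).const_smul (-((1 - r ^ 2) * N.size lam) : ℂ)
  have h2 := (N.tendsto_finVec_boundary (hB r (by linarith))).const_smul (r : ℂ)
  have h3 := h1.add h2
  rw [smul_zero, add_zero] at h3
  refine h3.congr fun n => ?_
  have h4 : N.markov r (N.meix r lam) = -(((1 - r ^ 2) * N.size lam) • N.meix r lam) :=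
    N.meix_eigen hr2 lam
  ext x
  simp only [lp.coeFn_add, lp.coeFn_smul, Pi.add_apply, Pi.smul_apply, finVec_apply, smul_eq_mul]
  rw [markov_trunc, h4]
  simp only [trunc, Pi.add_apply, Pi.smul_apply, Pi.neg_apply, smul_eq_mul]
  by_cases hx : N.size x ≤ n
  · simp [hx, Nat.le_succ_of_le hx]
  · by_cases hx1 : N.size x ≤ n + 1 <;> simp [hx, hx1]

end SlNetwork

/-! ### Weighted `ℓ²` spaces over a countable set -/

section DiscreteL2

variable {X : Type*} [Countable X] [MeasurableSpace X] [DiscreteMeasurableSpace X] {m : X → ℝ}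

/-- The discrete measure with weights `m`. -/
def weightMeasure (m : X → ℝ) : Measure X :=
  Measure.sum fun x => ENNReal.ofReal (m x) • Measure.dirac x

theorem ae_weightMeasure_iff (hm : ∀ x, 0 < m x) {p : X → Prop} :
    (∀ᵐ x ∂weightMeasure m, p x) ↔ ∀ x, p x := by
  rw [weightMeasure, Measure.ae_sum_iff]
  refine forall_congr' fun x => ?_
  rw [Measure.ae_ennreal_smul_measure_iff (by simpa using hm x), ae_dirac_eq]
  rfl

theorem memLp_weightMeasure_iff (hm : ∀ x, 0 < m x) {f : X → ℂ} :
    MemLp f 2 (weightMeasure m) ↔ Summable fun x => m x * ‖f x‖ ^ 2 := by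
  rw [memLp_two_iff_integrable_sq_norm (Measurable.of_discrete.aestronglyMeasurable),
    weightMeasure, integrable_sum_dirac_iff (by simp)]
  simp [ENNReal.toReal_ofReal (hm _).le]

theorem memLp_div_sqrt (hm : ∀ x, 0 < m x) (h : lp (fun _ : X => ℂ) 2) :
    MemLp (fun x => h x / (√(m x) : ℂ)) 2 (weightMeasure m) := by
  rw [memLp_weightMeasure_iff hm]
  have h1 := (lp.memℓp h).summable (by simp)
  refine h1.congr fun x => ?_
  have := Real.sq_sqrt (hm x).le
  have h0 := (hm x).ne'
  rw [norm_div, Complex.norm_real, Real.norm_of_nonneg (Real.sqrt_nonneg _), div_pow, this]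
  field_simp
  simp

/-- The linear map from `ℓ²(X)` to the weighted space, which divides by the square root of the
weight. -/
def weightLinear (hm : ∀ x, 0 < m x) : lp (fun _ : X => ℂ) 2 →ₗ[ℂ] Lp ℂ 2 (weightMeasure m) where
  toFun h := (memLp_div_sqrt hm h).toLp
  map_add' f g := by
    rw [← MemLp.toLp_add]
    refine MemLp.toLp_congr _ _ (Eventually.of_forall fun x => ?_)
    simp [add_div]
  map_smul' c f := by
    rw [RingHom.id_apply, ← MemLp.toLp_const_smul]
    refine MemLp.toLp_congr _ _ (Eventually.of_forall fun x => ?_)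
    simp [mul_div_assoc]

theorem weightLinear_apply (hm : ∀ x, 0 < m x) (h : lp (fun _ : X => ℂ) 2) (x : X) :
    weightLinear hm h x = h x / (√(m x) : ℂ) :=
  (ae_weightMeasure_iff hm).1 (memLp_div_sqrt hm h).coeFn_toLp x

theorem norm_weightLinear (hm : ∀ x, 0 < m x) (h : lp (fun _ : X => ℂ) 2) :
    ‖weightLinear hm h‖ = ‖h‖ := by
  have h1 : ‖weightLinear hm h‖ ^ 2 = ∑' x, ‖h x‖ ^ 2 := by
    have h2 : ((‖weightLinear hm h‖ ^ 2 : ℝ) : ℂ) = ((∑' x, ‖h x‖ ^ 2 : ℝ) : ℂ) := by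
      rw [Complex.ofReal_pow]
      refine (inner_self_eq_norm_sq_to_K (𝕜 := ℂ) (weightLinear hm h)).symm.trans ?_
      rw [L2.inner_def, Complex.ofReal_tsum]
      refine (integral_sum_dirac (x := fun x : X => x) (c := fun x => ENNReal.ofReal (m x))
        (by simp)).trans (tsum_congr fun x => ?_)
      have h0 : (m x : ℂ) ≠ 0 := by exact_mod_cast (hm x).ne'
      have h3 : ((√(m x) : ℂ)) ^ 2 = m x := by exact_mod_cast Real.sq_sqrt (hm x).le
      have h4 : (inner ℂ (weightLinear hm h x) (weightLinear hm h x) : ℂ) =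
          ((‖h x‖ ^ 2 / m x : ℝ) : ℂ) := by
        refine (inner_self_eq_norm_sq_to_K (𝕜 := ℂ) (weightLinear hm h x)).trans ?_
        rw [weightLinear_apply, norm_div, Complex.norm_real,
          Real.norm_of_nonneg (Real.sqrt_nonneg _)]
        push_cast
        rw [div_pow, ← h3]
        rfl
      refine (congrArg (fun z : ℂ => (ENNReal.ofReal (m x)).toReal • z) h4).trans ?_
      rw [ENNReal.toReal_ofReal (hm x).le, Complex.real_smul]
      push_cast
      field_simp
    exact_mod_cast h2
  have h2 := lp.norm_rpow_eq_tsum (p := 2) (by simp) h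
  have h3 : ‖weightLinear hm h‖ ^ 2 = ‖h‖ ^ 2 := by
    rw [h1]; simpa using h2.symm
  exact (pow_left_inj₀ (norm_nonneg _) (norm_nonneg _) two_ne_zero).1 h3

theorem weightLinear_surjective (hm : ∀ x, 0 < m x) : Function.Surjective (weightLinear hm) := by
  intro f
  have hf := (memLp_weightMeasure_iff hm).1 (Lp.memLp f)
  have h0 : ∀ x, (√(m x) : ℂ) ≠ 0 := fun x => by
    exact_mod_cast (Real.sqrt_pos.2 (hm x)).ne'
  refine ⟨⟨fun x => f x * (√(m x) : ℂ), memℓp_gen ?_⟩, Lp.ext (Eventually.of_forall fun x => ?_)⟩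
  · refine hf.congr fun x => ?_
    have := Real.sq_sqrt (hm x).le
    simp [mul_pow, this, abs_of_nonneg, Real.sqrt_nonneg, mul_comm]
  · rw [weightLinear_apply]
    exact mul_div_cancel_right₀ _ (h0 x)

/-- The unitary equivalence of `ℓ²(X)` and the weighted space. -/
def weightEquiv (hm : ∀ x, 0 < m x) : lp (fun _ : X => ℂ) 2 ≃ₗᵢ[ℂ] Lp ℂ 2 (weightMeasure m) :=
  LinearIsometryEquiv.ofSurjective ⟨weightLinear hm, norm_weightLinear hm⟩
    (weightLinear_surjective hm)

theorem weightEquiv_apply (hm : ∀ x, 0 < m x) (h : lp (fun _ : X => ℂ) 2) (x : X) :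
    weightEquiv hm h x = h x / (√(m x) : ℂ) :=
  weightLinear_apply hm h x

theorem weightEquiv_symm_apply (hm : ∀ x, 0 < m x) (f : Lp ℂ 2 (weightMeasure m)) (x : X) :
    (weightEquiv hm).symm f x = (√(m x) : ℂ) * f x := by
  have h0 : (√(m x) : ℂ) ≠ 0 := by exact_mod_cast (Real.sqrt_pos.2 (hm x)).ne'
  have h := weightEquiv_apply hm ((weightEquiv hm).symm f) x
  rw [LinearIsometryEquiv.apply_symm_apply] at h
  rw [h]
  field_simp

theorem continuous_eval_weightMeasure (hm : ∀ x, 0 < m x) (x : X) :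
    Continuous fun f : Lp ℂ 2 (weightMeasure m) => f x := by
  have h0 : (√(m x) : ℂ) ≠ 0 := by exact_mod_cast (Real.sqrt_pos.2 (hm x)).ne'
  have h : (fun f : Lp ℂ 2 (weightMeasure m) => f x) = fun f =>
      lp.evalCLM ℂ (fun _ : X => ℂ) 2 x ((weightEquiv hm).symm f) / (√(m x) : ℂ) := by
    ext f
    change _ = (weightEquiv hm).symm f x / _
    rw [weightEquiv_symm_apply, mul_div_cancel_left₀ _ h0]
  rw [h]
  exact ((lp.evalCLM ℂ (fun _ : X => ℂ) 2 x).continuous.comp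
    (weightEquiv hm).symm.continuous).div_const _

end DiscreteL2

/-! ### Finite order ideals, dimensions and Kerov triplets -/

namespace FinIdeal

variable {P : Type*} [PartialOrder P]

theorem mem_below {mu lam : FinIdeal P} : mu ∈ lam.below ↔ mu.carrier ⊆ lam.carrier := by
  simp [below]

theorem mem_down {mu lam : FinIdeal P} : mu ∈ lam.down ↔ Covers mu lam := by
  simp only [down, Finset.mem_filter, mem_below]
  exact ⟨fun h => h.2, fun h => ⟨h.1, h⟩⟩

theorem size_empty : (empty : FinIdeal P).size = 0 := rfl

theorem size_eq_zero {lam : FinIdeal P} : lam.size = 0 ↔ lam = empty := by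
  rw [size, Finset.card_eq_zero]
  exact ⟨fun h => FinIdeal.ext h, fun h => h ▸ rfl⟩

theorem size_le_of_subset {mu lam : FinIdeal P} (h : mu.carrier ⊆ lam.carrier) :
    mu.size ≤ lam.size := Finset.card_le_card h

theorem empty_subset (lam : FinIdeal P) : (empty : FinIdeal P).carrier ⊆ lam.carrier :=
  Finset.empty_subset _

theorem exists_covers {lam : FinIdeal P} (h : lam.size ≠ 0) : ∃ mu, Covers mu lam := by
  have hne : lam.carrier.Nonempty := Finset.card_ne_zero.1 h
  obtain ⟨x, hx⟩ := lam.carrier.exists_maximal hne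
  refine ⟨⟨lam.carrier.erase x, fun a b hba ha => ?_⟩, Finset.erase_subset _ _, ?_⟩
  · simp only [Finset.coe_erase, Set.mem_sdiff, Finset.mem_coe, Set.mem_singleton_iff] at ha ⊢
    refine ⟨lam.lower hba ha.1, ?_⟩
    rintro rfl
    exact ha.2 (le_antisymm (hx.2 ha.1 hba) hba)
  · rw [size, size, Finset.card_erase_add_one hx.1]

/-- The multiplicativity of products over skew shapes. -/
theorem prod_sdiff_mul {M : Type*} [CommMonoid M] (f : P → M) {mu nu lam : FinIdeal P}
    (h1 : mu.carrier ⊆ nu.carrier) (h2 : nu.carrier ⊆ lam.carrier) :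
    (∏ x ∈ nu.carrier \ mu.carrier, f x) * ∏ x ∈ lam.carrier \ nu.carrier, f x =
      ∏ x ∈ lam.carrier \ mu.carrier, f x := by
  rw [mul_comm, ← Finset.prod_sdiff (Finset.sdiff_subset_sdiff h2 (le_refl mu.carrier))]
  congr 2
  ext x
  simp only [Finset.mem_sdiff]
  have := @h1 x
  tauto

theorem boxProd_mul (f : P → ℂ) {mu nu lam : FinIdeal P}
    (h1 : mu.carrier ⊆ nu.carrier) (h2 : nu.carrier ⊆ lam.carrier) :
    boxProd f mu nu * boxProd f nu lam = boxProd f mu lam :=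
  prod_sdiff_mul f h1 h2

/-- Every box is the last box of some ideal. -/
theorem exists_covers_sdiff_eq_singleton {x : P} {lam : FinIdeal P} (hx : x ∈ lam.carrier) :
    ∃ mu nu : FinIdeal P, mu.carrier ⊆ nu.carrier ∧ nu.carrier \ mu.carrier = {x} := by
  refine ⟨⟨lam.carrier.filter (· < x), fun a b hba ha => ?_⟩,
    ⟨lam.carrier.filter (· ≤ x), fun a b hba ha => ?_⟩, fun y hy => ?_, ?_⟩
  · simp only [Finset.coe_filter, Set.mem_ofPred_eq] at ha ⊢
    exact ⟨lam.lower hba ha.1, hba.trans_lt ha.2⟩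
  · simp only [Finset.coe_filter, Set.mem_ofPred_eq] at ha ⊢
    exact ⟨lam.lower hba ha.1, hba.trans ha.2⟩
  · simp only [Finset.mem_filter] at hy ⊢
    exact ⟨hy.1, hy.2.le⟩
  · ext y
    simp only [Finset.mem_sdiff, Finset.mem_filter, Finset.mem_singleton, not_and]
    constructor
    · rintro ⟨⟨h1, h2⟩, h3⟩
      exact (eq_or_lt_of_le h2).resolve_right (h3 h1)
    · rintro rfl
      exact ⟨⟨hx, le_rfl⟩, fun _ => lt_irrefl y⟩

end FinIdeal

namespace IdealGraph

open FinIdeal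

variable {P : Type*} [PartialOrder P] (G : IdealGraph P)

theorem mem_level {n : ℕ} {lam : FinIdeal P} : lam ∈ G.level n ↔ lam.size = n := by
  simp [level]

theorem mem_up {lam nu : FinIdeal P} : nu ∈ G.up lam ↔ Covers lam nu := by
  simp only [up, Finset.mem_filter, mem_level]
  exact ⟨fun h => h.2, fun h => ⟨h.2, h⟩⟩

/-- The finiteness of the levels makes the set of ideals countable. -/
theorem countable_finIdeal (G : IdealGraph P) : Countable (FinIdeal P) := by
  have h : (Set.univ : Set (FinIdeal P)) = ⋃ n : ℕ, {lam | lam.size = n} := by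
    ext lam; simp
  rw [← Set.countable_univ_iff, h]
  exact Set.countable_iUnion fun n => (G.level_finite n).countable

theorem pathSum_ne_zero {n : ℕ} {mu lam : FinIdeal P} (h : G.pathSum n mu lam ≠ 0) :
    mu.carrier ⊆ lam.carrier ∧ lam.size = mu.size + n := by
  induction n generalizing lam with
  | zero =>
    rw [pathSum] at h
    have : mu = lam := by
      by_contra hne
      exact h (if_neg hne)
    subst this
    exact ⟨Finset.Subset.refl _, rfl⟩
  | succ n ih =>
    obtain ⟨nu, hnu, h1⟩ := Finset.exists_ne_zero_of_sum_ne_zero h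
    have h2 := mem_down.1 hnu
    have h3 := ih (left_ne_zero_of_mul h1)
    exact ⟨h3.1.trans h2.1, by rw [h2.2, h3.2]; ring⟩

theorem pathSum_nonneg (n : ℕ) (mu lam : FinIdeal P) : 0 ≤ G.pathSum n mu lam := by
  induction n generalizing lam with
  | zero => rw [pathSum]; split_ifs <;> norm_num
  | succ n ih =>
    exact Finset.sum_nonneg fun nu hnu => mul_nonneg (ih nu) (G.mult_pos _ _ (mem_down.1 hnu)).le

theorem dim_eq_pathSum (lam : FinIdeal P) : G.dim lam = G.pathSum lam.size empty lam := by
  rw [dim, relDim, size_empty, Nat.sub_zero]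

theorem pathSum_empty_pos (n : ℕ) (lam : FinIdeal P) (h : lam.size = n) :
    0 < G.pathSum n empty lam := by
  induction n generalizing lam with
  | zero =>
    rw [size_eq_zero.1 h, pathSum, if_pos rfl]
    exact one_pos
  | succ n ih =>
    obtain ⟨mu, hmu⟩ := exists_covers (lam := lam) (by omega)
    refine Finset.sum_pos' (fun nu hnu => mul_nonneg (G.pathSum_nonneg _ _ _)
      (G.mult_pos _ _ (mem_down.1 hnu)).le) ⟨mu, mem_down.2 hmu, ?_⟩
    exact mul_pos (ih mu (by have := hmu.2; omega)) (G.mult_pos _ _ hmu)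

theorem dim_pos (lam : FinIdeal P) : 0 < G.dim lam := by
  rw [dim_eq_pathSum]
  exact G.pathSum_empty_pos _ _ rfl

theorem relDim_ne_zero {mu lam : FinIdeal P} (h : G.relDim mu lam ≠ 0) :
    mu.carrier ⊆ lam.carrier :=
  (G.pathSum_ne_zero h).1

theorem upOp_single (q : P → ℂ) (lam : FinIdeal P) (a : ℂ) (nu : FinIdeal P) :
    G.upOp q (Finsupp.single lam a) nu =
      if Covers lam nu then a * (G.mult lam nu * boxProd q lam nu) else 0 := by
  rw [upOp, Finsupp.linearCombination_single, Finsupp.smul_apply, Finsupp.finsetSum_apply]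
  simp only [Finsupp.single_apply, Finset.sum_ite_eq', mem_up, smul_eq_mul, mul_ite, mul_zero]

theorem downOp_single (q : P → ℂ) (lam : FinIdeal P) (a : ℂ) (mu : FinIdeal P) :
    G.downOp q (Finsupp.single lam a) mu =
      if Covers mu lam then a * (G.mult mu lam * boxProd q mu lam) else 0 := by
  rw [downOp, Finsupp.linearCombination_single, Finsupp.smul_apply, Finsupp.finsetSum_apply]
  simp only [Finsupp.single_apply, Finset.sum_ite_eq', mem_down, smul_eq_mul, mul_ite, mul_zero]

theorem upOp_apply (q : P → ℂ) (f : FinIdeal P →₀ ℂ) (nu : FinIdeal P) :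
    G.upOp q f nu = ∑ lam ∈ nu.down, f lam * (G.mult lam nu * boxProd q lam nu) := by
  induction f using Finsupp.induction_linear with
  | zero => simp
  | add f g hf hg => simp [hf, hg, add_mul, Finset.sum_add_distrib]
  | single lam a =>
    rw [upOp_single]
    simp only [Finsupp.single_apply, ite_mul, zero_mul, Finset.sum_ite_eq, mem_down]

theorem downOp_apply (q : P → ℂ) (f : FinIdeal P →₀ ℂ) (mu : FinIdeal P) :
    G.downOp q f mu = ∑ lam ∈ G.up mu, f lam * (G.mult mu lam * boxProd q mu lam) := by
  induction f using Finsupp.induction_linear with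
  | zero => simp
  | add f g hf hg => simp [hf, hg, add_mul, Finset.sum_add_distrib]
  | single lam a =>
    rw [downOp_single]
    simp only [Finsupp.single_apply, ite_mul, zero_mul, Finset.sum_ite_eq, mem_up]

/-- The matrix of `U ^ n` counts paths, weighted by `q` on the skew shape. -/
theorem upOp_pow_single (q : P → ℂ) (n : ℕ) (mu lam : FinIdeal P) :
    (G.upOp q ^ n) (Finsupp.single mu 1) lam = G.pathSum n mu lam * boxProd q mu lam := by
  induction n generalizing lam with
  | zero =>
    rw [pow_zero, Module.End.one_apply, Finsupp.single_apply, pathSum]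
    split_ifs with h
    · subst h; simp [boxProd]
    · simp
  | succ n ih =>
    rw [pow_succ', Module.End.mul_apply, upOp_apply, pathSum, Complex.ofReal_sum, Finset.sum_mul]
    refine Finset.sum_congr rfl fun nu hnu => ?_
    rw [ih, Complex.ofReal_mul]
    by_cases h : G.pathSum n mu nu = 0
    · simp [h]
    · rw [← boxProd_mul q (G.pathSum_ne_zero h).1 (mem_down.1 hnu).1]
      ring

theorem downOp_pow_single (q : P → ℂ) (n : ℕ) (mu lam : FinIdeal P) :
    (G.downOp q ^ n) (Finsupp.single lam 1) mu = G.pathSum n mu lam * boxProd q mu lam := by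
  induction n generalizing lam with
  | zero =>
    rw [pow_zero, Module.End.one_apply, Finsupp.single_apply, pathSum]
    by_cases h : lam = mu
    · subst h; simp [boxProd]
    · simp [h, Ne.symm h]
  | succ n ih =>
    have h1 : G.downOp q (Finsupp.single lam 1) =
        ∑ nu ∈ lam.down, ((G.mult nu lam : ℂ) * boxProd q nu lam) • Finsupp.single nu 1 := by
      rw [downOp, Finsupp.linearCombination_single, one_smul]
      simp
    rw [pow_succ, Module.End.mul_apply, h1, map_sum, Finsupp.finsetSum_apply, pathSum,
      Complex.ofReal_sum, Finset.sum_mul]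
    refine Finset.sum_congr rfl fun nu hnu => ?_
    rw [map_smul, Finsupp.smul_apply, ih, smul_eq_mul, Complex.ofReal_mul]
    by_cases h : G.pathSum n mu nu = 0
    · simp [h]
    · rw [← boxProd_mul q (G.pathSum_ne_zero h).1 (mem_down.1 hnu).1]
      ring

theorem coherentWeight_eq (q : P → ℂ) (lam : FinIdeal P) :
    G.coherentWeight q lam.size lam = (G.dim lam : ℂ) ^ 2 * boxProd q empty lam ^ 2 := by
  rw [coherentWeight, upOp_pow_single, downOp_pow_single, dim_eq_pathSum]
  ring

section Triplet

variable {G} {q : P → ℂ} {H : Module.End ℂ (FinIdeal P →₀ ℂ)}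

theorem IsKerovTriplet.apply_eq (hK : G.IsKerovTriplet q H) : ∃ h : ℕ → ℂ,
    ∀ (f : FinIdeal P →₀ ℂ) lam, H f lam = h lam.size * f lam := by
  obtain ⟨h, hh⟩ := hK.eigen
  refine ⟨h, fun f lam => ?_⟩
  induction f using Finsupp.induction_linear with
  | zero => simp
  | add f g hf hg => simp [hf, hg, mul_add]
  | single mu a =>
    have : Finsupp.single mu a = a • Finsupp.single mu (1 : ℂ) := by simp
    rw [this, map_smul, hh]
    simp only [Finsupp.smul_apply, smul_eq_mul, Finsupp.single_apply]
    split_ifs with h1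
    · rw [h1]; ring
    · simp

theorem IsKerovTriplet.H_upOp (hK : G.IsKerovTriplet q H) (f : FinIdeal P →₀ ℂ) :
    H (G.upOp q f) = G.upOp q (H f) + (2 : ℂ) • G.upOp q f := by
  have := LinearMap.congr_fun hK.comm_H_U f
  simp only [LinearMap.sub_apply, Module.End.mul_apply, LinearMap.smul_apply] at this
  rw [← this]; abel

theorem IsKerovTriplet.downOp_upOp (hK : G.IsKerovTriplet q H) (f : FinIdeal P →₀ ℂ) :
    G.downOp q (G.upOp q f) = G.upOp q (G.downOp q f) + H f := by
  have := LinearMap.congr_fun hK.comm_D_U f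
  simp only [LinearMap.sub_apply, Module.End.mul_apply] at this
  rw [← this]; abel

theorem IsKerovTriplet.H_vacuum (hK : G.IsKerovTriplet q H) {t : ℝ}
    (htH : H (Finsupp.single empty 1) empty = (t : ℂ)) :
    H (Finsupp.single empty 1) = (t : ℂ) • Finsupp.single empty 1 := by
  obtain ⟨h, hh⟩ := hK.eigen
  rw [hh] at htH ⊢
  simp only [Finsupp.smul_apply, Finsupp.single_eq_same, smul_eq_mul, mul_one] at htH
  rw [htH]

theorem IsKerovTriplet.H_upOp_pow (hK : G.IsKerovTriplet q H) {t : ℝ}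
    (htH : H (Finsupp.single empty 1) empty = (t : ℂ)) (n : ℕ) :
    H ((G.upOp q ^ n) (Finsupp.single empty 1)) =
      ((t : ℂ) + 2 * n) • (G.upOp q ^ n) (Finsupp.single empty 1) := by
  induction n with
  | zero => simpa using hK.H_vacuum htH
  | succ n ih =>
    rw [pow_succ', Module.End.mul_apply, hK.H_upOp, ih, map_smul]
    push_cast
    module

/-- The action of `D` on the lowest weight module generated by `1_∅`. -/
theorem IsKerovTriplet.downOp_upOp_pow (hK : G.IsKerovTriplet q H) {t : ℝ}
    (htH : H (Finsupp.single empty 1) empty = (t : ℂ)) (n : ℕ) :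
    G.downOp q ((G.upOp q ^ (n + 1)) (Finsupp.single empty 1)) =
      (((n : ℂ) + 1) * (t + n)) • (G.upOp q ^ n) (Finsupp.single empty 1) := by
  induction n with
  | zero =>
    have hd : G.downOp q (Finsupp.single empty 1) = 0 := by
      ext mu
      rw [downOp_single, if_neg, Finsupp.coe_zero, Pi.zero_apply]
      intro h
      have := h.2
      rw [size_empty] at this
      omega
    rw [zero_add, pow_one, hK.downOp_upOp, hd, map_zero, zero_add, hK.H_vacuum htH]
    simp
  | succ n ih =>
    rw [pow_succ', Module.End.mul_apply, hK.downOp_upOp, ih, map_smul, hK.H_upOp_pow htH,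
      ← Module.End.mul_apply, ← pow_succ']
    push_cast
    module

theorem IsKerovTriplet.downOp_pow_upOp_pow (hK : G.IsKerovTriplet q H) {t : ℝ}
    (htH : H (Finsupp.single empty 1) empty = (t : ℂ)) (n : ℕ) :
    (G.downOp q ^ n) ((G.upOp q ^ n) (Finsupp.single empty 1)) =
      (((n.factorial : ℝ) * (ascPochhammer ℝ n).eval t : ℝ) : ℂ) • Finsupp.single empty 1 := by
  induction n with
  | zero => simp
  | succ n ih =>
    rw [pow_succ, Module.End.mul_apply, hK.downOp_upOp_pow htH, map_smul, ih,
      ascPochhammer_succ_eval, Nat.factorial_succ, smul_smul]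
    congr 1
    push_cast
    ring

/-- The normalization of the coherent system is the norm of the `n`-th level of the lowest weight
module with lowest weight `t`. -/
theorem IsKerovTriplet.sum_coherentWeight (hK : G.IsKerovTriplet q H) {t : ℝ}
    (htH : H (Finsupp.single empty 1) empty = (t : ℂ)) (n : ℕ) :
    ∑ rho ∈ G.level n, G.coherentWeight q n rho =
      (((n.factorial : ℝ) * (ascPochhammer ℝ n).eval t : ℝ) : ℂ) := by
  have h1 : (G.upOp q ^ n) (Finsupp.single empty 1) = ∑ rho ∈ G.level n,
      (G.upOp q ^ n) (Finsupp.single empty 1) rho • Finsupp.single rho 1 := by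
    ext lam
    rw [Finsupp.finsetSum_apply]
    simp only [Finsupp.smul_apply, Finsupp.single_apply, smul_eq_mul, mul_ite, mul_one, mul_zero]
    rw [Finset.sum_ite_eq']
    split_ifs with h
    · rfl
    · rw [upOp_pow_single]
      by_contra hne
      refine h (G.mem_level.2 ?_)
      have := (G.pathSum_ne_zero (Complex.ofReal_ne_zero.1 (left_ne_zero_of_mul hne))).2
      rwa [size_empty, zero_add] at this
  have h2 := congrArg (fun f : FinIdeal P →₀ ℂ => f empty) (hK.downOp_pow_upOp_pow htH n)
  rw [h1, map_sum, Finsupp.finsetSum_apply] at h2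
  simp only [map_smul, Finsupp.smul_apply, smul_eq_mul, Finsupp.single_eq_same, mul_one] at h2
  exact h2

theorem coherent_eq (hK : G.IsKerovTriplet q H) {t : ℝ}
    (htH : H (Finsupp.single empty 1) empty = (t : ℂ)) (lam : FinIdeal P) :
    G.coherent q lam = (G.dim lam : ℂ) ^ 2 * boxProd q empty lam ^ 2 /
      (((lam.size.factorial : ℝ) * (ascPochhammer ℝ lam.size).eval t : ℝ) : ℂ) := by
  rw [coherent, hK.sum_coherentWeight htH, coherentWeight_eq]

/-- The positivity of the coherent system forces the values of `q` to be real and nonzero. -/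
theorem IsPositive.sq_eq (hpos : G.IsPositive q) (hK : G.IsKerovTriplet q H) {t : ℝ} (ht : 0 < t)
    (htH : H (Finsupp.single empty 1) empty = (t : ℂ)) (x : P) :
    q x ≠ 0 ∧ q x ^ 2 = ((‖q x‖ ^ 2 : ℝ) : ℂ) := by
  -- the squares of the products over ideals are positive; a single value of `q²` is a quotient of
  -- two of them
  have hreal : ∀ lam : FinIdeal P, ∃ s : ℝ, 0 < s ∧ boxProd q empty lam ^ 2 = (s : ℂ) := by
    intro lam
    set Z := (lam.size.factorial : ℝ) * (ascPochhammer ℝ lam.size).eval t with hZ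
    have hZ0 : 0 < Z := mul_pos (by exact_mod_cast Nat.factorial_pos _)
      (ascPochhammer_pos _ _ ht)
    have hd := G.dim_pos lam
    obtain ⟨him, hre⟩ := hpos lam
    refine ⟨(G.coherent q lam).re * Z / G.dim lam ^ 2, by positivity, ?_⟩
    have h1 : G.coherent q lam = ((G.coherent q lam).re : ℂ) :=
      Complex.ext (by simp) (by simpa using him)
    have h2 := coherent_eq hK htH lam
    rw [h1, ← hZ] at h2
    have hZ1 : (Z : ℂ) ≠ 0 := by exact_mod_cast hZ0.ne'
    have hd1 : (G.dim lam : ℂ) ≠ 0 := by exact_mod_cast hd.ne'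
    push_cast
    rw [h2]
    field_simp
  obtain ⟨lam, hx⟩ := G.minimal x
  obtain ⟨mu, nu, hsub, hdiff⟩ := exists_covers_sdiff_eq_singleton hx
  obtain ⟨a, ha, ha'⟩ := hreal mu
  obtain ⟨b, hb, hb'⟩ := hreal nu
  have h3 : boxProd q empty nu = boxProd q empty mu * q x := by
    rw [← boxProd_mul q (empty_subset mu) hsub]
    simp [boxProd, hdiff]
  rw [h3, mul_pow, ha'] at hb'
  have ha0 : (a : ℂ) ≠ 0 := by exact_mod_cast ha.ne'
  have h4 : q x ^ 2 = ((b / a : ℝ) : ℂ) := by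
    push_cast
    rw [eq_div_iff ha0, mul_comm]
    exact hb'
  have hba : 0 < b / a := div_pos hb ha
  constructor
  · intro h0
    rw [h0] at h4
    have : (0 : ℝ) = b / a := by exact_mod_cast (by simpa using h4 : (0 : ℂ) = ((b / a : ℝ) : ℂ))
    exact hba.ne this
  · rw [← norm_pow, h4, Complex.norm_real, Real.norm_of_nonneg hba.le]

end Triplet

end IdealGraph

/-! ### Removal of the signs of `q` -/

namespace FinIdeal

variable {P : Type*} [PartialOrder P]

/-- The product of a real function over the boxes of `lam / mu`. -/
def realProd (a : P → ℝ) (mu lam : FinIdeal P) : ℝ := ∏ x ∈ lam.carrier \ mu.carrier, a x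

theorem realProd_mul (a : P → ℝ) {mu nu lam : FinIdeal P}
    (h1 : mu.carrier ⊆ nu.carrier) (h2 : nu.carrier ⊆ lam.carrier) :
    realProd a mu nu * realProd a nu lam = realProd a mu lam :=
  prod_sdiff_mul a h1 h2

theorem realProd_self (a : P → ℝ) (lam : FinIdeal P) : realProd a lam lam = 1 := by
  simp [realProd]

theorem realProd_pos {a : P → ℝ} (ha : ∀ x, 0 < a x) (mu lam : FinIdeal P) :
    0 < realProd a mu lam := Finset.prod_pos fun x _ => ha x

theorem boxProd_sq_eq {q : P → ℂ} {a : P → ℝ} (h : ∀ x, q x ^ 2 = ((a x ^ 2 : ℝ) : ℂ))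
    (mu lam : FinIdeal P) :
    boxProd (fun x => q x ^ 2) mu lam = ((realProd a mu lam ^ 2 : ℝ) : ℂ) := by
  simp only [boxProd, h, realProd, ← Finset.prod_pow, Complex.ofReal_prod]

theorem boxProd_ofReal (a : P → ℝ) (mu lam : FinIdeal P) :
    boxProd (fun x => (a x : ℂ)) mu lam = (realProd a mu lam : ℂ) := by
  simp only [boxProd, realProd, Complex.ofReal_prod]

end FinIdeal

namespace IdealGraph

open FinIdeal

variable {P : Type*} [PartialOrder P] (G : IdealGraph P)

/-- The matrix of the up operator of a real function. -/
def edgeWeight (a : P → ℝ) (lam nu : FinIdeal P) : ℝ :=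
  if Covers lam nu then G.mult lam nu * realProd a lam nu else 0

theorem edgeWeight_eq_zero (a : P → ℝ) {lam nu : FinIdeal P} (h : nu.size ≠ lam.size + 1) :
    G.edgeWeight a lam nu = 0 := if_neg fun hc => h hc.2

theorem sum_level_up (a : P → ℝ) (lam : FinIdeal P) (f : FinIdeal P → ℝ) :
    ∑ nu ∈ G.level (lam.size + 1), G.edgeWeight a lam nu * f nu =
      ∑ nu ∈ G.up lam, G.edgeWeight a lam nu * f nu := by
  refine (Finset.sum_subset (Finset.filter_subset _ _) fun nu _ hnu => ?_).symm
  rw [edgeWeight, if_neg (fun h => hnu (G.mem_up.2 h)), zero_mul]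

theorem sum_level_down (a : P → ℝ) (nu : FinIdeal P) (f : FinIdeal P → ℝ) :
    ∑ lam ∈ G.level (nu.size - 1), G.edgeWeight a lam nu * f lam =
      ∑ lam ∈ nu.down, G.edgeWeight a lam nu * f lam := by
  refine (Finset.sum_subset (fun lam hlam => ?_) fun lam _ hlam => ?_).symm
  · rw [mem_down] at hlam
    rw [mem_level, hlam.2, Nat.add_sub_cancel]
  · rw [edgeWeight, if_neg (fun h => hlam (mem_down.2 h)), zero_mul]

section Triplet

variable {G} {q : P → ℂ} {H : Module.End ℂ (FinIdeal P →₀ ℂ)}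

/-- The eigenvalue of `H` increases by `2` from level to level. This uses that `q` has no zeros: the
components of `U 1_mu` on the next level must not vanish. -/
theorem IsKerovTriplet.H_apply (hK : G.IsKerovTriplet q H) (hq : ∀ x, q x ≠ 0) {t : ℝ}
    (htH : H (Finsupp.single empty 1) empty = (t : ℂ)) (f : FinIdeal P →₀ ℂ) (lam : FinIdeal P) :
    H f lam = ((2 * lam.size + t : ℝ) : ℂ) * f lam := by
  obtain ⟨h, hh⟩ := hK.apply_eq
  suffices ∀ n lam, FinIdeal.size lam = n → h n = ((2 * n + t : ℝ) : ℂ) by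
    rw [hh, this _ lam rfl]
  intro n
  induction n with
  | zero =>
    intro lam _
    rw [hh, size_empty] at htH
    simpa using htH
  | succ n ih =>
    intro lam hlam
    obtain ⟨mu, hmu⟩ := exists_covers (lam := lam) (by omega)
    have hn : mu.size = n := by have := hmu.2; omega
    have h1 := DFunLike.congr_fun (hK.H_upOp (Finsupp.single mu 1)) lam
    have h2 : H (Finsupp.single mu 1) = Finsupp.single mu (h n) := by
      ext nu
      rw [hh, Finsupp.single_apply, Finsupp.single_apply]
      split_ifs with h3
      · rw [← h3, hn, mul_one]
      · rw [mul_zero]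
    rw [h2, hh, Finsupp.add_apply, Finsupp.smul_apply, upOp_single, upOp_single, if_pos hmu,
      if_pos hmu, hlam, smul_eq_mul] at h1
    have h4 : (G.mult mu lam : ℂ) * boxProd q mu lam ≠ 0 :=
      mul_ne_zero (by exact_mod_cast (G.mult_pos _ _ hmu).ne')
        (Finset.prod_ne_zero_iff.2 fun x _ => hq x)
    have h5 : h (n + 1) = h n + 2 := mul_right_cancel₀ h4 (by linear_combination h1)
    rw [h5, ih mu hn]
    push_cast
    ring

/-- The commutation relation of a triplet, for the absolute values of `q`: the signs of `q` are a
gauge transformation. -/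
theorem IsKerovTriplet.comm_edgeWeight (hK : G.IsKerovTriplet q H)
    (hq : ∀ x, q x ≠ 0 ∧ q x ^ 2 = ((‖q x‖ ^ 2 : ℝ) : ℂ)) {t : ℝ}
    (htH : H (Finsupp.single empty 1) empty = (t : ℂ)) (x y : FinIdeal P) (hxy : x.size = y.size) :
    ∑ z ∈ G.level (x.size + 1), G.edgeWeight (‖q ·‖) x z * G.edgeWeight (‖q ·‖) y z -
        ∑ z ∈ G.level (x.size - 1), G.edgeWeight (‖q ·‖) z x * G.edgeWeight (‖q ·‖) z y =
      if x = y then 2 * (x.size : ℝ) + t else 0 := by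
  set w := G.edgeWeight (‖q ·‖) with hw
  -- the signs of `q`, multiplied over the boxes of an ideal; the gauge transformation multiplies
  -- the basis vectors by them
  let e : FinIdeal P → ℂ := fun lam => boxProd (fun x => q x / ‖q x‖) empty lam
  have he : ∀ lam, e lam ^ 2 = 1 := fun lam => by
    simp only [e, boxProd, ← Finset.prod_pow]
    refine Finset.prod_eq_one fun x _ => ?_
    have h0 : (‖q x‖ : ℂ) ≠ 0 := by exact_mod_cast norm_ne_zero_iff.2 (hq x).1
    rw [div_pow, (hq x).2, Complex.ofReal_pow, div_self (pow_ne_zero 2 h0)]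
  have hgauge : ∀ lam nu, (if Covers lam nu then (G.mult lam nu : ℂ) * boxProd q lam nu else 0) =
      e lam * e nu * (w lam nu : ℂ) := by
    intro lam nu
    rw [hw, edgeWeight]
    split_ifs with h
    · have h1 : e nu = e lam * boxProd (fun x => q x / ‖q x‖) lam nu :=
        (boxProd_mul _ (empty_subset lam) h.1).symm
      have h2 : boxProd q lam nu =
          boxProd (fun x => q x / ‖q x‖) lam nu * (realProd (‖q ·‖) lam nu : ℂ) := by
        rw [← boxProd_ofReal, boxProd, boxProd, boxProd, ← Finset.prod_mul_distrib]
        refine Finset.prod_congr rfl fun x _ => ?_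
        rw [div_mul_cancel₀]
        exact_mod_cast norm_ne_zero_iff.2 (hq x).1
      rw [h2, h1, Complex.ofReal_mul]
      linear_combination (-((G.mult lam nu : ℂ) *
        (boxProd (fun x => q x / ‖q x‖) lam nu * (realProd (‖q ·‖) lam nu : ℂ)))) * he lam
    · simp
  have h1 := DFunLike.congr_fun (hK.downOp_upOp (Finsupp.single x 1)) y
  rw [Finsupp.add_apply, downOp_apply, upOp_apply, hK.H_apply (fun x => (hq x).1) htH] at h1
  have h2 : ∑ z ∈ G.up y, G.upOp q (Finsupp.single x 1) z * (G.mult y z * boxProd q y z) =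
      e x * e y * ((∑ z ∈ G.up y, w y z * w x z : ℝ) : ℂ) := by
    rw [Complex.ofReal_sum, Finset.mul_sum]
    refine Finset.sum_congr rfl fun z hz => ?_
    have h3 := hgauge y z
    rw [if_pos (G.mem_up.1 hz)] at h3
    rw [upOp_single, one_mul, hgauge, h3, Complex.ofReal_mul]
    linear_combination (e x * e y * w y z * w x z) * he z
  have h4 : ∑ z ∈ y.down, G.downOp q (Finsupp.single x 1) z * (G.mult z y * boxProd q z y) =
      e x * e y * ((∑ z ∈ y.down, w z y * w z x : ℝ) : ℂ) := by
    rw [Complex.ofReal_sum, Finset.mul_sum]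
    refine Finset.sum_congr rfl fun z hz => ?_
    have h3 := hgauge z y
    rw [if_pos (mem_down.1 hz)] at h3
    rw [downOp_single, one_mul, hgauge, h3, Complex.ofReal_mul]
    linear_combination (e x * e y * w z y * w z x) * he z
  rw [h2, h4, ← sum_level_up, ← sum_level_down] at h1
  have h5 : ∀ s : Finset (FinIdeal P), ∑ z ∈ s, w x z * w y z = ∑ z ∈ s, w y z * w x z :=
    fun s => Finset.sum_congr rfl fun _ _ => mul_comm _ _
  have h6 : ∀ s : Finset (FinIdeal P), ∑ z ∈ s, w z x * w z y = ∑ z ∈ s, w z y * w z x :=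
    fun s => Finset.sum_congr rfl fun _ _ => mul_comm _ _
  rw [h5, h6, hxy]
  have h7 : (((∑ z ∈ G.level (y.size + 1), w y z * w x z -
      ∑ z ∈ G.level (y.size - 1), w z y * w z x : ℝ)) : ℂ) =
      ((if x = y then 2 * (y.size : ℝ) + t else 0 : ℝ) : ℂ) := by
    have h8 : e x * e y * (e x * e y) = 1 := by
      linear_combination e y ^ 2 * he x + he y
    rw [Finsupp.single_apply] at h1
    split_ifs at h1 ⊢ with h9
    · subst h9
      push_cast at h1 ⊢
      linear_combination (e x * e x) * h1 - (∑ z ∈ G.level (x.size + 1), (w x z : ℂ) * w x z -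
        ∑ z ∈ G.level (x.size - 1), (w z x : ℂ) * w z x - (2 * (x.size : ℂ) + t)) * h8
          + (2 * (x.size : ℂ) + t) * (he x - h8)
    · push_cast at h1 ⊢
      linear_combination (e x * e y) * h1 - (∑ z ∈ G.level (y.size + 1), (w y z : ℂ) * w x z -
        ∑ z ∈ G.level (y.size - 1), (w z y : ℂ) * w z x) * h8
  exact_mod_cast h7

end Triplet

end IdealGraph

/-! ### The Meixner functions in terms of the network -/

namespace IdealGraph

open FinIdeal

variable {P : Type*} [PartialOrder P] (G : IdealGraph P)

/-- The network of a graph of ideals, for a real function whose up and down operators satisfy the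
commutation relations. -/
def network (a : P → ℝ) (t : ℝ) (ht : 0 < t)
    (hcomm : ∀ x y : FinIdeal P, x.size = y.size →
      ∑ z ∈ G.level (x.size + 1), G.edgeWeight a x z * G.edgeWeight a y z -
        ∑ z ∈ G.level (x.size - 1), G.edgeWeight a z x * G.edgeWeight a z y =
      if x = y then 2 * (x.size : ℝ) + t else 0) : SlNetwork (FinIdeal P) where
  size := FinIdeal.size
  level := G.level
  mem_level _ _ := G.mem_level
  w := G.edgeWeight a
  w_eq_zero _ _ := G.edgeWeight_eq_zero a
  t := t
  t_pos := ht
  comm := hcomm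

/-- A network that is realized by a real function `a` on a graph of ideals. -/
structure IsNetwork (a : P → ℝ) (t : ℝ) (N : SlNetwork (FinIdeal P)) : Prop where
  size_eq : N.size = FinIdeal.size
  level_eq : N.level = G.level
  w_eq : N.w = G.edgeWeight a
  t_eq : N.t = t

variable {G} {a : P → ℝ} {t : ℝ} {N : SlNetwork (FinIdeal P)}

theorem IsNetwork.up_apply (hN : G.IsNetwork a t N) (f : FinIdeal P → ℝ) (lam : FinIdeal P) :
    N.up f lam = ∑ mu ∈ lam.down, G.mult mu lam * realProd a mu lam * f mu := by
  rw [SlNetwork.up_apply, hN.size_eq, hN.level_eq, hN.w_eq, sum_level_down]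
  refine Finset.sum_congr rfl fun mu hmu => ?_
  rw [edgeWeight, if_pos (mem_down.1 hmu)]

theorem IsNetwork.down_apply (hN : G.IsNetwork a t N) (f : FinIdeal P → ℝ) (lam : FinIdeal P) :
    N.down f lam = ∑ nu ∈ G.up lam, G.mult lam nu * realProd a lam nu * f nu := by
  rw [SlNetwork.down_apply, hN.size_eq, hN.level_eq, hN.w_eq, sum_level_up]
  refine Finset.sum_congr rfl fun nu hnu => ?_
  rw [edgeWeight, if_pos (G.mem_up.1 hnu)]

theorem IsNetwork.up_pow_ket (hN : G.IsNetwork a t N) (n : ℕ) (mu lam : FinIdeal P) :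
    (N.up ^ n) (SlNetwork.ket mu) lam = G.pathSum n mu lam * realProd a mu lam := by
  induction n generalizing lam with
  | zero =>
    rw [pow_zero, Module.End.one_apply, SlNetwork.ket, Pi.single_apply, pathSum]
    by_cases h : lam = mu
    · subst h; simp [realProd_self]
    · simp [h, Ne.symm h]
  | succ n ih =>
    rw [pow_succ', Module.End.mul_apply, hN.up_apply, pathSum, Finset.sum_mul]
    refine Finset.sum_congr rfl fun nu hnu => ?_
    rw [ih]
    by_cases h : G.pathSum n mu nu = 0
    · simp [h]
    · rw [← realProd_mul a (G.pathSum_ne_zero h).1 (mem_down.1 hnu).1]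
      ring

theorem IsNetwork.down_ket (hN : G.IsNetwork a t N) (lam : FinIdeal P) :
    N.down (SlNetwork.ket lam) =
      ∑ nu ∈ lam.down, (G.mult nu lam * realProd a nu lam) • SlNetwork.ket nu := by
  ext mu
  rw [hN.down_apply, Finset.sum_apply]
  simp only [SlNetwork.ket, Pi.smul_apply, Pi.single_apply, smul_eq_mul, mul_ite, mul_one,
    mul_zero, Finset.sum_ite_eq', Finset.sum_ite_eq, mem_down, mem_up]

theorem IsNetwork.down_pow_ket (hN : G.IsNetwork a t N) (n : ℕ) (mu lam : FinIdeal P) :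
    (N.down ^ n) (SlNetwork.ket lam) mu = G.pathSum n mu lam * realProd a mu lam := by
  induction n generalizing lam with
  | zero =>
    rw [pow_zero, Module.End.one_apply, SlNetwork.ket, Pi.single_apply, pathSum]
    split_ifs with h
    · subst h; simp [realProd_self]
    · simp
  | succ n ih =>
    rw [pow_succ, Module.End.mul_apply, hN.down_ket, map_sum, Finset.sum_apply, pathSum,
      Finset.sum_mul]
    refine Finset.sum_congr rfl fun nu hnu => ?_
    rw [map_smul, Pi.smul_apply, ih, smul_eq_mul]
    by_cases h : G.pathSum n mu nu = 0
    · simp [h]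
    · rw [← realProd_mul a (G.pathSum_ne_zero h).1 (mem_down.1 hnu).1]
      ring

theorem IsNetwork.expUp_ket (hN : G.IsNetwork a t N) (r : ℝ) (mu rho : FinIdeal P) :
    N.expUp r (SlNetwork.ket mu) rho = r ^ (rho.size - mu.size) /
      ((rho.size - mu.size).factorial : ℝ) * (G.relDim mu rho * realProd a mu rho) := by
  have hf : ∀ x, N.size x ≠ mu.size → SlNetwork.ket mu x = 0 := fun x hx => by
    rw [SlNetwork.ket, Pi.single_apply, if_neg]
    rintro rfl
    exact hx (by rw [hN.size_eq])
  rcases le_or_gt mu.size rho.size with h | h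
  · rw [N.expUp_apply_of_size hf r (k := rho.size - mu.size) (by rw [hN.size_eq]; omega),
      hN.up_pow_ket, relDim]
  · rw [N.expUp_apply_of_size_lt hf r (by rw [hN.size_eq]; exact h)]
    have h0 : G.relDim mu rho = 0 := by
      by_contra h1
      have := size_le_of_subset (G.relDim_ne_zero h1)
      omega
    rw [h0]
    ring

/-- The terms of `meix` regrouped by the ideals `mu ⊆ lam`; the power of `D` is `|lam| - |mu|`. -/
theorem IsNetwork.meix_eq (hN : G.IsNetwork a t N) (r : ℝ) (lam rho : FinIdeal P) :
    N.meix r lam rho = ∑ mu ∈ lam.below, N.coef lam.size (lam.size - mu.size) r *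
      (G.relDim mu lam * realProd a mu lam) * N.expUp r (SlNetwork.ket mu) rho := by
  have h1 : ∀ j ∈ Finset.range (lam.size + 1), (N.down ^ j) (SlNetwork.ket lam) =
      ∑ mu ∈ lam.below.filter (fun mu => lam.size - mu.size = j),
        (G.relDim mu lam * realProd a mu lam) • SlNetwork.ket mu := by
    intro j hj
    ext mu
    rw [hN.down_pow_ket, Finset.sum_apply]
    simp only [SlNetwork.ket, Pi.smul_apply, Pi.single_apply, smul_eq_mul, mul_ite, mul_one,
      mul_zero]
    rw [Finset.sum_ite_eq]
    by_cases h : G.pathSum j mu lam = 0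
    · rw [h, zero_mul]
      split_ifs with h2
      · rw [relDim, (Finset.mem_filter.1 h2).2, h, zero_mul]
      · rfl
    · obtain ⟨h2, h3⟩ := G.pathSum_ne_zero h
      have h4 : lam.size - mu.size = j := by omega
      rw [if_pos (Finset.mem_filter.2 ⟨mem_below.2 h2, h4⟩), relDim, h4]
  rw [SlNetwork.meix, Finset.sum_apply, hN.size_eq]
  rw [← Finset.sum_fiberwise_of_maps_to (s := lam.below) (t := Finset.range (lam.size + 1))
    (g := fun mu => lam.size - mu.size) (fun mu _ => by simp)]
  refine Finset.sum_congr rfl fun j hj => ?_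
  rw [h1 j hj, Pi.smul_apply, smul_eq_mul, map_sum, Finset.sum_apply, Finset.mul_sum]
  refine Finset.sum_congr rfl fun mu hmu => ?_
  rw [(Finset.mem_filter.1 hmu).2, map_smul, Pi.smul_apply, smul_eq_mul]
  ring

variable (G a t) in
/-- The square root of the mixed measure of a point, in terms of `r = √ξ`. -/
def rootWeight (r : ℝ) (rho : FinIdeal P) : ℝ :=
  (1 - r ^ 2) ^ (t / 2) * (r ^ rho.size / (rho.size.factorial : ℝ)) *
    (G.dim rho * realProd a empty rho)

theorem rootWeight_pos (ha : ∀ x, 0 < a x) {r : ℝ} (hr : 0 < r) (hr1 : 0 < 1 - r ^ 2)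
    (rho : FinIdeal P) : 0 < G.rootWeight a t r rho :=
  mul_pos (mul_pos (Real.rpow_pos_of_pos hr1 _)
    (div_pos (pow_pos hr _) (by exact_mod_cast Nat.factorial_pos _)))
    (mul_pos (G.dim_pos rho) (realProd_pos ha _ _))

theorem floorMeasure_eq {q : P → ℂ} {H : Module.End ℂ (FinIdeal P →₀ ℂ)}
    (hK : G.IsKerovTriplet q H) (htH : H (Finsupp.single empty 1) empty = (t : ℂ))
    (hq : ∀ x, q x ^ 2 = ((a x ^ 2 : ℝ) : ℂ)) (rho : FinIdeal P) :
    G.floorMeasure q rho = G.dim rho ^ 2 * realProd a empty rho ^ 2 /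
      ((rho.size.factorial : ℝ) * (ascPochhammer ℝ rho.size).eval t) := by
  have h : boxProd q empty rho ^ 2 = ((realProd a empty rho ^ 2 : ℝ) : ℂ) := by
    rw [← boxProd_sq_eq hq, boxProd, boxProd, Finset.prod_pow]
  rw [floorMeasure, coherent_eq hK htH, h, ← Complex.ofReal_pow, ← Complex.ofReal_mul,
    ← Complex.ofReal_div, Complex.ofReal_re]

theorem mixedWeight_eq_sq {q : P → ℂ} {H : Module.End ℂ (FinIdeal P →₀ ℂ)}
    (hK : G.IsKerovTriplet q H) (ht : 0 < t)
    (htH : H (Finsupp.single empty 1) empty = (t : ℂ))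
    (hq : ∀ x, q x ^ 2 = ((a x ^ 2 : ℝ) : ℂ)) {r : ℝ} (hr1 : 0 < 1 - r ^ 2) (rho : FinIdeal P) :
    G.mixedWeight q t (r ^ 2) rho = G.rootWeight a t r rho ^ 2 := by
  have h1 : (1 - r ^ 2) ^ t = ((1 - r ^ 2) ^ (t / 2)) ^ 2 := by
    rw [← Real.rpow_mul_natCast hr1.le]
    norm_num
  have h2 := (ascPochhammer_pos rho.size t ht).ne'
  have h3 : (rho.size.factorial : ℝ) ≠ 0 := by exact_mod_cast Nat.factorial_ne_zero _
  rw [mixedWeight, negBinomialWeight, floorMeasure_eq hK htH hq, rootWeight, h1]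
  field_simp
  ring

/-- The vectors `exp (r U) 1_mu` are the relative dimension functions, up to the square root of the
mixed measure. -/
theorem IsNetwork.rootWeight_mul_relDimFun (hN : G.IsNetwork a t N) {r : ℝ} (hr : r ≠ 0)
    (mu rho : FinIdeal P) :
    G.rootWeight a t r rho * G.relDimFun mu rho = (1 - r ^ 2) ^ (t / 2) *
      (r ^ mu.size * realProd a empty mu) * N.expUp r (SlNetwork.ket mu) rho := by
  rw [hN.expUp_ket, relDimFun]
  by_cases h : G.relDim mu rho = 0
  · simp [h]
  have hsub := G.relDim_ne_zero h
  obtain ⟨d, hd⟩ := Nat.exists_eq_add_of_le (size_le_of_subset hsub)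
  have h1 : (rho.size.descFactorial mu.size : ℝ) =
      (rho.size.factorial : ℝ) / (d.factorial : ℝ) := by
    rw [eq_div_iff (by exact_mod_cast Nat.factorial_ne_zero _), mul_comm]
    have := Nat.factorial_mul_descFactorial (size_le_of_subset hsub)
    rw [hd, Nat.add_sub_cancel_left, ← hd] at this
    exact_mod_cast this
  have h2 : rho.size - mu.size = d := by omega
  have h3 := (G.dim_pos rho).ne'
  have h4 : (rho.size.factorial : ℝ) ≠ 0 := by exact_mod_cast Nat.factorial_ne_zero _
  have h5 : (d.factorial : ℝ) ≠ 0 := by exact_mod_cast Nat.factorial_ne_zero _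
  rw [h1, h2, rootWeight, ← realProd_mul a (empty_subset mu) hsub]
  have h6 : r ^ rho.size = r ^ mu.size * r ^ d := by rw [hd, pow_add]
  rw [h6]
  field_simp

theorem IsNetwork.coef_eq (hN : G.IsNetwork a t N) {r : ℝ} (hr1 : 0 < 1 - r ^ 2) {n m : ℕ}
    (h : m ≤ n) : N.coef n (n - m) r =
      (-r) ^ (n - m) / ((n - m).factorial : ℝ) * ((1 - r ^ 2) ^ m * (1 - r ^ 2) ^ (t / 2)) := by
  rw [SlNetwork.coef, hN.t_eq, Nat.cast_sub h, sub_sub_cancel, Real.rpow_add hr1, Real.rpow_natCast]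

/-- The explicit vectors in terms of the relative dimension functions. -/
theorem IsNetwork.meix_eq_sum (hN : G.IsNetwork a t N) (ha : ∀ x, 0 < a x) {r : ℝ} (hr : 0 < r)
    (hr1 : 0 < 1 - r ^ 2) (lam rho : FinIdeal P) :
    N.meix r lam rho = ∑ mu ∈ lam.below,
      (-r) ^ (lam.size - mu.size) / ((lam.size - mu.size).factorial : ℝ) * (1 - r ^ 2) ^ mu.size *
        (G.relDim mu lam * realProd a mu lam) / (r ^ mu.size * realProd a empty mu) *
        (G.rootWeight a t r rho * G.relDimFun mu rho) := by
  rw [hN.meix_eq]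
  refine Finset.sum_congr rfl fun mu hmu => ?_
  rw [hN.coef_eq hr1 (size_le_of_subset (mem_below.1 hmu)), hN.rootWeight_mul_relDimFun hr.ne']
  have := (realProd_pos ha empty mu).ne'
  field_simp

theorem IsNetwork.frakF_eq (hN : G.IsNetwork a t N) (ha : ∀ x, 0 < a x) {q : P → ℂ}
    {H : Module.End ℂ (FinIdeal P →₀ ℂ)} (hK : G.IsKerovTriplet q H) (ht : 0 < t)
    (htH : H (Finsupp.single empty 1) empty = (t : ℂ)) (hq : ∀ x, q x = (a x : ℂ)) {r : ℝ}
    (hr : 0 < r) (hr1 : 0 < 1 - r ^ 2) (lam rho : FinIdeal P) :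
    G.frakF q t (r ^ 2) lam rho = (N.meix r lam rho : ℂ) := by
  have hq2 : ∀ x, q x ^ 2 = ((a x ^ 2 : ℝ) : ℂ) := fun x => by rw [hq]; push_cast; rfl
  have hq3 : (fun x => (q x)⁻¹) = fun x => (((a x)⁻¹ : ℝ) : ℂ) := by
    ext x; rw [hq]; push_cast; rfl
  have hinv : realProd (fun x => (a x)⁻¹) empty lam = (realProd a empty lam)⁻¹ := by
    simp [realProd]
  rw [hN.meix_eq_sum ha hr hr1, frakF, Complex.ofReal_sum]
  refine Finset.sum_congr rfl fun mu hmu => ?_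
  have hsub := mem_below.1 hmu
  obtain ⟨d, hd⟩ := Nat.exists_eq_add_of_le (size_le_of_subset hsub)
  rw [boxProd_sq_eq hq2, hq3, boxProd_ofReal, hinv, mixedWeight_eq_sq hK ht htH hq2 hr1,
    Real.sqrt_sq (rootWeight_pos ha hr hr1 rho).le, ← Complex.ofReal_mul, ← Complex.ofReal_mul,
    ← Complex.ofReal_mul]
  congr 1
  have h1 : (r ^ 2) ^ ((lam.size : ℝ) / 2 - mu.size) = r ^ d / r ^ mu.size := by
    rw [← Real.rpow_natCast r 2, ← Real.rpow_mul hr.le, ← Real.rpow_natCast r d,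
      ← Real.rpow_natCast r mu.size, ← Real.rpow_sub hr, hd]
    congr 1
    push_cast
    ring
  have h2 : lam.size - mu.size = d := by omega
  rw [h1, h2, ← realProd_mul a (empty_subset mu) hsub, neg_pow r]
  have h3 := (realProd_pos ha empty mu).ne'
  have h4 := (realProd_pos ha mu lam).ne'
  field_simp

theorem IsNetwork.meixner_eq (hN : G.IsNetwork a t N) (ha : ∀ x, 0 < a x) {q : P → ℂ}
    (hq : ∀ x, q x ^ 2 = ((a x ^ 2 : ℝ) : ℂ)) {r : ℝ}
    (hr : 0 < r) (hr1 : 0 < 1 - r ^ 2) (lam rho : FinIdeal P) :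
    (G.rootWeight a t r rho : ℂ) * G.meixner q (r ^ 2) lam rho =
      ((r ^ lam.size / (1 - r ^ 2) ^ lam.size * realProd a empty lam * N.meix r lam rho : ℝ) :
        ℂ) := by
  rw [hN.meix_eq_sum ha hr hr1, meixner, Finset.mul_sum, Finset.mul_sum, Complex.ofReal_sum]
  refine Finset.sum_congr rfl fun mu hmu => ?_
  have hsub := mem_below.1 hmu
  obtain ⟨d, hd⟩ := Nat.exists_eq_add_of_le (size_le_of_subset hsub)
  have h2 : lam.size - mu.size = d := by omega
  rw [boxProd_sq_eq hq, ← Complex.ofReal_pow, ← Complex.ofReal_mul, ← Complex.ofReal_mul,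
    ← Complex.ofReal_mul, ← Complex.ofReal_mul]
  congr 1
  rw [h2, ← realProd_mul a (empty_subset mu) hsub, neg_pow r, hd, pow_add, pow_add]
  have h3 := (realProd_pos ha empty mu).ne'
  have h5 : r ^ 2 / (r ^ 2 - 1) = (-1) * (r ^ 2 / (1 - r ^ 2)) := by
    rw [← neg_sub, div_neg]; ring
  rw [h5, mul_pow, div_pow]
  field_simp
  ring

end IdealGraph

/-! ### The jump rates -/

namespace IdealGraph

open FinIdeal

variable {P : Type*} [PartialOrder P] {G : IdealGraph P} {a : P → ℝ} {t : ℝ}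
  {N : SlNetwork (FinIdeal P)} {q : P → ℂ} {H : Module.End ℂ (FinIdeal P →₀ ℂ)}

theorem jumpRate_self (ξ : ℝ) (lam : FinIdeal P) : G.jumpRate q t ξ lam lam =
    -((lam.size + ξ * (lam.size + t)) / (1 - ξ)) := if_pos rfl

theorem ne_of_covers {mu lam : FinIdeal P} (h : Covers mu lam) : mu ≠ lam := by
  rintro rfl
  have := h.2
  omega

theorem not_covers_of_covers {mu lam : FinIdeal P} (h : Covers mu lam) : ¬ Covers lam mu := by
  intro h'
  have := h.2
  have := h'.2
  omega

theorem jumpRate_of_covers_down {mu lam : FinIdeal P} (ξ : ℝ) (h : Covers mu lam) :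
    G.jumpRate q t ξ lam mu =
      lam.size / (1 - ξ) * (G.mult mu lam * G.dim mu / G.dim lam) := by
  rw [jumpRate, if_neg (ne_of_covers h), if_pos h, downProb, if_pos h]

theorem jumpRate_of_covers_up {lam nu : FinIdeal P} (ξ : ℝ) (h : Covers lam nu) :
    G.jumpRate q t ξ lam nu =
      ξ * (lam.size + t) / (1 - ξ) * (G.floorMeasure q nu / G.floorMeasure q lam *
        (G.mult lam nu * G.dim lam / G.dim nu)) := by
  rw [jumpRate, if_neg (ne_of_covers h).symm, if_neg (not_covers_of_covers h), if_pos h, upProb,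
    if_pos h, downProb, if_pos h]

/-- The generator only involves the neighbours of a vertex. -/
theorem jumpFun_apply (ξ : ℝ) (f : FinIdeal P →₀ ℂ) (lam : FinIdeal P) :
    G.jumpFun q t ξ f lam = (G.jumpRate q t ξ lam lam : ℂ) * f lam +
      ∑ mu ∈ lam.down, (G.jumpRate q t ξ lam mu : ℂ) * f mu +
      ∑ nu ∈ G.up lam, (G.jumpRate q t ξ lam nu : ℂ) * f nu := by
  induction f using Finsupp.induction_linear with
  | zero => simp [jumpFun]
  | add f g hf hg =>
    rw [jumpFun] at hf hg ⊢
    rw [Finsupp.sum_add_index' (by simp) (by intros; ring), hf, hg]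
    simp only [Finsupp.add_apply, mul_add, Finset.sum_add_distrib]
    ring
  | single rho c =>
    rw [jumpFun, Finsupp.sum_single_index (by simp)]
    simp only [Finsupp.single_apply, mul_ite, mul_zero, Finset.sum_ite_eq, mem_down, mem_up]
    by_cases h1 : rho = lam
    · subst h1
      have : ¬ Covers rho rho := fun h => ne_of_covers h rfl
      simp [this]
    · by_cases h2 : Covers rho lam
      · simp [h1, h2, not_covers_of_covers h2]
      · by_cases h3 : Covers lam rho
        · simp [h1, h2, h3]
        · simp [h1, h2, h3, jumpRate]

/-- The square roots of the weights of neighbouring vertices, in terms of their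
dimensions. -/
theorem rootWeight_of_covers (r : ℝ) {mu lam : FinIdeal P} (h : Covers mu lam) :
    lam.size * G.dim mu * G.rootWeight a t r lam =
      r * realProd a mu lam * G.dim lam * G.rootWeight a t r mu := by
  rw [rootWeight, rootWeight, ← realProd_mul a (empty_subset mu) h.1, h.2, Nat.factorial_succ]
  have := Nat.factorial_ne_zero mu.size
  push_cast
  field_simp
  ring

/-- After conjugation by the square root of the weights, the jump rates off the diagonal are a
multiple of the symmetric matrix of `U + D`. -/
theorem rootWeight_mul_jumpRate_down {r : ℝ} (hr1 : 0 < 1 - r ^ 2)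
    {mu lam : FinIdeal P} (h : Covers mu lam) :
    G.rootWeight a t r lam * G.jumpRate q t (r ^ 2) lam mu =
      (1 - r ^ 2)⁻¹ * (r * (G.mult mu lam * realProd a mu lam * G.rootWeight a t r mu)) := by
  rw [jumpRate_of_covers_down _ h]
  have h1 := rootWeight_of_covers (G := G) (a := a) (t := t) r h
  have h2 := (G.dim_pos lam).ne'
  field_simp
  linear_combination G.mult mu lam * h1

theorem rootWeight_mul_jumpRate_up (hK : G.IsKerovTriplet q H) (ht : 0 < t)
    (htH : H (Finsupp.single empty 1) empty = (t : ℂ)) (ha : ∀ x, 0 < a x)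
    (hq : ∀ x, q x ^ 2 = ((a x ^ 2 : ℝ) : ℂ)) {r : ℝ} (hr1 : 0 < 1 - r ^ 2)
    {lam nu : FinIdeal P} (h : Covers lam nu) :
    G.rootWeight a t r lam * G.jumpRate q t (r ^ 2) lam nu =
      (1 - r ^ 2)⁻¹ * (r * (G.mult lam nu * realProd a lam nu * G.rootWeight a t r nu)) := by
  rw [jumpRate_of_covers_up _ h, floorMeasure_eq hK htH hq,
    floorMeasure_eq hK htH hq, rootWeight, rootWeight,
    ← realProd_mul a (empty_subset lam) h.1, h.2, Nat.factorial_succ, ascPochhammer_succ_eval]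
  have h1 := (ascPochhammer_pos lam.size t ht).ne'
  have h2 := (G.dim_pos lam).ne'
  have h3 := (G.dim_pos nu).ne'
  have h4 : (lam.size.factorial : ℝ) ≠ 0 := by exact_mod_cast Nat.factorial_ne_zero _
  have h5 := (realProd_pos ha empty lam).ne'
  have h6 : t + (lam.size : ℝ) ≠ 0 := by positivity
  push_cast
  field_simp
  ring

/-- Conjugation by the square root of the mixed measure turns the Markov generator into an operator
of the Lie algebra. -/
theorem IsNetwork.rootWeight_mul_jumpFun (hN : G.IsNetwork a t N) (hK : G.IsKerovTriplet q H)
    (ht : 0 < t) (htH : H (Finsupp.single empty 1) empty = (t : ℂ)) (ha : ∀ x, 0 < a x)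
    (hq : ∀ x, q x ^ 2 = ((a x ^ 2 : ℝ) : ℂ)) {r : ℝ} (hr1 : 0 < 1 - r ^ 2)
    {f : FinIdeal P →₀ ℂ} {g : FinIdeal P → ℝ}
    (hfg : ∀ lam, (G.rootWeight a t r lam : ℂ) * f lam = (g lam : ℂ)) (lam : FinIdeal P) :
    (G.rootWeight a t r lam : ℂ) * G.jumpFun q t (r ^ 2) f lam =
      (((1 - r ^ 2)⁻¹ * N.markov r g lam : ℝ) : ℂ) := by
  have hd : ∀ mu ∈ lam.down, (G.rootWeight a t r lam : ℂ) *
      ((G.jumpRate q t (r ^ 2) lam mu : ℂ) * f mu) =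
        (((1 - r ^ 2)⁻¹ * (r * (G.mult mu lam * realProd a mu lam * g mu)) : ℝ) : ℂ) := by
    intro mu hmu
    rw [← mul_assoc, ← Complex.ofReal_mul, rootWeight_mul_jumpRate_down hr1 (mem_down.1 hmu)]
    push_cast
    rw [← hfg]
    ring
  have hu : ∀ nu ∈ G.up lam, (G.rootWeight a t r lam : ℂ) *
      ((G.jumpRate q t (r ^ 2) lam nu : ℂ) * f nu) =
        (((1 - r ^ 2)⁻¹ * (r * (G.mult lam nu * realProd a lam nu * g nu)) : ℝ) : ℂ) := by
    intro nu hnu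
    rw [← mul_assoc, ← Complex.ofReal_mul,
      rootWeight_mul_jumpRate_up hK ht htH ha hq hr1 (G.mem_up.1 hnu)]
    push_cast
    rw [← hfg]
    ring
  rw [jumpFun_apply, mul_add, mul_add, Finset.mul_sum, Finset.mul_sum, Finset.sum_congr rfl hd,
    Finset.sum_congr rfl hu, ← Complex.ofReal_sum, ← Complex.ofReal_sum, ← Finset.mul_sum,
    ← Finset.mul_sum, ← Finset.mul_sum, ← Finset.mul_sum, ← hN.up_apply, ← hN.down_apply,
    jumpRate_self, SlNetwork.markov_apply, hN.size_eq, hN.t_eq, mul_left_comm, hfg]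
  push_cast
  have : (1 : ℂ) - r ^ 2 ≠ 0 := by exact_mod_cast hr1.ne'
  field_simp
  ring

end IdealGraph

/-! ### Closure of the generator -/

namespace IdealGraph

open FinIdeal

instance {P : Type*} [PartialOrder P] : DiscreteMeasurableSpace (FinIdeal P) :=
  ⟨fun _ => trivial⟩

section WeightedSpace

variable {P : Type*} [PartialOrder P] {G : IdealGraph P} {q : P → ℂ} {t ξ : ℝ}

variable [Countable (FinIdeal P)]

theorem ae_mixedMeasure_iff (hm : ∀ lam, 0 < G.mixedWeight q t ξ lam) {p : FinIdeal P → Prop} :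
    (∀ᵐ lam ∂G.mixedMeasure q t ξ, p lam) ↔ ∀ lam, p lam :=
  ae_weightMeasure_iff hm

/-- The unitary equivalence of `ℓ²(J(P))` and `ℓ²(J(P), M_ξ)`. -/
def toWeighted (hm : ∀ lam, 0 < G.mixedWeight q t ξ lam) : Ell2 P ≃ₗᵢ[ℂ] G.WeightedL2 q t ξ :=
  weightEquiv hm

theorem toWeighted_apply (hm : ∀ lam, 0 < G.mixedWeight q t ξ lam) (h : Ell2 P)
    (lam : FinIdeal P) :
    toWeighted hm h lam = h lam / (√(G.mixedWeight q t ξ lam) : ℂ) :=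
  weightEquiv_apply hm h lam

theorem memLp_mixedMeasure (hm : ∀ lam, 0 < G.mixedWeight q t ξ lam) {h : Ell2 P}
    {f : FinIdeal P → ℂ} (hf : ∀ lam, (√(G.mixedWeight q t ξ lam) : ℂ) * f lam = h lam) :
    MemLp f 2 (G.mixedMeasure q t ξ) := by
  have hfun : f = fun lam => h lam / (√(G.mixedWeight q t ξ lam) : ℂ) := by
    ext lam
    have h0 : (√(G.mixedWeight q t ξ lam) : ℂ) ≠ 0 := by
      exact_mod_cast (Real.sqrt_pos.2 (hm lam)).ne'
    rw [← hf, mul_div_cancel_left₀ _ h0]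
  rw [hfun]
  exact memLp_div_sqrt hm h

theorem toLp_eq_toWeighted (hm : ∀ lam, 0 < G.mixedWeight q t ξ lam) {h : Ell2 P}
    {f : FinIdeal P → ℂ} (hf : ∀ lam, (√(G.mixedWeight q t ξ lam) : ℂ) * f lam = h lam)
    (hL : MemLp f 2 (G.mixedMeasure q t ξ)) : hL.toLp = toWeighted hm h := by
  refine Lp.ext ?_
  filter_upwards [hL.coeFn_toLp] with lam hlam
  have h0 : (√(G.mixedWeight q t ξ lam) : ℂ) ≠ 0 := by
    exact_mod_cast (Real.sqrt_pos.2 (hm lam)).ne'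
  rw [hlam, toWeighted_apply, ← hf, mul_div_cancel_left₀ _ h0]

theorem mem_preGeneratorGraph_iff (hm : ∀ lam, 0 < G.mixedWeight q t ξ lam)
    {p : G.WeightedL2 q t ξ × G.WeightedL2 q t ξ} :
    p ∈ G.preGeneratorGraph q t ξ ↔ ∃ f : FinIdeal P →₀ ℂ,
      (∀ lam, p.1 lam = f lam) ∧ ∀ lam, p.2 lam = G.jumpFun q t ξ f lam := by
  change (∃ f : FinIdeal P →₀ ℂ, _ ∧ _) ↔ _
  refine exists_congr fun f => and_congr ?_ ?_
  · exact ae_mixedMeasure_iff hm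
  · exact ae_mixedMeasure_iff hm

/-- In the closure of the graph of the generator, the second function is given by the same finite
sums of values of the first function. -/
theorem apply_eq_of_mem_closure_preGeneratorGraph (hm : ∀ lam, 0 < G.mixedWeight q t ξ lam)
    {p : G.WeightedL2 q t ξ × G.WeightedL2 q t ξ}
    (hp : p ∈ (G.preGeneratorGraph q t ξ).topologicalClosure) (lam : FinIdeal P) :
    p.2 lam = (G.jumpRate q t ξ lam lam : ℂ) * p.1 lam +
      ∑ mu ∈ lam.down, (G.jumpRate q t ξ lam mu : ℂ) * p.1 mu +
      ∑ nu ∈ G.up lam, (G.jumpRate q t ξ lam nu : ℂ) * p.1 nu := by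
  have hev : ∀ mu : FinIdeal P, Continuous fun f : G.WeightedL2 q t ξ => f mu :=
    fun mu => continuous_eval_weightMeasure hm mu
  -- point evaluations are continuous, so that the identity defines a closed set
  have hclosed : IsClosed {p : G.WeightedL2 q t ξ × G.WeightedL2 q t ξ |
      p.2 lam = (G.jumpRate q t ξ lam lam : ℂ) * p.1 lam +
      ∑ mu ∈ lam.down, (G.jumpRate q t ξ lam mu : ℂ) * p.1 mu +
      ∑ nu ∈ G.up lam, (G.jumpRate q t ξ lam nu : ℂ) * p.1 nu} := by
    refine isClosed_eq ((hev lam).comp continuous_snd) ?_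
    refine ((continuous_const.mul ((hev lam).comp continuous_fst)).add ?_).add ?_
    · exact continuous_finsetSum _ fun mu _ => continuous_const.mul ((hev mu).comp continuous_fst)
    · exact continuous_finsetSum _ fun mu _ => continuous_const.mul ((hev mu).comp continuous_fst)
  refine closure_minimal ?_ hclosed hp
  intro p hp
  obtain ⟨f, h1, h2⟩ := (mem_preGeneratorGraph_iff hm).1 hp
  change p.2 lam = _
  rw [h2, jumpFun_apply]
  simp only [h1]

theorem snd_eq_zero_of_mem_closure (hm : ∀ lam, 0 < G.mixedWeight q t ξ lam)
    {p : G.WeightedL2 q t ξ × G.WeightedL2 q t ξ}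
    (hp : p ∈ (G.preGeneratorGraph q t ξ).topologicalClosure) (h0 : p.1 = 0) : p.2 = 0 := by
  have hz : ∀ lam, (0 : G.WeightedL2 q t ξ) lam = 0 :=
    (ae_mixedMeasure_iff hm).1 (Lp.coeFn_zero ℂ 2 (G.mixedMeasure q t ξ))
  refine Lp.ext (Eventually.of_forall fun lam => ?_)
  rw [apply_eq_of_mem_closure_preGeneratorGraph hm hp lam, h0]
  simp only [hz, mul_zero, Finset.sum_const_zero, add_zero]

theorem graph_preGenerator (hm : ∀ lam, 0 < G.mixedWeight q t ξ lam) :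
    (G.preGenerator q t ξ).graph = G.preGeneratorGraph q t ξ :=
  Submodule.toLinearPMap_graph_eq _ fun _ hp h0 =>
    snd_eq_zero_of_mem_closure hm (Submodule.le_topologicalClosure _ hp) h0

theorem isClosable_preGenerator (hm : ∀ lam, 0 < G.mixedWeight q t ξ lam) :
    (G.preGenerator q t ξ).IsClosable := by
  refine ⟨(G.preGeneratorGraph q t ξ).topologicalClosure.toLinearPMap, ?_⟩
  rw [graph_preGenerator hm]
  exact (Submodule.toLinearPMap_graph_eq _ fun _ hp h0 => snd_eq_zero_of_mem_closure hm hp h0).symm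

theorem closure_preGenerator_apply (hm : ∀ lam, 0 < G.mixedWeight q t ξ lam)
    {f g : G.WeightedL2 q t ξ}
    (h : (f, g) ∈ (G.preGeneratorGraph q t ξ).topologicalClosure) :
    ∃ hd : f ∈ (G.preGenerator q t ξ).closure.domain,
      (G.preGenerator q t ξ).closure ⟨f, hd⟩ = g := by
  rw [← graph_preGenerator hm,
    (isClosable_preGenerator hm).graph_closure_eq_closure_graph, LinearPMap.mem_graph_iff] at h
  obtain ⟨⟨y, hy⟩, rfl, h2⟩ := h
  exact ⟨hy, h2⟩

end WeightedSpace

section Eigenfunctions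

variable {P : Type*} [PartialOrder P] {G : IdealGraph P} {a : P → ℝ} {t : ℝ}
  {N : SlNetwork (FinIdeal P)} {q : P → ℂ} {H : Module.End ℂ (FinIdeal P →₀ ℂ)}
  [Countable (FinIdeal P)]

/-- The norm of `meixner` in the weighted space with parameter `r ^ 2`. -/
def meixnerScale (a : P → ℝ) (r : ℝ) (lam : FinIdeal P) : ℝ :=
  r ^ lam.size / (1 - r ^ 2) ^ lam.size * realProd a empty lam

/-- The function `meix` is transported into the closure of the graph of the generator: its
truncations are finitely supported, and they converge in the graph norm. -/
theorem IsNetwork.meixner_eigen (hN : G.IsNetwork a t N) (hK : G.IsKerovTriplet q H)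
    (ht : 0 < t) (htH : H (Finsupp.single empty 1) empty = (t : ℂ)) (ha : ∀ x, 0 < a x)
    (hq : ∀ x, q x ^ 2 = ((a x ^ 2 : ℝ) : ℂ)) {r : ℝ} (hr : 0 < r) (hr1 : 0 < 1 - r ^ 2)
    (hm : ∀ lam, 0 < G.mixedWeight q t (r ^ 2) lam) (lam : FinIdeal P)
    (hs : Summable fun rho => N.meix r lam rho ^ 2) :
    (toWeighted hm (SlNetwork.ofRealVec (N.meix r lam) hs),
      (-(lam.size : ℂ)) • toWeighted hm (SlNetwork.ofRealVec (N.meix r lam) hs)) ∈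
      (G.preGeneratorGraph q t (r ^ 2)).topologicalClosure := by
  have hrabs : |r| < 1 := (sq_lt_one_iff_abs_lt_one r).1 (by linarith)
  have hroot : ∀ rho, √(G.mixedWeight q t (r ^ 2) rho) = G.rootWeight a t r rho := fun rho => by
    rw [mixedWeight_eq_sq hK ht htH hq hr1, Real.sqrt_sq (rootWeight_pos ha hr hr1 rho).le]
  have hW : ∀ rho, (G.rootWeight a t r rho : ℂ) ≠ 0 := fun rho => by
    exact_mod_cast (rootWeight_pos ha hr hr1 rho).ne'
  set c : ℂ := (((1 - r ^ 2)⁻¹ : ℝ) : ℂ) with hc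
  have hc1 : c * (1 - r ^ 2) = 1 := by
    rw [hc]
    have : (1 : ℂ) - r ^ 2 ≠ 0 := by exact_mod_cast hr1.ne'
    push_cast
    exact inv_mul_cancel₀ this
  have h1 := (toWeighted hm).continuous.tendsto _ |>.comp (N.tendsto_finVec hs)
  have h2 := (toWeighted hm).continuous.tendsto _ |>.comp
    ((N.tendsto_finVec_markov hrabs lam hs).const_smul c)
  have hlim : c • ((-((1 - r ^ 2) * N.size lam) : ℂ) •
      SlNetwork.ofRealVec (N.meix r lam) hs) =
      (-(lam.size : ℂ)) • SlNetwork.ofRealVec (N.meix r lam) hs := by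
    rw [smul_smul, hN.size_eq]
    congr 1
    linear_combination (-(lam.size : ℂ)) * hc1
  rw [hlim, map_smul] at h2
  refine mem_closure_of_tendsto (h1.prodMk_nhds h2) (Eventually.of_forall fun n => ?_)
  refine (mem_preGeneratorGraph_iff hm).2 ⟨∑ rho ∈ N.ball n,
    Finsupp.single rho ((N.meix r lam rho : ℂ) / G.rootWeight a t r rho), ?_, ?_⟩
  all_goals
    have hval : ∀ rho, (∑ rho ∈ N.ball n, Finsupp.single rho
        ((N.meix r lam rho : ℂ) / G.rootWeight a t r rho)) rho =
          (N.trunc n (N.meix r lam) rho : ℂ) / G.rootWeight a t r rho := by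
      intro rho
      rw [Finsupp.finsetSum_apply]
      simp only [Finsupp.single_apply, Finset.sum_ite_eq', SlNetwork.mem_ball, SlNetwork.trunc]
      split_ifs <;> simp
  · intro rho
    simp only [Function.comp_apply]
    rw [hval, toWeighted_apply, hroot, SlNetwork.finVec_apply]
  · intro rho
    simp only [Function.comp_apply]
    have h3 := hN.rootWeight_mul_jumpFun hK ht htH ha hq hr1 (g := N.trunc n (N.meix r lam))
      (fun rho => by rw [hval, mul_div_cancel₀ _ (hW rho)]) rho
    -- the Markov operator raises the level by at most one
    have h4 : N.trunc (n + 1) (N.markov r (N.trunc n (N.meix r lam))) rho =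
        N.markov r (N.trunc n (N.meix r lam)) rho := by
      rw [SlNetwork.trunc]
      split_ifs with h
      · rfl
      · rw [SlNetwork.markov_trunc, Pi.add_apply, Pi.smul_apply, SlNetwork.trunc,
          SlNetwork.boundary, if_neg (by omega), if_neg (by omega), if_neg (by omega)]
        simp
    rw [toWeighted_apply, hroot, lp.coeFn_smul, Pi.smul_apply, SlNetwork.finVec_apply, h4,
      div_eq_iff (hW rho), mul_comm (G.jumpFun _ _ _ _ _), h3, Complex.ofReal_mul, smul_eq_mul]

end Eigenfunctions

end IdealGraph

/-! ### Integration of `U - D` -/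

namespace IdealGraph

open FinIdeal

section Integration

variable {P : Type*} [PartialOrder P] {G : IdealGraph P} {a : P → ℝ} {t : ℝ}
  {N : SlNetwork (FinIdeal P)} {q : P → ℂ} {H : Module.End ℂ (FinIdeal P →₀ ℂ)}

theorem toEll2_single (lam : FinIdeal P) (c : ℂ) :
    toEll2 (Finsupp.single lam c) = lp.single (E := fun _ : FinIdeal P => ℂ) 2 lam c := by
  rw [toEll2, Finsupp.sum_single_index (lp.single_zero 2 lam)]

theorem toEll2_add (f g : FinIdeal P →₀ ℂ) : toEll2 (f + g) = toEll2 f + toEll2 g :=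
  Finsupp.sum_add_index' (fun lam => lp.single_zero 2 lam) fun lam b c =>
    lp.single_add (E := fun _ : FinIdeal P => ℂ) 2 lam b c

theorem toEll2_apply (f : FinIdeal P →₀ ℂ) (lam : FinIdeal P) : toEll2 f lam = f lam := by
  induction f using Finsupp.induction_linear with
  | zero => simp [toEll2]
  | add f g hf hg => rw [toEll2_add, lp.coeFn_add, Pi.add_apply, hf, hg, Finsupp.add_apply]
  | single mu c =>
    rw [toEll2_single, lp.coeFn_single, Pi.single_apply, Finsupp.single_apply]
    simp [eq_comm]

theorem toEll2_smul (c : ℂ) (f : FinIdeal P →₀ ℂ) : toEll2 (c • f) = c • toEll2 f := by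
  ext lam
  rw [lp.coeFn_smul, Pi.smul_apply, toEll2_apply, toEll2_apply, Finsupp.smul_apply]

/-- The two descriptions of `(U - D) 1_lam` agree. -/
theorem IsNetwork.toEll2_sub (hN : G.IsNetwork a t N) (hq : ∀ x, q x = (a x : ℂ))
    (lam : FinIdeal P) :
    toEll2 ((G.upOp q - G.downOp q) (Finsupp.single lam 1)) = N.genVec lam := by
  have hbox : ∀ mu nu, boxProd q mu nu = (realProd a mu nu : ℂ) := fun mu nu => by
    rw [← boxProd_ofReal]
    congr 1
    ext x
    exact hq x
  have hw : ∀ x y, (if Covers x y then 1 * ((G.mult x y : ℂ) * boxProd q x y) else 0) =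
      (N.w x y : ℂ) := fun x y => by
    rw [hN.w_eq, edgeWeight, hbox]
    split_ifs <;> simp
  ext rho
  rw [toEll2_apply, LinearMap.sub_apply, Finsupp.sub_apply, upOp_single, downOp_single, hw, hw,
    SlNetwork.genVec, lp.coeFn_sub, Pi.sub_apply, lp.coeFn_sum, lp.coeFn_sum, Finset.sum_apply,
    Finset.sum_apply]
  simp only [lp.coeFn_smul, Pi.smul_apply, lp.coeFn_single, Pi.single_apply, smul_eq_mul, mul_ite,
    mul_one, mul_zero, Finset.sum_ite_eq, N.mem_level]
  congr 1
  · split_ifs with h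
    · rfl
    · rw [N.w_eq_zero _ _ h, Complex.ofReal_zero]
  · split_ifs with h
    · rfl
    · rw [N.w_eq_zero _ _ (by omega), Complex.ofReal_zero]

theorem IsNetwork.isIntegral_group (hN : G.IsNetwork a t N) (hq : ∀ x, q x = (a x : ℂ)) :
    G.IsIntegral q N.group where
  map_zero := by
    ext1 f
    exact N.evolve_zero f
  map_add r s := by
    ext1 f
    exact N.evolve_add r s f
  continuous f := N.continuous_evolve f
  deriv f := by
    induction f using Finsupp.induction_linear with
    | zero =>
      have h0 : toEll2 (0 : FinIdeal P →₀ ℂ) = 0 := Finsupp.sum_zero_index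
      rw [map_zero, h0]
      simpa using hasDerivAt_const (0 : ℝ) (0 : Ell2 P)
    | add f g hf hg =>
      rw [map_add, toEll2_add, toEll2_add]
      simpa only [map_add] using hf.fun_add hg
    | single lam c =>
      have h1 : Finsupp.single lam c = c • Finsupp.single lam (1 : ℂ) := by simp
      rw [h1, map_smul, toEll2_smul, toEll2_smul, hN.toEll2_sub hq, toEll2_single]
      simpa only [map_smul, SlNetwork.group_apply] using
        (N.hasDerivAt_evolve_single lam).fun_const_smul c

end Integration

end IdealGraph

end

theorem mainTheorem1 {P : Type*} [PartialOrder P] (G : IdealGraph P) (q : P → ℂ)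
    (H : Module.End ℂ (FinIdeal P →₀ ℂ)) (hK : G.IsKerovTriplet q H)
    (t : ℝ) (ht : 0 < t) (htH : H (Finsupp.single FinIdeal.empty 1) FinIdeal.empty = (t : ℂ))
    (hpos : G.IsPositive q) (ξ : ℝ) (hξ0 : 0 < ξ) (hξ1 : ξ < 1) :
    -- the functions `𝔐_lam` belong to the weighted space
    (∃ hL : ∀ lam : FinIdeal P, MemLp (G.meixner q ξ lam) 2 (G.mixedMeasure q t ξ),
      -- the generator is well defined, and the `𝔐_lam` are its eigenfunctions
      (G.preGenerator q t ξ).IsClosable ∧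
      (∀ lam : FinIdeal P, ∃ hd : (hL lam).toLp ∈ (G.preGenerator q t ξ).closure.domain,
        (G.preGenerator q t ξ).closure ⟨(hL lam).toLp, hd⟩ =
          (-(lam.size : ℂ)) • (hL lam).toLp) ∧
      -- the `𝔐_lam` form an orthogonal basis with the given squared norms
      (∀ lam mu : FinIdeal P, inner ℂ (hL mu).toLp (hL lam).toLp =
        if lam = mu then
          ((ξ ^ lam.size / (1 - ξ) ^ (2 * lam.size) : ℝ) : ℂ) *
            FinIdeal.boxProd (fun x => q x ^ 2) FinIdeal.empty lam
        else 0) ∧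
      (∀ lam : FinIdeal P, (hL lam).toLp ≠ 0) ∧
      (Submodule.span ℂ (Set.range fun lam : FinIdeal P => (hL lam).toLp)).topologicalClosure
        = ⊤) ∧
    -- `U - D` integrates to a unitary group, which takes the basis vectors to the `𝔉_lam`
    ((∀ x : P, (q x).im = 0 ∧ 0 < (q x).re) →
      (∃ V : ℝ → (FinIdeal.Ell2 P ≃ₗᵢ[ℂ] FinIdeal.Ell2 P), G.IsIntegral q V) ∧
      ∀ V : ℝ → (FinIdeal.Ell2 P ≃ₗᵢ[ℂ] FinIdeal.Ell2 P), G.IsIntegral q V →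
        ∀ lam rho : FinIdeal P,
          (V (Real.artanh (Real.sqrt ξ)) (FinIdeal.toEll2 (Finsupp.single lam 1)) :
            FinIdeal P → ℂ) rho = G.frakF q t ξ lam rho) := by
  have hq := fun x => hpos.sq_eq hK ht htH x
  set a : P → ℝ := fun x => ‖q x‖ with ha_def
  have ha : ∀ x, 0 < a x := fun x => norm_pos_iff.2 (hq x).1
  have hq2 : ∀ x, q x ^ 2 = ((a x ^ 2 : ℝ) : ℂ) := fun x => (hq x).2
  -- the network for the absolute values of `q`
  set N := G.network a t ht (hK.comm_edgeWeight hq htH) with hN_def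
  have hN : G.IsNetwork a t N := ⟨rfl, rfl, rfl, rfl⟩
  have : Countable (FinIdeal P) := G.countable_finIdeal
  set r := √ξ with hr_def
  have hr : 0 < r := Real.sqrt_pos.2 hξ0
  have hrξ : r ^ 2 = ξ := Real.sq_sqrt hξ0.le
  have hr1 : 0 < 1 - r ^ 2 := by rw [hrξ]; linarith
  have hrlt : r < 1 := (Real.sqrt_lt' one_pos).2 (by simpa using hξ1)
  -- the time of the flow at which the explicit solutions are the Meixner functions, up to scalars
  -- and the square root of the weights
  set s := Real.artanh r with hs_def
  have htanh : Real.tanh s = r := Real.tanh_artanh ⟨by linarith, hrlt⟩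
  have hflow : ∀ lam, N.flow lam s = N.meix r lam := fun lam => by rw [SlNetwork.flow, htanh]
  rw [← hrξ]
  have hroot : ∀ rho, √(G.mixedWeight q t (r ^ 2) rho) = G.rootWeight a t r rho := fun rho => by
    rw [IdealGraph.mixedWeight_eq_sq hK ht htH hq2 hr1,
      Real.sqrt_sq (IdealGraph.rootWeight_pos ha hr hr1 rho).le]
  have hm : ∀ rho, 0 < G.mixedWeight q t (r ^ 2) rho := fun rho => by
    rw [← Real.sqrt_pos, hroot]
    exact IdealGraph.rootWeight_pos ha hr hr1 rho
  -- the Meixner functions are the scalars `K lam` times an orthonormal family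
  set K : FinIdeal P → ℝ := IdealGraph.meixnerScale a r with hK_def
  have hK0 : ∀ lam, (K lam : ℂ) ≠ 0 := fun lam => by
    have : 0 < K lam := mul_pos (div_pos (pow_pos hr _) (pow_pos hr1 _))
      (FinIdeal.realProd_pos ha _ _)
    exact_mod_cast this.ne'
  have hmeix : ∀ lam rho, (√(G.mixedWeight q t (r ^ 2) rho) : ℂ) * G.meixner q (r ^ 2) lam rho =
      ((K lam : ℂ) • N.flowVec s lam : FinIdeal.Ell2 P) rho := fun lam rho => by
    rw [hroot, hN.meixner_eq ha hq2 hr hr1, lp.coeFn_smul, Pi.smul_apply, smul_eq_mul,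
      SlNetwork.flowVec_apply, hflow, ← Complex.ofReal_mul]
    rfl
  have hL : ∀ lam, MemLp (G.meixner q (r ^ 2) lam) 2 (G.mixedMeasure q t (r ^ 2)) := fun lam =>
    IdealGraph.memLp_mixedMeasure hm (hmeix lam)
  have hLp : ∀ lam, (hL lam).toLp =
      (K lam : ℂ) • IdealGraph.toWeighted hm (N.flowVec s lam) := fun lam => by
    rw [IdealGraph.toLp_eq_toWeighted hm (hmeix lam), map_smul]
  have hinner : ∀ lam mu, inner ℂ (N.flowVec s mu) (N.flowVec s lam) =
      if lam = mu then (1 : ℂ) else 0 := fun lam mu => by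
    rw [orthonormal_iff_ite.1 (N.orthonormal_flowVec s)]
    simp [eq_comm]
  refine ⟨⟨hL, IdealGraph.isClosable_preGenerator hm, fun lam => ?_, fun lam mu => ?_,
    fun lam => ?_, ?_⟩, fun hqpos => ?_⟩
  · refine IdealGraph.closure_preGenerator_apply hm ?_
    have h1 := hN.meixner_eigen hK ht htH ha hq2 hr hr1 hm lam
      (by rw [← hflow]; exact N.summable_sq_flow lam s)
    have h2 := Submodule.smul_mem _ (K lam : ℂ) h1
    have h3 : SlNetwork.ofRealVec (N.meix r lam)
        (by rw [← hflow]; exact N.summable_sq_flow lam s) = N.flowVec s lam := by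
      ext rho
      change ((N.meix r lam rho : ℝ) : ℂ) = ((N.flow lam s rho : ℝ) : ℂ)
      rw [hflow]
    rw [h3] at h2
    rw [hLp, smul_comm]
    exact h2
  · rw [hLp, hLp, inner_smul_left, inner_smul_right, LinearIsometryEquiv.inner_map_map, hinner]
    split_ifs with h
    · subst h
      rw [FinIdeal.boxProd_sq_eq hq2, Complex.conj_ofReal, mul_one, ← Complex.ofReal_mul,
        ← Complex.ofReal_mul]
      congr 1
      rw [hK_def, IdealGraph.meixnerScale]
      field_simp
      ring
    · simp
  · rw [hLp]
    refine smul_ne_zero (hK0 lam) ?_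
    rw [Ne, LinearIsometryEquiv.map_eq_zero_iff]
    exact (N.orthonormal_flowVec s).ne_zero lam
  · rw [Submodule.topologicalClosure_eq_top_iff, Submodule.eq_bot_iff]
    intro g hg
    -- the coefficients of `g` in the orthonormal family are the values of its image under the
    -- group at time `-s`
    have h1 : N.evolve (-s) ((IdealGraph.toWeighted hm).symm g) = 0 := by
      ext lam
      have h2 : inner ℂ (hL lam).toLp g = 0 :=
        hg _ (Submodule.subset_span ⟨lam, rfl⟩)
      rw [hLp, inner_smul_left, mul_eq_zero] at h2
      have h3 := h2.resolve_left (by simpa using hK0 lam)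
      rw [SlNetwork.evolve_apply, neg_neg, ← (IdealGraph.toWeighted hm).inner_map_map,
        LinearIsometryEquiv.apply_symm_apply, h3]
      rfl
    have h4 := (map_eq_zero_iff _ (N.evolve (-s)).injective).1 h1
    exact (LinearIsometryEquiv.map_eq_zero_iff _).1 h4
  · have hqa : ∀ x, q x = (a x : ℂ) := fun x => by
      obtain ⟨him, hre⟩ := hqpos x
      have h1 : q x = ((q x).re : ℂ) := Complex.ext (by simp) (by simpa using him)
      rw [ha_def]
      simp only
      rw [h1, Complex.norm_real, Real.norm_of_nonneg hre.le]
    refine ⟨⟨N.group, hN.isIntegral_group hqa⟩, fun V hV lam rho => ?_⟩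
    have h1 := N.eq_flowVec_of_hasDerivAt hV.map_zero hV.map_add (fun lam => by
      rw [← hN.toEll2_sub hqa]
      simpa only [IdealGraph.toEll2_single] using hV.deriv (Finsupp.single lam 1)) s lam
    rw [IdealGraph.toEll2_single]
    rw [hN.frakF_eq ha hK ht htH hqa hr hr1, ← hflow, ← SlNetwork.flowVec_apply, ← h1]
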